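/- Let $\pi:Y\to X$ be a smooth fibration (surjective submersion) of smooth, Hausdorff, second countable manifolds with $\dim X=n+1$, $\dim Y=n+1+m$, and let $\eta$ be a volume form on $X$. Let $Z=J^1\pi$ be the first jet bundle, with projections $\pi_{XZ}:Z\to X$ and $\pi_{YZ}:Z\to Y$, and let $j^1\phi:X\to Z$ denote the first jet prolongation of a section $\phi$ of $\pi$. Let $L:Z\to\mathbb R$ be a smooth Lagrangian, $\mathcal L=L\,\pi_{XZ}^*\eta$ the Lagrangian form, and $$\Theta_L=\mathcal L+(S_\eta)^*(dL),\qquad \Omega_L=-d\Theta_L$$ the Poincaré–Cartan forms, where the vertical endomorphism $S_\eta$ is the $TZ$-valued $(n+1)$-form $$(S_\eta)_{j^1_x\phi}(V_0,\dots,V_n)=\sum_{i=0}^n\Big((-1)^i\,\eta\big(\,\cdot\,,T\pi_{XZ}V_0,\dots,\widehat{T\pi_{XZ}V_i},\dots,T\pi_{XZ}V_n\big)\otimes\big(T\pi_{YZ}V_i-T_x\phi(T\pi_{XZ}V_i)\big)\Big)^v ,$$ and $f^v=\frac{d}{dt}\big|_{t=0}(j^1_x\phi+tf)$ is the vertical lift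 of $f\in T_x^*X\otimes\ker T_{\phi(x)}\pi$. In induced coordinates $(x^\mu,y^i,z^i_\mu)$ with $\eta=d^{n+1}x$ this is $\Theta_L=L\,d^{n+1}x+\frac{\partial L}{\partial z^i_\mu}(dy^i-z^i_\nu dx^\nu)\wedge d^nx_\mu$, where $d^nx_\mu=\iota_{\partial/\partial x^\mu}d^{n+1}x$. A smooth section $\phi$ of $\pi$ is called an extremal of the action if, for every compact $(n+1)$-dimensional submanifold $C\subseteq X$ with (possibly empty) boundary and every $\pi$-projectable smooth vector field $\xi_Y$ on $Y$, with projection $\xi_X$, which vanishes at all points of $\phi(\partial C)$ (fixed values on $\partial C$), $$\frac{d}{dt}\Big|_{t=0}\int_C (j^1\phi_t)^*\mathcal L=0,\qquad \phi_t=\Phi^Y_t\circ\phi\circ\Phi^X_{-t},$$ where $\Phi^Y$, $\Phi^X$ are the local flows of $\xi_Y$, $\xi_X$ (so that, for small $|t|$, $\phi_t$ is a section of $\pi$ on a neighbourhood of $C$), and $X$ is oriented by $\eta$. Then a smooth section $\phi$ of $\pi$ is an extremal of the action if and only if $$(j^1\phi)^*(\iota_\xi\Omega_L)=0$$ for every smooth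 vector field $\xi$ on $Z$. -/

import Mathlib

open Set Filter Topology MeasureTheory Manifold
open scoped ContDiff

noncomputable section
namespace ClassicalField

/-- The model space `ℝ^{n+1}` of the base. -/
abbrev EBase (n : ℕ) := EuclideanSpace ℝ (Fin (n + 1))

/-- The model space `ℝ^m` of the fibres. -/
abbrev EFib (m : ℕ) := EuclideanSpace ℝ (Fin m)

/-- The model space `ℝ^{n+1+m}` of the total space. -/
abbrev ETot (n m : ℕ) := EuclideanSpace ℝ (Fin (n + 1 + m))

/-- The model space of the first jet bundle, with coordinates `((x^μ, y^i), z^i_μ)`. -/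
abbrev EJet (n m : ℕ) := (EBase n × EFib m) × (EBase n →L[ℝ] EFib m)

/-- A smooth fibration `π : Y → X`: a surjective submersion of an `(n+1+m)`-dimensional manifold
onto an `(n+1)`-dimensional one. -/
structure Fibration (n m : ℕ) (X Y : Type*)
    [TopologicalSpace X] [ChartedSpace (EBase n) X]
    [TopologicalSpace Y] [ChartedSpace (ETot n m) Y] where
  proj : Y → X
  surjective : Function.Surjective proj
  submersion : IsSubmersionOfComplement (EFib m) (𝓡 (n + 1 + m)) (𝓡 (n + 1)) ∞ proj

section Jet

variable {n m : ℕ} {X Y : Type*}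
  [TopologicalSpace X] [ChartedSpace (EBase n) X]
  [TopologicalSpace Y] [ChartedSpace (ETot n m) Y]

/-- The differential `T_yπ` of the projection. -/
def Fibration.dproj (P : Fibration n m X Y) (y : Y) : ETot n m →L[ℝ] EBase n :=
  mfderiv (𝓡 (n + 1 + m)) (𝓡 (n + 1)) P.proj y

theorem Fibration.contMDiff (P : Fibration n m X Y) :
    ContMDiff (𝓡 (n + 1 + m)) (𝓡 (n + 1)) ∞ P.proj := P.submersion.contMDiff

/-- The first jet bundle `J¹π`: a 1-jet of a local section is given by its value `y` together with
its differential at `π y`, which is a linear section of `T_yπ`. -/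
@[ext]
structure Jet (P : Fibration n m X Y) where
  pt : Y
  lin : EBase n →L[ℝ] ETot n m
  dproj_lin : (P.dproj pt).comp lin = ContinuousLinearMap.id ℝ (EBase n)

/-- Fibered coordinates `(x^μ, y^i)` on `Y` over coordinates `(x^μ)` on `X`. -/
structure FiberedChart (P : Fibration n m X Y) where
  base : OpenPartialHomeomorph X (EBase n)
  total : OpenPartialHomeomorph Y (EBase n × EFib m)
  base_smooth : ContMDiffOn (𝓡 (n + 1)) 𝓘(ℝ, EBase n) ∞ base base.source
  base_symm_smooth : ContMDiffOn 𝓘(ℝ, EBase n) (𝓡 (n + 1)) ∞ base.symm base.target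
  total_smooth : ContMDiffOn (𝓡 (n + 1 + m)) 𝓘(ℝ, EBase n × EFib m) ∞ total total.source
  total_symm_smooth :
    ContMDiffOn 𝓘(ℝ, EBase n × EFib m) (𝓡 (n + 1 + m)) ∞ total.symm total.target
  proj_mem : ∀ y ∈ total.source, P.proj y ∈ base.source
  base_proj : ∀ y ∈ total.source, base (P.proj y) = (total y).1

variable {P : Fibration n m X Y}

namespace FiberedChart

/-- The differential of the coordinates on `X`. -/
def dBase (c : FiberedChart P) (x : X) : EBase n →L[ℝ] EBase n :=
  mfderiv (𝓡 (n + 1)) 𝓘(ℝ, EBase n) c.base x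

/-- The differential of the inverse of the coordinates on `X`. -/
def dBaseSymm (c : FiberedChart P) (u : EBase n) : EBase n →L[ℝ] EBase n :=
  mfderiv 𝓘(ℝ, EBase n) (𝓡 (n + 1)) c.base.symm u

/-- The differential of the coordinates on `Y`. -/
def dTot (c : FiberedChart P) (y : Y) : ETot n m →L[ℝ] EBase n × EFib m :=
  mfderiv (𝓡 (n + 1 + m)) 𝓘(ℝ, EBase n × EFib m) c.total y

/-- The differential of the inverse of the coordinates on `Y`. -/
def dTotSymm (c : FiberedChart P) (u : EBase n × EFib m) : EBase n × EFib m →L[ℝ] ETot n m :=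
  mfderiv 𝓘(ℝ, EBase n × EFib m) (𝓡 (n + 1 + m)) c.total.symm u

theorem mdiffAt_base (c : FiberedChart P) {x : X} (hx : x ∈ c.base.source) :
    MDifferentiableAt (𝓡 (n + 1)) 𝓘(ℝ, EBase n) c.base x :=
  (c.base_smooth.contMDiffAt (c.base.open_source.mem_nhds hx)).mdifferentiableAt (by simp)

theorem mdiffAt_base_symm (c : FiberedChart P) {u : EBase n} (hu : u ∈ c.base.target) :
    MDifferentiableAt 𝓘(ℝ, EBase n) (𝓡 (n + 1)) c.base.symm u :=
  (c.base_symm_smooth.contMDiffAt (c.base.open_target.mem_nhds hu)).mdifferentiableAt (by simp)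

theorem mdiffAt_total (c : FiberedChart P) {y : Y} (hy : y ∈ c.total.source) :
    MDifferentiableAt (𝓡 (n + 1 + m)) 𝓘(ℝ, EBase n × EFib m) c.total y :=
  (c.total_smooth.contMDiffAt (c.total.open_source.mem_nhds hy)).mdifferentiableAt (by simp)

theorem mdiffAt_total_symm (c : FiberedChart P) {u : EBase n × EFib m} (hu : u ∈ c.total.target) :
    MDifferentiableAt 𝓘(ℝ, EBase n × EFib m) (𝓡 (n + 1 + m)) c.total.symm u :=
  (c.total_symm_smooth.contMDiffAt (c.total.open_target.mem_nhds hu)).mdifferentiableAt (by simp)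

theorem dBaseSymm_comp_dBase (c : FiberedChart P) {x : X} (hx : x ∈ c.base.source) :
    (c.dBaseSymm (c.base x)).comp (c.dBase x) = ContinuousLinearMap.id ℝ (EBase n) := by
  have h := mfderiv_comp x (c.mdiffAt_base_symm (c.base.map_source hx)) (c.mdiffAt_base hx)
  refine h.symm.trans ?_
  have he : (c.base.symm ∘ c.base) =ᶠ[𝓝 x] id := by
    filter_upwards [c.base.open_source.mem_nhds hx] with y hy using c.base.left_inv hy
  rw [he.mfderiv_eq]
  exact mfderiv_id

theorem dBase_comp_dBaseSymm (c : FiberedChart P) {x : X} (hx : x ∈ c.base.source) :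
    (c.dBase x).comp (c.dBaseSymm (c.base x)) = ContinuousLinearMap.id ℝ (EBase n) := by
  have hd := c.mdiffAt_base hx
  have hu := c.base.map_source hx
  rw [← c.base.left_inv hx] at hd
  have h := mfderiv_comp (c.base x) hd (c.mdiffAt_base_symm hu)
  rw [c.base.left_inv hx] at h
  refine h.symm.trans ?_
  have he : (c.base ∘ c.base.symm) =ᶠ[𝓝 (c.base x)] id := by
    filter_upwards [c.base.open_target.mem_nhds hu] with y hy using c.base.right_inv hy
  rw [he.mfderiv_eq]
  exact mfderiv_id

theorem dTotSymm_comp_dTot (c : FiberedChart P) {y : Y} (hy : y ∈ c.total.source) :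
    (c.dTotSymm (c.total y)).comp (c.dTot y) = ContinuousLinearMap.id ℝ (ETot n m) := by
  have h := mfderiv_comp y (c.mdiffAt_total_symm (c.total.map_source hy)) (c.mdiffAt_total hy)
  refine h.symm.trans ?_
  have he : (c.total.symm ∘ c.total) =ᶠ[𝓝 y] id := by
    filter_upwards [c.total.open_source.mem_nhds hy] with y hy using c.total.left_inv hy
  rw [he.mfderiv_eq]
  exact mfderiv_id

theorem dTot_comp_dTotSymm (c : FiberedChart P) {y : Y} (hy : y ∈ c.total.source) :
    (c.dTot y).comp (c.dTotSymm (c.total y)) = ContinuousLinearMap.id ℝ (EBase n × EFib m) := by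
  have hd := c.mdiffAt_total hy
  have hu := c.total.map_source hy
  rw [← c.total.left_inv hy] at hd
  have h := mfderiv_comp (c.total y) hd (c.mdiffAt_total_symm hu)
  rw [c.total.left_inv hy] at h
  refine h.symm.trans ?_
  have he : (c.total ∘ c.total.symm) =ᶠ[𝓝 (c.total y)] id := by
    filter_upwards [c.total.open_target.mem_nhds hu] with y hy using c.total.right_inv hy
  rw [he.mfderiv_eq]
  exact mfderiv_id

theorem fst_comp_dTot (c : FiberedChart P) {y : Y} (hy : y ∈ c.total.source) :
    (ContinuousLinearMap.fst ℝ (EBase n) (EFib m)).comp (c.dTot y)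
      = (c.dBase (P.proj y)).comp (P.dproj y) := by
  have h1 := mfderiv_comp y (c.mdiffAt_base (c.proj_mem y hy))
    ((P.contMDiff y).mdifferentiableAt (by simp))
  have h2 := mfderiv_comp y
    ((ContinuousLinearMap.fst ℝ (EBase n) (EFib m)).mdifferentiableAt (x := c.total y))
    (c.mdiffAt_total hy)
  rw [ContinuousLinearMap.mfderiv_eq] at h2
  refine h2.symm.trans (Eq.trans ?_ h1)
  apply Filter.EventuallyEq.mfderiv_eq
  filter_upwards [c.total.open_source.mem_nhds hy] with y hy using (c.base_proj y hy).symm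

theorem dproj_comp_lift (c : FiberedChart P) {u : EBase n × EFib m} (hu : u ∈ c.total.target)
    (B : EBase n →L[ℝ] EFib m) :
    (P.dproj (c.total.symm u)).comp ((c.dTotSymm u).comp
      (((ContinuousLinearMap.id ℝ (EBase n)).prod B).comp
        (c.dBase (P.proj (c.total.symm u))))) = ContinuousLinearMap.id ℝ (EBase n) := by
  have hy := c.total.map_target hu
  have hx := c.proj_mem _ hy
  have h1 := c.dBaseSymm_comp_dBase hx
  have h2 := c.dTot_comp_dTotSymm hy
  have h3 := c.fst_comp_dTot hy
  rw [c.total.right_inv hu] at h2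
  ext1 v
  have e1 := fun w ↦ congrArg (fun f ↦ f w) h1
  have e2 := fun w ↦ congrArg (fun f ↦ f w) h2
  have e3 := fun w ↦ congrArg (fun f ↦ f w) h3
  simp only [ContinuousLinearMap.comp_apply, ContinuousLinearMap.id_apply] at e1 e2 e3 ⊢
  rw [← e1 (P.dproj _ _), ← e3, e2]
  simpa using e1 v

open Classical in
/-- The coordinates `((x^μ, y^i), z^i_μ)` on the jet bundle induced by fibered coordinates: the
matrix `z^i_μ` is the coordinate expression of the fibre components of the differential.
The jet `z₀` is only used as the value of the inverse outside of the target. -/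
def jetChart (c : FiberedChart P) (z₀ : Jet P) : PartialEquiv (Jet P) (EJet n m) where
  toFun z := (c.total z.pt, (ContinuousLinearMap.snd ℝ (EBase n) (EFib m)).comp
    ((c.dTot z.pt).comp (z.lin.comp (c.dBaseSymm (c.base (P.proj z.pt))))))
  invFun p :=
    if h : p.1 ∈ c.total.target then
      { pt := c.total.symm p.1
        lin := (c.dTotSymm p.1).comp (((ContinuousLinearMap.id ℝ (EBase n)).prod p.2).comp
          (c.dBase (P.proj (c.total.symm p.1))))
        dproj_lin := c.dproj_comp_lift h p.2 }
    else z₀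
  source := {z | z.pt ∈ c.total.source}
  target := {p | p.1 ∈ c.total.target}
  map_source' z hz := c.total.map_source hz
  map_target' p hp := by
    have hp' : p.1 ∈ c.total.target := hp
    simp [hp']
  left_inv' z hz := by
    have hz' : z.pt ∈ c.total.source := hz
    have hx := c.proj_mem _ hz'
    have e1 := fun w ↦ congrArg (fun f ↦ f w) (c.dBaseSymm_comp_dBase hx)
    have e2 := fun w ↦ congrArg (fun f ↦ f w) (c.dTotSymm_comp_dTot hz')
    have e3 := fun w ↦ congrArg (fun f ↦ f w) (c.fst_comp_dTot hz')
    have e4 := fun w ↦ congrArg (fun f ↦ f w) z.dproj_lin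
    simp only [ContinuousLinearMap.comp_apply, ContinuousLinearMap.id_apply] at e1 e2 e3 e4
    rw [dif_pos (c.total.map_source hz')]
    ext1
    · exact c.total.left_inv hz'
    · ext1 v
      simp only [ContinuousLinearMap.comp_apply, ContinuousLinearMap.prod_apply,
        ContinuousLinearMap.id_apply, c.total.left_inv hz', e1]
      refine Eq.trans ?_ (e2 (z.lin v))
      congr 1
      refine Prod.ext ?_ rfl
      have := e3 (z.lin v)
      rw [e4] at this
      exact this.symm
  right_inv' p hp := by
    have hp' : p.1 ∈ c.total.target := hp
    have hy := c.total.map_target hp'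
    have hx := c.proj_mem _ hy
    have h2 := c.dTot_comp_dTotSymm hy
    rw [c.total.right_inv hp'] at h2
    have e1 := fun w ↦ congrArg (fun f ↦ f w) (c.dBase_comp_dBaseSymm hx)
    have e2 := fun w ↦ congrArg (fun f ↦ f w) h2
    simp only [ContinuousLinearMap.comp_apply, ContinuousLinearMap.id_apply] at e1 e2
    rw [dif_pos hp']
    refine Prod.ext (c.total.right_inv hp') ?_
    ext1 v
    simp only [ContinuousLinearMap.comp_apply, e1, e2]
    rfl

/-- The change of coordinates on `X`. -/
def baseChange (c c' : FiberedChart P) : EBase n → EBase n := c'.base ∘ c.base.symm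

/-- The change of coordinates on `Y`. -/
def totChange (c c' : FiberedChart P) : EBase n × EFib m → EBase n × EFib m :=
  c'.total ∘ c.total.symm

theorem contDiffOn_baseChange (c c' : FiberedChart P) :
    ContDiffOn ℝ ∞ (c.baseChange c') (c.base.symm.trans c'.base).source := by
  rw [← contMDiffOn_iff_contDiffOn]
  refine c'.base_smooth.comp (c.base_symm_smooth.mono ?_) ?_
  · exact fun x hx ↦ hx.1
  · exact fun x hx ↦ hx.2

theorem contDiffOn_totChange (c c' : FiberedChart P) :
    ContDiffOn ℝ ∞ (c.totChange c') (c.total.symm.trans c'.total).source := by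
  rw [← contMDiffOn_iff_contDiffOn]
  refine c'.total_smooth.comp (c.total_symm_smooth.mono ?_) ?_
  · exact fun x hx ↦ hx.1
  · exact fun x hx ↦ hx.2

theorem jetChart_trans_source (c c' : FiberedChart P) (z₀ z₁ : Jet P) :
    ((c.jetChart z₀).symm.trans (c'.jetChart z₁)).source
      = Prod.fst ⁻¹' (c.total.symm.trans c'.total).source := by
  ext p
  constructor
  · rintro ⟨h1, h2⟩
    have h1' : p.1 ∈ c.total.target := h1
    refine ⟨h1, ?_⟩
    have h2' : ((c.jetChart z₀).symm p).pt ∈ c'.total.source := h2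
    simpa [jetChart, h1'] using h2'
  · rintro ⟨h1, h2⟩
    have h1' : p.1 ∈ c.total.target := h1
    refine ⟨h1, ?_⟩
    change ((c.jetChart z₀).symm p).pt ∈ c'.total.source
    simpa [jetChart, h1'] using h2

theorem jetChart_trans_eqOn (c c' : FiberedChart P) (z₀ z₁ : Jet P) :
    EqOn ((c.jetChart z₀).symm.trans (c'.jetChart z₁))
      (fun p ↦ (c.totChange c' p.1, (ContinuousLinearMap.snd ℝ (EBase n) (EFib m)).comp
        ((fderiv ℝ (c.totChange c') p.1).comp
          (((ContinuousLinearMap.id ℝ (EBase n)).prod p.2).comp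
            (fderiv ℝ (c'.baseChange c) (c.totChange c' p.1).1)))))
      ((c.jetChart z₀).symm.trans (c'.jetChart z₁)).source := by
  intro p hp
  rw [jetChart_trans_source] at hp
  obtain ⟨h1, h2⟩ := hp
  have h1' : p.1 ∈ c.total.target := h1
  have h2' : c.total.symm p.1 ∈ c'.total.source := h2
  have hs : (c.jetChart z₀).symm p = ⟨c.total.symm p.1, _, c.dproj_comp_lift h1' p.2⟩ :=
    dif_pos h1'
  have hx := c.proj_mem _ (c.total.map_target h1')
  have hx' := c'.proj_mem _ h2'
  change c'.jetChart z₁ ((c.jetChart z₀).symm p) = _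
  rw [hs]
  have hT : (c'.dTot (c.total.symm p.1)).comp (c.dTotSymm p.1)
      = fderiv ℝ (c.totChange c') p.1 := by
    rw [← mfderiv_eq_fderiv]
    exact (mfderiv_comp p.1 (c'.mdiffAt_total h2') (c.mdiffAt_total_symm h1')).symm
  have hq : (c.totChange c' p.1).1 = c'.base (P.proj (c.total.symm p.1)) :=
    (c'.base_proj _ h2').symm
  have hB : (c.dBase (P.proj (c.total.symm p.1))).comp
      (c'.dBaseSymm (c'.base (P.proj (c.total.symm p.1))))
      = fderiv ℝ (c'.baseChange c) (c.totChange c' p.1).1 := by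
    rw [← mfderiv_eq_fderiv, hq]
    have hd := c.mdiffAt_base hx
    rw [← c'.base.left_inv hx'] at hd
    have h := mfderiv_comp (c'.base (P.proj (c.total.symm p.1))) hd
      (c'.mdiffAt_base_symm (c'.base.map_source hx'))
    rw [c'.base.left_inv hx'] at h
    exact h.symm
  refine Prod.ext rfl ?_
  beta_reduce
  rw [← hT, ← hB]
  rfl

theorem contDiffOn_jetChart_trans (c c' : FiberedChart P) (z₀ z₁ : Jet P) :
    ContDiffOn ℝ ∞ ((c.jetChart z₀).symm.trans (c'.jetChart z₁))
      ((c.jetChart z₀).symm.trans (c'.jetChart z₁)).source := by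
  refine ContDiffOn.congr ?_ (c.jetChart_trans_eqOn c' z₀ z₁)
  rw [jetChart_trans_source]
  have hT := (c.contDiffOn_totChange c')
  have hT' := hT.fderiv_of_isOpen (m := ∞) (c.total.symm.trans c'.total).open_source (by simp)
  have hB' := (c'.contDiffOn_baseChange c).fderiv_of_isOpen (m := ∞)
    (c'.base.symm.trans c.base).open_source (by simp)
  have hfst : ContDiffOn ℝ ∞ (fun p : EJet n m ↦ p.1)
      (Prod.fst ⁻¹' (c.total.symm.trans c'.total).source) := contDiff_fst.contDiffOn
  have h1 := hT.comp hfst (fun p hp ↦ hp)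
  have h2 := hT'.comp hfst (fun p hp ↦ hp)
  have h3 := hB'.comp (g := fderiv ℝ (c'.baseChange c)) (contDiff_fst.comp_contDiffOn h1) (by
    rintro p ⟨hp1, hp2⟩
    have hp1' : p.1 ∈ c.total.target := hp1
    have hp2' : c.total.symm p.1 ∈ c'.total.source := hp2
    have hq : (c.totChange c' p.1).1 = c'.base (P.proj (c.total.symm p.1)) :=
      (c'.base_proj _ hp2').symm
    have hx' := c'.proj_mem _ hp2'
    change (c.totChange c' p.1).1 ∈ _
    rw [hq]
    refine ⟨c'.base.map_source hx', ?_⟩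
    change c'.base.symm _ ∈ c.base.source
    rw [c'.base.left_inv hx']
    exact c.proj_mem _ (c.total.map_target hp1'))
  refine h1.prodMk (contDiffOn_const.clm_comp (h2.clm_comp (ContDiffOn.clm_comp ?_ h3)))
  have hp : ContDiff ℝ ∞ (fun B : EBase n →L[ℝ] EFib m ↦
      (ContinuousLinearMap.id ℝ (EBase n)).prod B) := by
    have : (fun B : EBase n →L[ℝ] EFib m ↦ (ContinuousLinearMap.id ℝ (EBase n)).prod B)
      = fun B ↦ ContinuousLinearMap.prodₗᵢ ℝ (ContinuousLinearMap.id ℝ (EBase n), B) := rfl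
    rw [this]
    exact (LinearIsometryEquiv.contDiff _).comp (contDiff_const.prodMk contDiff_id)
  exact hp.comp_contDiffOn contDiff_snd.contDiffOn

end FiberedChart

/-- A submersion admits fibered coordinates around every point. -/
theorem Fibration.exists_fiberedChart (P : Fibration n m X Y) (y : Y) :
    ∃ c : FiberedChart P, y ∈ c.total.source := by
  have h := P.submersion y
  let ℓ := h.equiv.toHomeomorph.toOpenPartialHomeomorph
  have hd := h.domChart_mem_maximalAtlas
  have hc := h.codChart_mem_maximalAtlas
  refine ⟨{ base := h.codChart, total := h.domChart.trans ℓ, base_smooth := ?_,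
            base_symm_smooth := ?_, total_smooth := ?_, total_symm_smooth := ?_, proj_mem := ?_,
            base_proj := ?_ }, ?_⟩
  · exact contMDiffOn_of_mem_maximalAtlas hc
  · exact contMDiffOn_symm_of_mem_maximalAtlas hc
  · have h1 : ContMDiff (𝓡 (n + 1 + m)) 𝓘(ℝ, EBase n × EFib m) ∞ h.equiv :=
      h.equiv.contDiff.contMDiff
    exact h1.comp_contMDiffOn ((contMDiffOn_of_mem_maximalAtlas hd).mono fun x hx ↦ hx.1)
  · have h1 : ContMDiff 𝓘(ℝ, EBase n × EFib m) (𝓡 (n + 1 + m)) ∞ h.equiv.symm :=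
      h.equiv.symm.contDiff.contMDiff
    exact (contMDiffOn_symm_of_mem_maximalAtlas hd).comp h1.contMDiffOn fun x hx ↦ hx.2
  · exact fun y hy ↦ h.source_subset_preimage_source hy.1
  · intro y' hy'
    have hy'' : y' ∈ h.domChart.source := hy'.1
    have hm : h.domChart y' ∈ (h.domChart.extend (𝓡 (n + 1 + m))).target := by
      simpa using h.domChart.map_source hy''
    have := h.writtenInCharts hm
    simp [h.domChart.left_inv hy''] at this
    exact this
  · exact ⟨h.mem_domChart_source, mem_univ _⟩

/-- A choice of fibered coordinates around a point. -/
def Fibration.fiberedChartAt (P : Fibration n m X Y) (y : Y) : FiberedChart P :=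
  (P.exists_fiberedChart y).choose

theorem Fibration.mem_fiberedChartAt (P : Fibration n m X Y) (y : Y) :
    y ∈ (P.fiberedChartAt y).total.source := (P.exists_fiberedChart y).choose_spec

/-- The atlas of the jet bundle formed by all induced coordinates. -/
def jetCore (P : Fibration n m X Y) : ChartedSpaceCore (EJet n m) (Jet P) where
  atlas := {e | ∃ c z₀, e = FiberedChart.jetChart c z₀}
  chartAt z := (P.fiberedChartAt z.pt).jetChart z
  mem_chart_source z := P.mem_fiberedChartAt z.pt
  chart_mem_atlas z := ⟨_, _, rfl⟩
  open_source := by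
    rintro _ _ ⟨c, z₀, rfl⟩ ⟨c', z₁, rfl⟩
    rw [FiberedChart.jetChart_trans_source]
    exact (c.total.symm.trans c'.total).open_source.preimage continuous_fst
  continuousOn_toFun := by
    rintro _ _ ⟨c, z₀, rfl⟩ ⟨c', z₁, rfl⟩
    exact (c.contDiffOn_jetChart_trans c' z₀ z₁).continuousOn

instance (P : Fibration n m X Y) : TopologicalSpace (Jet P) := (jetCore P).toTopologicalSpace

instance (P : Fibration n m X Y) : ChartedSpace (EJet n m) (Jet P) := (jetCore P).toChartedSpace

instance (P : Fibration n m X Y) : IsManifold 𝓘(ℝ, EJet n m) ∞ (Jet P) := by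
  refine isManifold_of_contDiffOn _ _ _ ?_
  rintro e e' he he'
  simp only [atlas, ChartedSpace.atlas, mem_iUnion, mem_singleton_iff] at he he'
  obtain ⟨_, ⟨c, z₀, rfl⟩, rfl⟩ := he
  obtain ⟨_, ⟨c', z₁, rfl⟩, rfl⟩ := he'
  simpa using! c.contDiffOn_jetChart_trans c' z₀ z₁

/-- Every point of the base carries a 1-jet. -/
theorem Fibration.nonempty_jet (P : Fibration n m X Y) (x : X) : Nonempty (Jet P) := by
  obtain ⟨y, -⟩ := P.surjective x
  obtain ⟨c, hc⟩ := P.exists_fiberedChart y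
  exact ⟨⟨_, _, c.dproj_comp_lift (c.total.map_source hc) 0⟩⟩

end Jet

section Forms

variable {E : Type*} [NormedAddCommGroup E] [NormedSpace ℝ E]
  {M : Type*} [TopologicalSpace M] [ChartedSpace E M]
  {E' : Type*} [NormedAddCommGroup E'] [NormedSpace ℝ E']
  {N : Type*} [TopologicalSpace N] [ChartedSpace E' N]
  {k : ℕ}

/-- A differential `k`-form on a manifold `M` modelled on `E`, not necessarily smooth: an
alternating `k`-form on each tangent space. The tangent space `TangentSpace 𝓘(ℝ, E) x` is
by definition the vector space `E`. -/
abbrev DiffForm (E : Type*) [NormedAddCommGroup E] [NormedSpace ℝ E] (M : Type*) (k : ℕ) :=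
  M → E [⋀^Fin k]→L[ℝ] ℝ

/-- The pullback `f^* α`. -/
def pullback (f : M → N) (α : DiffForm E' N k) : DiffForm E M k :=
  fun x ↦ (α (f x)).compContinuousLinearMap (mfderiv 𝓘(ℝ, E) 𝓘(ℝ, E') f x : E →L[ℝ] E')

/-- The interior product `ι_ξ α`. -/
def interiorProduct (ξ : (x : M) → TangentSpace 𝓘(ℝ, E) x) (α : DiffForm E M (k + 1)) :
    DiffForm E M k :=
  fun x ↦ (α x).curryLeft (ξ x)

/-- The expression of a form in the preferred chart around `x₀`. -/
def formInChart (x₀ : M) (α : DiffForm E M k) : E → E [⋀^Fin k]→L[ℝ] ℝ :=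
  pullback (chartAt E x₀).symm α

/-- A form is smooth if its expressions in charts are. -/
def SmoothForm (α : DiffForm E M k) : Prop :=
  ∀ x₀ : M, ContDiffOn ℝ ∞ (formInChart x₀ α) (chartAt E x₀).target

/-- The exterior derivative `dα`, computed at `x` in the preferred chart around `x`. -/
def extDer (α : DiffForm E M k) : DiffForm E M (k + 1) :=
  fun x ↦ (extDeriv (formInChart x α) (chartAt E x x)).compContinuousLinearMap
    (mfderiv 𝓘(ℝ, E) 𝓘(ℝ, E) (chartAt E x) x : E →L[ℝ] E)

/-- Smoothness of a vector field. -/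
def SmoothField [IsManifold 𝓘(ℝ, E) ∞ M] (ξ : (x : M) → TangentSpace 𝓘(ℝ, E) x) : Prop :=
  ContMDiff 𝓘(ℝ, E) 𝓘(ℝ, E).tangent ∞ (fun x ↦ (⟨x, ξ x⟩ : TangentBundle 𝓘(ℝ, E) M))

/-- `Φ` restricts to a smooth local flow of the vector field `ξ` on `(-ε, ε) × U`. -/
structure IsLocalFlow (ξ : (x : M) → TangentSpace 𝓘(ℝ, E) x) (Φ : ℝ → M → M) (ε : ℝ)
    (U : Set M) : Prop where
  pos : 0 < ε
  isOpen : IsOpen U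
  smooth : ContMDiffOn (𝓘(ℝ, ℝ).prod 𝓘(ℝ, E)) 𝓘(ℝ, E) ∞ (fun p : ℝ × M ↦ Φ p.1 p.2)
    (Ioo (-ε) ε ×ˢ U)
  zero : ∀ x ∈ U, Φ 0 x = x
  integralCurve : ∀ x ∈ U, IsMIntegralCurveOn (fun t ↦ Φ t x) ξ (Ioo (-ε) ε)

end Forms

section Integration

variable {n : ℕ} {X : Type*} [TopologicalSpace X] [ChartedSpace (EBase n) X]

/-- The coordinate frame `∂/∂x^0, …, ∂/∂x^n` of `ℝ^{n+1}`. -/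
def frame (n : ℕ) : Fin (n + 1) → EBase n := fun i ↦ EuclideanSpace.single i (1 : ℝ)

/-- A volume form: a smooth nowhere vanishing form of top degree. -/
structure IsVolumeForm (η : DiffForm (EBase n) X (n + 1)) : Prop where
  smooth : SmoothForm η
  ne_zero : ∀ x, η x ≠ 0

/-- The measure `|η(∂_0, …, ∂_n)| dx^0 ⋯ dx^n` on the domain of the preferred chart at `x₀`. -/
def chartMeasure [MeasurableSpace X] (η : DiffForm (EBase n) X (n + 1)) (x₀ : X) : Measure X :=
  ((volume.restrict (chartAt (EBase n) x₀).target).withDensity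
    (fun u ↦ ENNReal.ofReal |formInChart x₀ η u (frame n)|)).map (chartAt (EBase n) x₀).symm

/-- The measure associated with the volume form `η`. The measures in the various charts agree on the
overlaps, and their supremum is the measure on `X` restricting to each of them. -/
def volumeMeasure [MeasurableSpace X] (η : DiffForm (EBase n) X (n + 1)) : Measure X :=
  ⨆ x₀ : X, chartMeasure η x₀

/-- The integral over `C` of the form `α = f η` of top degree, with respect to the orientation
given by the volume form `η`: it is the integral of `f` against the measure of `η`. -/
def integralForm [MeasurableSpace X] (η : DiffForm (EBase n) X (n + 1)) (C : Set X)
    (α : DiffForm (EBase n) X (n + 1)) : ℝ :=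
  ∫ x in C, α x (frame n) / η x (frame n) ∂(volumeMeasure η)

/-- `C` is a compact `(n+1)`-dimensional embedded submanifold with (possibly empty) boundary of the
`(n+1)`-dimensional manifold `X`: around each point of its frontier, `C` is a half-space in suitable
coordinates. The boundary `∂C` is the frontier of `C`. -/
structure IsCompactDomain (n : ℕ) {X : Type*} [TopologicalSpace X] [ChartedSpace (EBase n) X]
    (C : Set X) : Prop where
  isCompact : IsCompact C
  boundary : ∀ x ∈ frontier C, ∃ e ∈ IsManifold.maximalAtlas (𝓡 (n + 1)) ∞ X,
    x ∈ e.source ∧ ∀ x' ∈ e.source, (x' ∈ C ↔ 0 ≤ e x' 0)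

end Integration

section FieldTheory

variable {n m : ℕ} {X Y : Type*}
  [TopologicalSpace X] [ChartedSpace (EBase n) X]
  [TopologicalSpace Y] [ChartedSpace (ETot n m) Y]
  {P : Fibration n m X Y}

/-- A smooth (global) section of `π`. -/
structure Fibration.IsSection (P : Fibration n m X Y) (φ : X → Y) : Prop where
  smooth : ContMDiff (𝓡 (n + 1)) (𝓡 (n + 1 + m)) ∞ φ
  proj_apply : ∀ x, P.proj (φ x) = x

open Classical in
/-- The first jet prolongation `x ↦ j¹_x φ`. The value is meaningful at the points around which `φ`
is a section of `π`, and arbitrary elsewhere. -/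
def Fibration.jet1 (P : Fibration n m X Y) (φ : X → Y) (x : X) : Jet P :=
  if h : P.proj (φ x) = x ∧
      (P.dproj (φ x)).comp (mfderiv (𝓡 (n + 1)) (𝓡 (n + 1 + m)) φ x : EBase n →L[ℝ] ETot n m)
        = ContinuousLinearMap.id ℝ (EBase n) then
    ⟨φ x, mfderiv (𝓡 (n + 1)) (𝓡 (n + 1 + m)) φ x, h.2⟩
  else Classical.choice (P.nonempty_jet x)

namespace Jet

/-- The projection `π_{XZ} : J¹π → X`. -/
def toBase (z : Jet P) : X := P.proj z.pt

/-- The differential of `π_{YZ} : J¹π → Y`. -/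
def dpt (z : Jet P) : EJet n m →L[ℝ] ETot n m :=
  mfderiv 𝓘(ℝ, EJet n m) (𝓡 (n + 1 + m)) (Jet.pt : Jet P → Y) z

/-- The differential of `π_{XZ} : J¹π → X`. -/
def dtoBase (z : Jet P) : EJet n m →L[ℝ] EBase n :=
  mfderiv 𝓘(ℝ, EJet n m) (𝓡 (n + 1)) (Jet.toBase : Jet P → X) z

/-- The space `T_x^*X ⊗ V_yπ` of linear maps from `T_xX` to the vertical space at `y`, over which
the fibre of `J¹π → Y` at `y` is an affine space. -/
def vertHom (z : Jet P) : Submodule ℝ (EBase n →L[ℝ] ETot n m) where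
  carrier := {A | (P.dproj z.pt).comp A = 0}
  add_mem' {A B} hA hB := by
    have hA' : (P.dproj z.pt).comp A = 0 := hA
    have hB' : (P.dproj z.pt).comp B = 0 := hB
    simp [hA', hB']
  zero_mem' := by simp
  smul_mem' c A hA := by
    have hA' : (P.dproj z.pt).comp A = 0 := hA
    change (P.dproj z.pt).comp (c • A) = 0
    ext1 w
    have h : P.dproj z.pt (A w) = 0 := congrArg (fun f ↦ f w) hA'
    simp [h]

/-- The translate `z + f` of a jet in its fibre over `Y`. -/
def translate (z : Jet P) (f : z.vertHom) : Jet P where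
  pt := z.pt
  lin := z.lin + f
  dproj_lin := by
    have h : (P.dproj z.pt).comp (f : EBase n →L[ℝ] ETot n m) = 0 := f.2
    simp [h, z.dproj_lin]

/-- The vertical lift `f ↦ f^v`, where `f^v` is the derivative at `t = 0` of `t ↦ z + t f`. -/
def vertLift (z : Jet P) : z.vertHom →L[ℝ] EJet n m :=
  mfderiv 𝓘(ℝ, z.vertHom) 𝓘(ℝ, EJet n m) z.translate 0

/-- The contact form `V ↦ Tπ_{YZ} V - T_xφ (Tπ_{XZ} V)` for `z = j¹_x φ`. -/
def contact (z : Jet P) : EJet n m →L[ℝ] ETot n m :=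
  z.dpt - (z.lin.comp (P.dproj z.pt)).comp z.dpt

theorem dproj_contact (z : Jet P) (V : EJet n m) : P.dproj z.pt (z.contact V) = 0 := by
  have h := fun w ↦ congrArg (fun f ↦ f w) z.dproj_lin
  simp only [ContinuousLinearMap.comp_apply, ContinuousLinearMap.id_apply] at h
  simp [contact, h]

/-- The element `α ⊗ θ(V)` of `T_x^*X ⊗ V_yπ`, where `θ` is the contact form. -/
def tensorContact (z : Jet P) (V : EJet n m) (α : EBase n →L[ℝ] ℝ) : z.vertHom :=
  ⟨α.smulRight (z.contact V), by
    have h : (P.dproj z.pt).comp (α.smulRight (z.contact V)) = 0 := by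
      ext1 w
      simp [z.dproj_contact V]
    exact h⟩

/-- The map `V ↦ (α ↦ α ⊗ θ(V))` as a bilinear map. -/
def tensorContactₗ (z : Jet P) : EJet n m →ₗ[ℝ] (EBase n →L[ℝ] ℝ) →ₗ[ℝ] z.vertHom :=
  LinearMap.mk₂ ℝ z.tensorContact
    (fun V W α ↦ Subtype.ext <| ContinuousLinearMap.ext fun w ↦
      (congrArg (α w • ·) (map_add z.contact V W)).trans (smul_add _ _ _))
    (fun r V α ↦ Subtype.ext <| ContinuousLinearMap.ext fun w ↦
      (congrArg (α w • ·) (map_smul z.contact r V)).trans (smul_comm _ _ _))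
    (fun _ α β ↦ Subtype.ext <| ContinuousLinearMap.ext fun w ↦ add_smul (α w) (β w) _)
    (fun r _ α ↦ Subtype.ext <| ContinuousLinearMap.ext fun w ↦ mul_smul r (α w) _)

/-- The map `V ↦ (α ↦ (α ⊗ θ(V))^v)`. -/
def tensorLift (z : Jet P) : EJet n m →ₗ[ℝ] (EBase n →L[ℝ] ℝ) →L[ℝ] EJet n m :=
  LinearMap.toContinuousLinearMap.toLinearMap ∘ₗ
    z.tensorContactₗ.compr₂ (z.vertLift : z.vertHom →ₗ[ℝ] EJet n m)

/-- The vertical endomorphism `S_η`, a form of degree `n + 1` with values in the tangent space: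
`S_η(V_0, …, V_n) = ∑ i, (η_i ⊗ θ(V_i))^v`, where `η_i` is the covector
`(-1)^i η(·, Tπ_{XZ} V_0, …, Tπ_{XZ} V_n)` with `V_i` omitted.
In coordinates it is `(dy^i - z^i_μ dx^μ) ∧ d^n x_ν ⊗ ∂/∂z^i_ν`. -/
def vertEndo (η : DiffForm (EBase n) X (n + 1)) (z : Jet P) :
    EJet n m [⋀^Fin (n + 1)]→L[ℝ] EJet n m :=
  ContinuousAlternatingMap.alternatizeUncurryFin
    (LinearMap.toContinuousLinearMap
      { toFun := fun V ↦ (z.tensorLift V).compContinuousAlternatingMap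
          ((η z.toBase).curryLeft.flipAlternating.compContinuousLinearMap z.dtoBase)
        map_add' := fun V W ↦ by
          ext1 w
          simp
        map_smul' := fun r V ↦ by
          ext1 w
          simp })

theorem vertEndo_apply (η : DiffForm (EBase n) X (n + 1)) (z : Jet P)
    (V : Fin (n + 1) → EJet n m) :
    z.vertEndo η V = ∑ i : Fin (n + 1), (-1) ^ (i : ℕ) • z.vertLift (z.tensorContact (V i)
      ((η z.toBase).curryLeft.flipAlternating (fun j ↦ z.dtoBase (i.removeNth V j)))) := by
  rw [vertEndo, ContinuousAlternatingMap.alternatizeUncurryFin_apply]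
  rfl

end Jet

/-- The differential `dL` of a function on the jet bundle. -/
def dJet (L : Jet P → ℝ) (z : Jet P) : EJet n m →L[ℝ] ℝ :=
  mfderiv 𝓘(ℝ, EJet n m) 𝓘(ℝ, ℝ) L z

/-- The Lagrangian form `𝓛 = L η`. -/
def lagrangianForm (η : DiffForm (EBase n) X (n + 1)) (L : Jet P → ℝ) :
    DiffForm (EJet n m) (Jet P) (n + 1) :=
  fun z ↦ L z • pullback (Jet.toBase : Jet P → X) η z

/-- The Poincaré–Cartan `(n+1)`-form `Θ_L = 𝓛 + S_η^*(dL)`. -/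
def poincareCartan (η : DiffForm (EBase n) X (n + 1)) (L : Jet P → ℝ) :
    DiffForm (EJet n m) (Jet P) (n + 1) :=
  fun z ↦ lagrangianForm η L z +
    (dJet L z).compContinuousAlternatingMap (z.vertEndo η)

/-- The Poincaré–Cartan `(n+2)`-form `Ω_L = -dΘ_L`. -/
def poincareCartanTwo (η : DiffForm (EBase n) X (n + 1)) (L : Jet P → ℝ) :
    DiffForm (EJet n m) (Jet P) (n + 2) :=
  -extDer (poincareCartan η L)

/-- The action `∫_C (j¹φ)^* 𝓛`. -/
def action [MeasurableSpace X] (η : DiffForm (EBase n) X (n + 1)) (L : Jet P → ℝ) (C : Set X)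
    (φ : X → Y) : ℝ :=
  integralForm η C (pullback (P.jet1 φ) (lagrangianForm η L))

/-- The section `φ` is an extremal of the action: for every compact `(n+1)`-dimensional submanifold
`C` of `X` and every projectable vector field `ξY` on `Y`, with projection `ξX`, which keeps the
values of `φ` on `∂C` fixed, the action over `C` of the variation
`φ_t = Φ^Y_t ∘ φ ∘ Φ^X_{-t}` has vanishing derivative at `t = 0`. -/
def IsExtremal [IsManifold (𝓡 (n + 1)) ∞ X] [IsManifold (𝓡 (n + 1 + m)) ∞ Y]
    [MeasurableSpace X] (η : DiffForm (EBase n) X (n + 1)) (L : Jet P → ℝ)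
    (φ : X → Y) : Prop :=
  ∀ C : Set X, IsCompactDomain n C →
  ∀ (ξY : (y : Y) → TangentSpace (𝓡 (n + 1 + m)) y) (ξX : (x : X) → TangentSpace (𝓡 (n + 1)) x),
    SmoothField ξY → SmoothField ξX → (∀ y, P.dproj y (ξY y) = ξX (P.proj y)) →
    (∀ x ∈ frontier C, ξY (φ x) = 0) →
  ∀ (ΦY : ℝ → Y → Y) (ΦX : ℝ → X → X) (ε : ℝ) (V : Set Y) (U : Set X),
    IsLocalFlow ξY ΦY ε V → IsLocalFlow ξX ΦX ε U → C ⊆ U → φ '' C ⊆ V →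
    HasDerivAt (fun t ↦ action η L C (fun x ↦ ΦY t (φ (ΦX (-t) x)))) 0 0

end FieldTheory

end ClassicalField

end

open ClassicalField

noncomputable section

set_option linter.unusedSectionVars false

namespace ClassicalField

/-! ### Top-degree alternating forms on the model space -/

section Alternating

/-! Both conditions are equivalent to the Euler–Lagrange equations. Take fibered coordinates in
which `η = ρ dx`, `ℓ` is the Lagrangian and `u` represents `φ`, and put `p_μ = ρ ∂ℓ/∂z_μ` and `E = ρ
∂ℓ/∂y - ∂_μ p_μ` along the 1-jet of `u` (`momentum`, `eulerLagrange`). Each side of the theorem says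
that `E` vanishes.

The forms. Evaluated at `j¹φ` on a vector `V` and on the tangent vectors of `j¹φ`, the form `dΘ_L`
gives `E(V^y - Du V^x)`. To see this, pull `Θ_L` back along the map `(s, a) ↦ j¹u(a) + s V` from `ℝ
× ℝ^{n+1}` and differentiate there. The part of `V` tangent to `j¹φ` cancels because second
derivatives of `u` are symmetric, and the `∂/∂z` part cancels because the contact terms of `Θ_L`
compensate the derivative of `ℓ` (`extDeriv_locTheta`, transferred to the jet bundle in
`extDer_poincareCartan_apply`). Hence `E = 0` annihilates every contraction, and cut-off fields
`∂/∂y^i` suffice to recover `E = 0`.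

The variations. The flows turn `φ` into a one-parameter family of sections over the fixed base, so
only its vertical velocity `w` matters. The action may be differentiated under the integral
(`hasDerivAt_action`), and the product rule gives `ρ dℓ(w, Dw) = E(w) + ∂_μ (p_μ w)`
(`firstVariation_eq`). If `w` is supported in a chart and vanishes on `∂C`, the divergence
integrates to zero: cutting `p_μ w` off outside `C` leaves a Lipschitz function of compact support
(`setIntegral_fderiv_eq_zero`). This is `integral_varLag_eq`. A general family is split by a
partition of unity `χ_i`, replacing `Φ t x` by `Φ (χ_i(x) t) x`, which multiplies the velocity by
`χ_i`. So `E = 0` makes `φ` an extremal.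

Conversely, for an extremal take for `C` a closed coordinate ball and for `ξ_Y` a vertical field
`g(x) v` with `g` supported in the open ball. Its flow is explicit, and `∫ g E(v) = 0` for all such
`g`, so the fundamental lemma of the calculus of variations yields `E = 0`. -/

theorem contDiffAt_alternating_of_apply {G E : Type*} [NormedAddCommGroup G] [NormedSpace ℝ G]
    [NormedAddCommGroup E] [NormedSpace ℝ E] [FiniteDimensional ℝ E] {k : ℕ} {r : WithTop ℕ∞}
    {κ : G → E [⋀^Fin k]→L[ℝ] ℝ} {p : G} (h : ∀ v, ContDiffAt ℝ r (fun q ↦ κ q v) p) :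
    ContDiffAt ℝ r κ p := by
  let b := Module.finBasis ℝ E
  -- Evaluation on tuples of basis vectors embeds the alternating forms linearly into a finite
  -- product of lines; a linear left inverse carries smoothness back.
  let ev : (E [⋀^Fin k]→L[ℝ] ℝ) →ₗ[ℝ] ((Fin k → Fin (Module.finrank ℝ E)) → ℝ) :=
    { toFun := fun f w ↦ f (fun i ↦ b (w i))
      map_add' := fun _ _ ↦ rfl
      map_smul' := fun _ _ ↦ rfl }
  have hinj : Function.Injective ev := by
    intro f g hfg
    apply ContinuousAlternatingMap.toAlternatingMap_injective
    refine b.ext_alternating fun w _ ↦ ?_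
    exact congrFun hfg w
  obtain ⟨g, hg⟩ := LinearMap.exists_leftInverse_of_injective ev (LinearMap.ker_eq_bot.2 hinj)
  let g' := LinearMap.toContinuousLinearMap g
  have hκ : κ = fun q ↦ g' (ev (κ q)) := by
    funext q
    exact (LinearMap.congr_fun hg (κ q)).symm
  rw [hκ]
  refine g'.contDiff.contDiffAt.comp p ?_
  rw [contDiffAt_pi]
  intro w
  exact h _

/-- The standard basis of the model space of the base. -/
def baseBasis (n : ℕ) : Module.Basis (Fin (n + 1)) ℝ (EBase n) :=
  (EuclideanSpace.basisFun (Fin (n + 1)) ℝ).toBasis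

theorem coe_baseBasis (n : ℕ) : ⇑(baseBasis n) = frame n := by
  funext i
  simp [baseBasis, frame]

/-- The standard volume form `dx^0 ∧ ⋯ ∧ dx^n`. -/
def stdVol (n : ℕ) : EBase n [⋀^Fin (n + 1)]→L[ℝ] ℝ :=
  { (baseBasis n).det with
    cont := by
      change Continuous fun v : Fin (n + 1) → EBase n ↦ (baseBasis n).det v
      simp only [Module.Basis.det_apply]
      refine Continuous.matrix_det ?_
      refine continuous_matrix fun i j ↦ ?_
      simp only [Module.Basis.toMatrix_apply]
      have : Continuous fun x : EBase n ↦ (baseBasis n).repr x i :=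
        ((Finsupp.lapply i).comp (baseBasis n).repr.toLinearMap).continuous_of_finiteDimensional
      exact this.comp (continuous_apply j) }

theorem stdVol_frame (n : ℕ) : stdVol n (frame n) = 1 := by
  rw [← coe_baseBasis]
  exact (baseBasis n).det_self

theorem eq_smul_stdVol {n : ℕ} (κ : EBase n [⋀^Fin (n + 1)]→L[ℝ] ℝ) :
    κ = κ (frame n) • stdVol n := by
  apply ContinuousAlternatingMap.toAlternatingMap_injective
  have h := AlternatingMap.eq_smul_basis_det (baseBasis n) κ.toAlternatingMap
  rw [coe_baseBasis] at h
  exact h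

theorem eq_zero_of_apply_frame {n : ℕ} {κ : EBase n [⋀^Fin (n + 1)]→L[ℝ] ℝ}
    (h : κ (frame n) = 0) : κ = 0 := by
  rw [eq_smul_stdVol κ, h, zero_smul]

theorem sum_smul_frame {n : ℕ} (v : EBase n) : ∑ i, v i • frame n i = v := by
  ext k
  simp [frame, Finset.sum_apply, Pi.single_apply]

/-- Moving `v` from the first slot to slot `μ` costs the sign `(-1)^μ`. Expanding `v` in the frame
then leaves only its `μ`-th component, since every other term repeats a frame vector. -/
theorem stdVol_cons_removeNth {n : ℕ} (v : EBase n) (μ : Fin (n + 1)) :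
    stdVol n (Fin.cons v (μ.removeNth (frame n))) = (-1) ^ (μ : ℕ) * v μ := by
  have h1 := (stdVol n).map_insertNth μ v (μ.removeNth (frame n))
  have h2 : stdVol n (μ.insertNth v (μ.removeNth (frame n))) = v μ := by
    rw [Fin.insertNth_removeNth]
    have hs : stdVol n (Function.update (frame n) μ (∑ k, v k • frame n k))
        = ∑ k, stdVol n (Function.update (frame n) μ (v k • frame n k)) :=
      (stdVol n).toAlternatingMap.map_update_sum Finset.univ μ (fun k ↦ v k • frame n k) (frame n)
    rw [sum_smul_frame] at hs
    rw [hs, Finset.sum_eq_single μ]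
    · rw [(stdVol n).map_update_smul]
      simp [stdVol_frame]
    · intro k _ hk
      rw [(stdVol n).map_update_smul]
      rw [(stdVol n).map_eq_zero_of_eq _ (i := μ) (j := k) (by simp [hk]) hk.symm, smul_zero]
    · simp
  rw [h2] at h1
  have h3 : stdVol n (Fin.cons v (μ.removeNth (frame n)))
    = stdVol n (Matrix.vecCons v (μ.removeNth (frame n))) := rfl
  rw [h3, h1]
  simp [← mul_assoc, ← mul_pow]

/-- The covector `(stdVol)(·, e_0, …, ê_μ, …, e_n)`. -/
theorem stdVol_curryLeft_removeNth {n : ℕ} (μ : Fin (n + 1)) :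
    (stdVol n).curryLeft.flipAlternating (μ.removeNth (frame n))
      = (-1 : ℝ) ^ (μ : ℕ) • (EuclideanSpace.proj μ : EBase n →L[ℝ] ℝ) := by
  ext v
  exact stdVol_cons_removeNth v μ

end Alternating

/-! ### Integrals of derivatives of functions vanishing on the boundary -/

section Stokes

variable {E : Type*} [NormedAddCommGroup E] [NormedSpace ℝ E]

/-- A segment missing the frontier would be covered by the interior and the exterior of `S`, against
connectedness. -/
theorem exists_mem_segment_frontier {S : Set E} {x y : E} (hx : x ∈ S) (hy : y ∉ S) :
    ∃ z ∈ segment ℝ x y, z ∈ frontier S := by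
  by_contra! h
  have hpre := (convex_segment (𝕜 := ℝ) x y).isPreconnected
  have hsub : segment ℝ x y ⊆ interior S ∪ (closure S)ᶜ := by
    intro z hz
    by_cases hc : z ∈ closure S
    · left
      by_contra hi
      exact h z hz ⟨hc, hi⟩
    · exact Or.inr hc
  have hx' : x ∈ interior S := by
    rcases hsub (left_mem_segment ℝ x y) with h' | h'
    · exact h'
    · exact absurd (subset_closure hx) h'
  have hy' : y ∈ (closure S)ᶜ := by
    rcases hsub (right_mem_segment ℝ x y) with h' | h'
    · exact absurd (interior_subset h') hy
    · exact h'
  obtain ⟨z, -, hz1, hz2⟩ := hpre _ _ isOpen_interior isClosed_closure.isOpen_compl hsub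
    ⟨x, left_mem_segment ℝ x y, hx'⟩ ⟨y, right_mem_segment ℝ x y, hy'⟩
  exact hz2 (subset_closure (interior_subset hz1))

/-- A segment leaving `S` crosses the frontier at a point where `f = 0`, so the cut-off creates no
jump. This replaces any regularity of the boundary in the divergence argument. -/
theorem lipschitzWith_indicator {S : Set E} {f : E → ℝ} {K : NNReal} (hf : LipschitzWith K f)
    (h0 : ∀ x ∈ frontier S, f x = 0) : LipschitzWith K (S.indicator f) := by
  have key : ∀ x ∈ S, ∀ y ∉ S, dist (f x) 0 ≤ K * dist x y := by
    intro x hx y hy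
    obtain ⟨z, hz, hzf⟩ := exists_mem_segment_frontier hx hy
    rw [← h0 z hzf]
    refine (hf.dist_le_mul x z).trans ?_
    have : dist x z ≤ dist x y := by
      have := dist_add_dist_of_mem_segment hz
      have := dist_nonneg (x := z) (y := y)
      linarith
    gcongr
  refine LipschitzWith.of_dist_le_mul fun x y ↦ ?_
  by_cases hx : x ∈ S <;> by_cases hy : y ∈ S <;> simp only [indicator, hx, hy, if_true, if_false]
  · exact hf.dist_le_mul x y
  · exact key x hx y hy
  · rw [dist_comm, dist_comm x y]
    exact key y hy x hx
  · simp
    positivity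

variable [FiniteDimensional ℝ E] [MeasurableSpace E] [BorelSpace E]

/-- The integral over `S` of a directional derivative of a function vanishing on the boundary
of `S`. -/
theorem setIntegral_fderiv_eq_zero (μ : Measure E) [μ.IsAddHaarMeasure] {S : Set E}
    (hS : MeasurableSet S) {f : E → ℝ}
    (hf : ContDiff ℝ 1 f) (hc : HasCompactSupport f) (h0 : ∀ x ∈ frontier S, f x = 0)
    (hnull : μ (frontier S ∩ tsupport f) = 0) (v : E) :
    ∫ x in S, fderiv ℝ f x v ∂μ = 0 := by
  obtain ⟨K, hK⟩ := hf.lipschitzWith_of_hasCompactSupport hc (by norm_num)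
  have hg := lipschitzWith_indicator hK h0
  have hgc : HasCompactSupport (S.indicator f) :=
    hc.mono (by intro x hx; simp at hx ⊢; exact hx.2)
  have h1 : LipschitzWith 0 (fun _ : E ↦ (1 : ℝ)) := LipschitzWith.const _
  -- Integration by parts against the constant function 1, with `-v` because the formula reverses
  -- the direction: the derivative along `v` of the cut-off function has total integral zero.
  have := h1.integral_lineDeriv_mul_eq (μ := μ) hg hgc (-v)
  simp only [lineDeriv, deriv_const, zero_mul, integral_zero, neg_neg, mul_one] at this
  rw [← integral_indicator hS, this]
  apply integral_congr_ae
  -- Off this null set the cut-off function agrees near `x` with `f` or with `0`. Frontier points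
  -- outside the support of `f` are harmless, both sides being zero there.
  have hae : ∀ᵐ x ∂μ, x ∉ frontier S ∩ tsupport f := measure_eq_zero_iff_ae_notMem.1 hnull
  filter_upwards [hae] with x hx
  change _ = lineDeriv ℝ (S.indicator f) x v
  have hd : lineDeriv ℝ f x v = fderiv ℝ f x v :=
    (hf.differentiable (by norm_num) x).lineDeriv_eq_fderiv
  have hzero : ∀ g : E → ℝ, g =ᶠ[𝓝 x] 0 → lineDeriv ℝ g x v = 0 := by
    intro g hgx
    rw [hgx.lineDeriv_eq]
    simp [lineDeriv]
  by_cases ht : x ∈ tsupport f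
  · have hx' : x ∉ frontier S := fun h ↦ hx ⟨h, ht⟩
    by_cases hxS : x ∈ S
    · rw [indicator_of_mem hxS, ← hd]
      have hi : x ∈ interior S := by
        by_contra hi
        exact hx' ⟨subset_closure hxS, hi⟩
      symm
      apply Filter.EventuallyEq.lineDeriv_eq
      filter_upwards [isOpen_interior.mem_nhds hi] with y hy
      exact indicator_of_mem (interior_subset hy) f
    · rw [indicator_of_notMem hxS]
      symm
      apply hzero
      have hcl : x ∉ closure S := fun h ↦ hx' ⟨h, fun h' ↦ hxS (interior_subset h')⟩
      filter_upwards [isClosed_closure.isOpen_compl.mem_nhds hcl] with y hy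
      exact indicator_of_notMem (fun h ↦ hy (subset_closure h)) f
  · have hf0 : f =ᶠ[𝓝 x] 0 := notMem_tsupport_iff_eventuallyEq.1 ht
    have e1 : lineDeriv ℝ (S.indicator f) x v = 0 := by
      apply hzero
      filter_upwards [hf0] with y hy
      by_cases h : y ∈ S <;> simp [indicator, h, hy]
    have e2 : fderiv ℝ f x v = 0 := by
      rw [← hd]
      exact hzero f hf0
    rw [e1]
    by_cases h : x ∈ S <;> simp [indicator, h, e2]

end Stokes

/-! ### The Euler–Lagrange expression and the Poincaré–Cartan form in coordinates -/

section EulerLagrange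

variable {n m : ℕ}

/-- The 1-jet `a ↦ ((a, u a), Du a)` of a map between the model spaces. -/
def locJet (u : EBase n → EFib m) (a : EBase n) : EJet n m := ((a, u a), fderiv ℝ u a)

/-- The tensor product `v ↦ dx^μ ⊗ v`. -/
def dxTensor (m : ℕ) (μ : Fin (n + 1)) : EFib m →L[ℝ] (EBase n →L[ℝ] EFib m) :=
  ContinuousLinearMap.smulRightL ℝ (EBase n) (EFib m) (EuclideanSpace.proj μ : EBase n →L[ℝ] ℝ)

@[simp]
theorem dxTensor_apply (μ : Fin (n + 1)) (v : EFib m) (w : EBase n) :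
    dxTensor m μ v w = w μ • v := rfl

theorem sum_dxTensor (A : EBase n →L[ℝ] EFib m) :
    ∑ μ, dxTensor m μ (A (frame n μ)) = A := by
  ext1 w
  conv_rhs => rw [← sum_smul_frame w]
  simp [map_sum]

/-- The inclusion of the directions `∂/∂z^i_μ`. -/
def inZ : (EBase n →L[ℝ] EFib m) →L[ℝ] EJet n m :=
  ContinuousLinearMap.inr ℝ (EBase n × EFib m) (EBase n →L[ℝ] EFib m)

/-- The inclusion of the directions `∂/∂y^i`. -/
def inY : EFib m →L[ℝ] EJet n m :=
  (ContinuousLinearMap.inl ℝ (EBase n × EFib m) (EBase n →L[ℝ] EFib m)).comp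
    (ContinuousLinearMap.inr ℝ (EBase n) (EFib m))

theorem inZ_apply (A : EBase n →L[ℝ] EFib m) : inZ A = ((0, 0), A) := rfl

theorem inY_apply (v : EFib m) : (inY v : EJet n m) = ((0, v), 0) := rfl

/-- The momenta `ρ ∂ℓ/∂z^i_μ` along the 1-jet of `u`. -/
def momentum (ρ : EBase n → ℝ) (l : EJet n m → ℝ) (u : EBase n → EFib m) (μ : Fin (n + 1))
    (a : EBase n) : EFib m →L[ℝ] ℝ :=
  ρ a • (fderiv ℝ l (locJet u a)).comp (inZ.comp (dxTensor m μ))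

/-- The Euler–Lagrange expression `ρ ∂ℓ/∂y^i - ∂_μ (ρ ∂ℓ/∂z^i_μ)` along the 1-jet of `u`. -/
def eulerLagrange (ρ : EBase n → ℝ) (l : EJet n m → ℝ) (u : EBase n → EFib m)
    (a : EBase n) : EFib m →L[ℝ] ℝ :=
  ρ a • (fderiv ℝ l (locJet u a)).comp inY -
    ∑ μ, fderiv ℝ (momentum ρ l u μ) a (frame n μ)

variable {ρ : EBase n → ℝ} {l : EJet n m → ℝ} {u : EBase n → EFib m} {a : EBase n}

theorem contDiffAt_locJet (hu : ContDiffAt ℝ ∞ u a) : ContDiffAt ℝ ∞ (locJet u) a :=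
  (contDiffAt_id.prodMk hu).prodMk (hu.fderiv_right (m := ∞) (by simp))

theorem contDiffAt_momentum (hρ : ContDiffAt ℝ ∞ ρ a) (hl : ContDiffAt ℝ ∞ l (locJet u a))
    (hu : ContDiffAt ℝ ∞ u a) (μ : Fin (n + 1)) : ContDiffAt ℝ ∞ (momentum ρ l u μ) a := by
  refine hρ.smul (ContDiffAt.clm_comp ?_ contDiffAt_const)
  exact (hl.fderiv_right (m := ∞) (by simp)).comp a (contDiffAt_locJet hu)

theorem contDiffAt_eulerLagrange (hρ : ContDiffAt ℝ ∞ ρ a) (hl : ContDiffAt ℝ ∞ l (locJet u a))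
    (hu : ContDiffAt ℝ ∞ u a) : ContDiffAt ℝ ∞ (eulerLagrange ρ l u) a := by
  refine ContDiffAt.sub ?_ ?_
  · refine hρ.smul (ContDiffAt.clm_comp ?_ contDiffAt_const)
    exact (hl.fderiv_right (m := ∞) (by simp)).comp a (contDiffAt_locJet hu)
  · refine ContDiffAt.sum fun μ _ ↦ ?_
    exact ((contDiffAt_momentum hρ hl hu μ).fderiv_right (m := ∞) (by simp)).clm_apply
      contDiffAt_const

theorem hasFDerivAt_locJet (hu : ContDiffAt ℝ ∞ u a) :
    HasFDerivAt (locJet u) (((ContinuousLinearMap.id ℝ (EBase n)).prod (fderiv ℝ u a)).prod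
      (fderiv ℝ (fderiv ℝ u) a)) a :=
  ((hasFDerivAt_id a).prodMk (hu.differentiableAt (by simp)).hasFDerivAt).prodMk
    ((hu.fderiv_right (m := ∞) (by simp)).differentiableAt (by simp)).hasFDerivAt

/-- The first variation of the Lagrangian in terms of the Euler–Lagrange expression. -/
theorem firstVariation_eq (hρ : ContDiffAt ℝ ∞ ρ a) (hl : ContDiffAt ℝ ∞ l (locJet u a))
    (hu : ContDiffAt ℝ ∞ u a) {w : EBase n → EFib m} (hw : DifferentiableAt ℝ w a) :
    ρ a * fderiv ℝ l (locJet u a) ((0, w a), fderiv ℝ w a) = eulerLagrange ρ l u a (w a) +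
      ∑ μ, fderiv ℝ (fun b ↦ momentum ρ l u μ b (w b)) a (frame n μ) := by
  have h1 : ∀ μ, fderiv ℝ (fun b ↦ momentum ρ l u μ b (w b)) a (frame n μ)
      = fderiv ℝ (momentum ρ l u μ) a (frame n μ) (w a)
        + momentum ρ l u μ a (fderiv ℝ w a (frame n μ)) := by
    intro μ
    have hp := (contDiffAt_momentum hρ hl hu μ).differentiableAt (by simp)
    rw [(hp.hasFDerivAt.clm_apply hw.hasFDerivAt).fderiv]
    simp [add_comm]
  have h2 : ∑ μ, momentum ρ l u μ a (fderiv ℝ w a (frame n μ))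
      = ρ a * fderiv ℝ l (locJet u a) (inZ (fderiv ℝ w a)) := by
    conv_rhs => rw [← sum_dxTensor (fderiv ℝ w a)]
    simp [momentum, map_sum, Finset.mul_sum]
  have h3 : (((0, w a), fderiv ℝ w a) : EJet n m) = inY (w a) + inZ (fderiv ℝ w a) := by
    simp [inY_apply, inZ_apply]
  simp only [h1, Finset.sum_add_distrib, h2, h3, map_add, eulerLagrange]
  simp
  ring

/-- The coordinate expression of the Poincaré–Cartan form. -/
def locTheta (ρ : EBase n → ℝ) (l : EJet n m → ℝ) (p : EJet n m) (V : Fin (n + 1) → EJet n m) :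
    ℝ :=
  l p * ρ p.1.1 * stdVol n (fun i ↦ (V i).1.1) + ∑ i : Fin (n + 1), (-1) ^ (i : ℕ) *
    (ρ p.1.1 * fderiv ℝ l p (inZ (((stdVol n).curryLeft.flipAlternating
      (i.removeNth fun j ↦ (V j).1.1)).smulRight ((V i).1.2 - p.2 (V i).1.1))))

theorem contDiffAt_locTheta {p : EJet n m} (hρ : ContDiffAt ℝ ∞ ρ p.1.1)
    (hl : ContDiffAt ℝ ∞ l p) (V : Fin (n + 1) → EJet n m) :
    ContDiffAt ℝ ∞ (fun q ↦ locTheta ρ l q V) p := by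
  have hρ' : ContDiffAt ℝ ∞ (fun q : EJet n m ↦ ρ q.1.1) p :=
    ContDiffAt.comp (f := fun q : EJet n m ↦ q.1.1) p hρ (by fun_prop)
  refine ((hl.mul hρ').mul contDiffAt_const).add (ContDiffAt.sum fun i _ ↦ ?_)
  refine contDiffAt_const.mul (hρ'.mul ?_)
  refine (hl.fderiv_right (m := ∞) (by simp)).clm_apply ?_
  refine (ContinuousLinearMap.contDiff _).contDiffAt.comp p ?_
  refine contDiffAt_const.smulRight ?_
  exact contDiffAt_const.sub (contDiffAt_snd.clm_apply contDiffAt_const)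

/-- The coordinate form on vectors tangent to the 1-jet of a map, at a point whose position
coordinates lie on it. -/
theorem locTheta_tangent (B : EBase n →L[ℝ] EFib m) (p : EJet n m) (V : Fin (n + 1) → EJet n m)
    (hV : ∀ i, (V i).1 = (frame n i, B (frame n i))) :
    locTheta ρ l p V = l p * ρ p.1.1 - ρ p.1.1 * fderiv ℝ l p (inZ (p.2 - B)) := by
  have h1 : (fun i ↦ (V i).1.1) = frame n := by
    funext i
    rw [hV]
  simp only [locTheta, h1, stdVol_frame, mul_one]
  have h2 : ∀ i : Fin (n + 1), (-1 : ℝ) ^ (i : ℕ) *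
    (ρ p.1.1 * fderiv ℝ l p (inZ (((stdVol n).curryLeft.flipAlternating
      (i.removeNth (frame n))).smulRight ((V i).1.2 - p.2 (V i).1.1))))
      = - (ρ p.1.1 * fderiv ℝ l p (inZ (dxTensor m i ((p.2 - B) (frame n i))))) := by
    intro i
    have : ((stdVol n).curryLeft.flipAlternating (i.removeNth (frame n))).smulRight
        ((V i).1.2 - p.2 (V i).1.1)
        = -((-1 : ℝ) ^ (i : ℕ) • dxTensor m i ((p.2 - B) (frame n i))) := by
      rw [stdVol_curryLeft_removeNth, hV]
      ext1 w
      simp [mul_smul, smul_sub]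
    rw [this]
    simp only [map_neg, map_smul, smul_eq_mul]
    have hs : (-1 : ℝ) ^ (i : ℕ) * (-1) ^ (i : ℕ) = 1 := by simp [← mul_pow]
    linear_combination (-(ρ p.1.1 * fderiv ℝ l p (inZ (dxTensor m i ((p.2 - B) (frame n i)))))) * hs
  rw [Finset.sum_congr rfl fun i _ ↦ h2 i, Finset.sum_neg_distrib, ← Finset.mul_sum,
    ← map_sum, ← map_sum, sum_dxTensor]
  ring

/-- The contact forms vanish on the vectors `V i`, so of the sum in `locTheta` only the summand in
which the contact form meets `x` survives. -/
theorem locTheta_cons_tangent (x : EJet n m) (p : EJet n m) (V : Fin (n + 1) → EJet n m)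
    (hV : ∀ i, (V i).1 = (frame n i, p.2 (frame n i))) (μ : Fin (n + 1)) :
    locTheta ρ l p (Fin.cons x (μ.removeNth V)) = (-1) ^ (μ : ℕ) *
      (l p * ρ p.1.1 * x.1.1 μ
        + ρ p.1.1 * fderiv ℝ l p (inZ (dxTensor m μ (x.1.2 - p.2 x.1.1)))) := by
  have h1 : (fun i ↦ ((Fin.cons x (μ.removeNth V) : Fin (n + 1) → EJet n m) i).1.1)
      = Fin.cons x.1.1 (μ.removeNth (frame n)) := by
    funext i
    refine Fin.cases ?_ (fun j ↦ ?_) i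
    · rfl
    · simp [Fin.removeNth, hV]
  rw [locTheta, h1, stdVol_cons_removeNth, Fin.sum_univ_succ, Finset.sum_eq_zero, add_zero]
  · have : (Fin.removeNth 0 (Fin.cons x.1.1 (μ.removeNth (frame n)) : Fin (n + 1) → EBase n))
        = μ.removeNth (frame n) := by
      funext j
      simp [Fin.removeNth]
    simp only [Fin.cons_zero, this, stdVol_curryLeft_removeNth]
    have : ((-1 : ℝ) ^ (μ : ℕ) • (EuclideanSpace.proj μ : EBase n →L[ℝ] ℝ)).smulRight
        (x.1.2 - p.2 x.1.1) = (-1 : ℝ) ^ (μ : ℕ) • dxTensor m μ (x.1.2 - p.2 x.1.1) := by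
      ext1 w
      simp [mul_smul, smul_sub]
    rw [this]
    simp only [map_smul, smul_eq_mul, Fin.val_zero, pow_zero]
    ring
  · intro i _
    have : ((Fin.cons x (μ.removeNth V) : Fin (n + 1) → EJet n m) i.succ).1.2
        - p.2 ((Fin.cons x (μ.removeNth V) : Fin (n + 1) → EJet n m) i.succ).1.1 = 0 := by
      simp [Fin.removeNth, hV]
    rw [this]
    simp

theorem eventually_fst_fderiv_locJet (hu : ∀ᶠ b in 𝓝 a, ContDiffAt ℝ ∞ u b) :
    ∀ᶠ b in 𝓝 a, ∀ v, (fderiv ℝ (locJet u) b v).1 = (v, fderiv ℝ u b v) := by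
  filter_upwards [hu] with b hb v
  rw [(hasFDerivAt_locJet hb).fderiv]
  rfl

/-- The derivative in the parameter `s` that enters the exterior derivative of the pullback `κ` of
`Θ` along `(s, b) ↦ j¹u(b) + s x`. At parameter `s` the frame keeps its position part `(e_i, Du
e_i)`, while the `z`-coordinate of the point has moved by `s x.2`. The contact terms therefore
contribute `-s ρ ∂ℓ/∂z (x.2)`, whose derivative is the last term. -/
theorem fderiv_locTheta_param (hρ : ContDiffAt ℝ ∞ ρ a) (hl : ContDiffAt ℝ ∞ l (locJet u a))
    (hu : ∀ᶠ b in 𝓝 a, ContDiffAt ℝ ∞ u b) (x : EJet n m)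
    {κ : ℝ × EBase n → (ℝ × EBase n) [⋀^Fin (n + 1)]→L[ℝ] ℝ} (hκ : DifferentiableAt ℝ κ (0, a))
    (h : ∀ᶠ q in 𝓝 ((0 : ℝ), a), ∀ W, κ q W = locTheta ρ l (locJet u q.2 + q.1 • x)
      (fun i ↦ fderiv ℝ (locJet u) q.2 (W i).2 + (W i).1 • x)) :
    fderiv ℝ (fun q ↦ κ q (fun i ↦ (0, frame n i))) (0, a) (1, 0)
      = fderiv ℝ l (locJet u a) x * ρ a + l (locJet u a) * fderiv ℝ ρ a x.1.1
        - ρ a * fderiv ℝ l (locJet u a) (inZ x.2) := by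
  have hjet := eventually_fst_fderiv_locJet hu
  have hdl := hl.differentiableAt (by simp)
  have hdρ := hρ.differentiableAt (by simp)
  have hd : HasFDerivAt (fun q ↦ κ q (fun i ↦ (0, frame n i)))
      (fderiv ℝ (fun q ↦ κ q (fun i ↦ (0, frame n i))) (0, a)) ((fun s : ℝ ↦ (s, a)) 0) :=
    (hκ.continuousAlternatingMap_apply_const _).hasFDerivAt
  have hc : HasDerivAt (fun s : ℝ ↦ (s, a)) ((1 : ℝ), (0 : EBase n)) 0 :=
    (hasDerivAt_id (0 : ℝ)).prodMk (hasDerivAt_const (0 : ℝ) a)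
  have h1 := hd.comp_hasDerivAt 0 hc
  have hline : HasDerivAt (fun s : ℝ ↦ locJet u a + s • x) x 0 := by
    simpa using ((hasDerivAt_id (0 : ℝ)).smul_const x).const_add (locJet u a)
  have h0 : locJet u a + (0 : ℝ) • x = locJet u a := by rw [zero_smul ℝ x, add_zero]
  have hl1 : HasDerivAt (fun s : ℝ ↦ l (locJet u a + s • x)) (fderiv ℝ l (locJet u a) x) 0 := by
    refine HasFDerivAt.comp_hasDerivAt (0 : ℝ) (l := l) ?_ hline
    rw [h0]
    exact hdl.hasFDerivAt
  have hρ1 : HasDerivAt (fun s : ℝ ↦ ρ (a + s • x.1.1)) (fderiv ℝ ρ a x.1.1) 0 := by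
    have hline' : HasDerivAt (fun s : ℝ ↦ a + s • x.1.1) x.1.1 0 := by
      simpa using ((hasDerivAt_id (0 : ℝ)).smul_const x.1.1).const_add a
    refine HasFDerivAt.comp_hasDerivAt (0 : ℝ) (l := ρ) ?_ hline'
    simpa using hdρ.hasFDerivAt
  -- The value of this derivative is irrelevant: the factor is multiplied by `s`, which is zero at
  -- the point considered.
  have hl2 : DifferentiableAt ℝ (fun s : ℝ ↦ fderiv ℝ l (locJet u a + s • x) (inZ x.2)) 0 := by
    have hdd : DifferentiableAt ℝ (fderiv ℝ l) (locJet u a + (0 : ℝ) • x) := by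
      rw [h0]
      exact (hl.fderiv_right (m := ∞) (by simp)).differentiableAt (by simp)
    exact (DifferentiableAt.comp (0 : ℝ) (g := fderiv ℝ l) hdd
      hline.differentiableAt).clm_apply (differentiableAt_const _)
  have h2 : HasDerivAt (fun s : ℝ ↦ l (locJet u a + s • x) * ρ (a + s • x.1.1)
      - s * (ρ (a + s • x.1.1) * fderiv ℝ l (locJet u a + s • x) (inZ x.2)))
      (fderiv ℝ l (locJet u a) x * ρ a + l (locJet u a) * fderiv ℝ ρ a x.1.1
      - ρ a * fderiv ℝ l (locJet u a) (inZ x.2)) 0 := by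
    have := (hl1.mul hρ1).sub ((hasDerivAt_id (0 : ℝ)).mul (hρ1.mul hl2.hasDerivAt))
    refine HasDerivAt.congr_deriv this ?_
    simp only [id, zero_mul, one_mul, add_zero]
    change _ - ρ (a + (0 : ℝ) • x.1.1) * fderiv ℝ l (locJet u a + (0 : ℝ) • x) (inZ x.2) = _
    rw [h0, zero_smul ℝ x.1.1, add_zero]
  refine h1.unique (h2.congr_of_eventuallyEq ?_)
  have hcont : Tendsto (fun s : ℝ ↦ (s, a)) (𝓝 0) (𝓝 (0, a)) := by
    have := hc.continuousAt.tendsto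
    simpa using this
  filter_upwards [hcont.eventually h] with s hs
  change κ (s, a) _ = _
  rw [hs, locTheta_tangent (fderiv ℝ u a)]
  · have e1 : (locJet u a + s • x).1.1 = a + s • x.1.1 := rfl
    have e2 : (locJet u a + s • x).2 - fderiv ℝ u a = s • x.2 := by
      simp [locJet]
    have e3 : fderiv ℝ l (locJet u a + s • x) (inZ (s • x.2))
        = s * fderiv ℝ l (locJet u a + s • x) (inZ x.2) :=
      ((fderiv ℝ l (locJet u a + s • x)).comp inZ).map_smul s x.2
    rw [e1, e2, e3]
    ring
  · intro i
    simp [hjet.self_of_nhds]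

/-- The derivatives in the base directions. For `s = 0` the point lies on the 1-jet of `u` and the
remaining frame vectors are tangent to it, so `locTheta_cons_tangent` evaluates `κ` at all base
points near `a`, and the result can be differentiated. -/
theorem fderiv_locTheta_base (hρ : ContDiffAt ℝ ∞ ρ a) (hl : ContDiffAt ℝ ∞ l (locJet u a))
    (hu : ∀ᶠ b in 𝓝 a, ContDiffAt ℝ ∞ u b) (x : EJet n m)
    {κ : ℝ × EBase n → (ℝ × EBase n) [⋀^Fin (n + 1)]→L[ℝ] ℝ} (hκ : DifferentiableAt ℝ κ (0, a))
    (h : ∀ᶠ q in 𝓝 ((0 : ℝ), a), ∀ W, κ q W = locTheta ρ l (locJet u q.2 + q.1 • x)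
      (fun i ↦ fderiv ℝ (locJet u) q.2 (W i).2 + (W i).1 • x))
    (μ : Fin (n + 1)) :
    fderiv ℝ (fun q ↦ κ q (Fin.cons (1, 0) (μ.removeNth fun i ↦ (0, frame n i)))) (0, a)
        (0, frame n μ)
      = (-1) ^ (μ : ℕ) * fderiv ℝ (fun b ↦ l (locJet u b) * ρ b * x.1.1 μ
          + momentum ρ l u μ b (x.1.2 - fderiv ℝ u b x.1.1)) a (frame n μ) := by
  have hua := hu.self_of_nhds
  have hjet := eventually_fst_fderiv_locJet hu
  have hdl := hl.differentiableAt (by simp)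
  have hdρ := hρ.differentiableAt (by simp)
  have hdj : DifferentiableAt ℝ (locJet u) a := (hasFDerivAt_locJet hua).differentiableAt
  set W : Fin (n + 1) → ℝ × EBase n := Fin.cons (1, 0) (μ.removeNth fun i ↦ (0, frame n i))
    with hW
  have hd : HasFDerivAt (fun q ↦ κ q W) (fderiv ℝ (fun q ↦ κ q W) (0, a))
      ((fun b : EBase n ↦ ((0 : ℝ), b)) a) :=
    (hκ.continuousAlternatingMap_apply_const _).hasFDerivAt
  have hc : HasFDerivAt (fun b : EBase n ↦ ((0 : ℝ), b))
      (ContinuousLinearMap.inr ℝ ℝ (EBase n)) a :=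
    (ContinuousLinearMap.inr ℝ ℝ (EBase n)).hasFDerivAt
  have h1 := (hd.comp a hc).fderiv
  have h2 : fderiv ℝ ((fun q ↦ κ q W) ∘ fun b : EBase n ↦ ((0 : ℝ), b)) a
      = fderiv ℝ (fun b ↦ (-1) ^ (μ : ℕ) * (l (locJet u b) * ρ b * x.1.1 μ
        + momentum ρ l u μ b (x.1.2 - fderiv ℝ u b x.1.1))) a := by
    apply Filter.EventuallyEq.fderiv_eq
    have hcont : Tendsto (fun b : EBase n ↦ ((0 : ℝ), b)) (𝓝 a) (𝓝 (0, a)) :=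
      hc.continuousAt.tendsto
    filter_upwards [hcont.eventually h, hjet] with b hb hjb
    change κ (0, b) W = _
    rw [hb]
    have e1 : (fun i ↦ fderiv ℝ (locJet u) b (W i).2 + (W i).1 • x)
        = Fin.cons x (μ.removeNth fun i ↦ fderiv ℝ (locJet u) b (frame n i)) := by
      funext i
      refine Fin.cases ?_ (fun j ↦ ?_) i
      · simp [hW]
      · simp only [hW, Fin.removeNth, Fin.cons_succ]
        rw [zero_smul ℝ x, add_zero]
    simp only [e1]
    rw [zero_smul ℝ x, add_zero, locTheta_cons_tangent]
    · simp only [momentum, locJet]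
      simp
    · intro i
      exact hjb _
  rw [h1] at h2
  have h3 := congrArg (fun f ↦ f (frame n μ)) h2
  simp only [ContinuousLinearMap.comp_apply, ContinuousLinearMap.inr_apply] at h3
  rw [h3, ← smul_eq_mul, ← smul_apply]
  congr 1
  refine fderiv_const_mul ?_ _
  refine (((hdl.comp a hdj).mul hdρ).mul (differentiableAt_const _)).add ?_
  refine ((contDiffAt_momentum hρ hl hua μ).differentiableAt (by simp)).clm_apply ?_
  exact (differentiableAt_const _).sub
    (((hua.fderiv_right (m := ∞) (by simp)).differentiableAt (by simp)).clm_apply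
      (differentiableAt_const _))

/-- The first two terms are the derivative of `ρ ℓ` along the 1-jet of `u` in the direction `x.1.1`.
In the last one the symmetry of the second derivative has turned `∑ p_μ (D²u(e_μ, x.1.1))` into a
`∂ℓ/∂z` term, the shape in which it cancels in `extDeriv_locTheta`. -/
theorem sum_fderiv_momentum (hρ : ContDiffAt ℝ ∞ ρ a) (hl : ContDiffAt ℝ ∞ l (locJet u a))
    (hua : ContDiffAt ℝ ∞ u a) (x : EJet n m) :
    ∑ μ, fderiv ℝ (fun b ↦ l (locJet u b) * ρ b * x.1.1 μ
          + momentum ρ l u μ b (x.1.2 - fderiv ℝ u b x.1.1)) a (frame n μ)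
      = fderiv ℝ l (locJet u a) ((x.1.1, fderiv ℝ u a x.1.1), fderiv ℝ (fderiv ℝ u) a x.1.1) * ρ a
        + l (locJet u a) * fderiv ℝ ρ a x.1.1
        + (∑ μ, fderiv ℝ (momentum ρ l u μ) a (frame n μ)) (x.1.2 - fderiv ℝ u a x.1.1)
        - ρ a * fderiv ℝ l (locJet u a) (inZ (fderiv ℝ (fderiv ℝ u) a x.1.1)) := by
  have hdl := hl.differentiableAt (by simp)
  have hdρ := hρ.differentiableAt (by simp)
  have hdj : DifferentiableAt ℝ (locJet u) a := (hasFDerivAt_locJet hua).differentiableAt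
  have hC : ∀ μ : Fin (n + 1), fderiv ℝ (fun b ↦ l (locJet u b) * ρ b * x.1.1 μ
          + momentum ρ l u μ b (x.1.2 - fderiv ℝ u b x.1.1)) a (frame n μ)
      = (fderiv ℝ (fun b ↦ l (locJet u b) * ρ b) a (frame n μ)) * x.1.1 μ
        + (fderiv ℝ (momentum ρ l u μ) a (frame n μ) (x.1.2 - fderiv ℝ u a x.1.1)
          - momentum ρ l u μ a (fderiv ℝ (fderiv ℝ u) a (frame n μ) x.1.1)) := by
    intro μ
    have d1 : DifferentiableAt ℝ (fun b ↦ l (locJet u b) * ρ b) a := (hdl.comp a hdj).mul hdρ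
    have d2 := (contDiffAt_momentum hρ hl hua μ).differentiableAt (by simp)
    have d3 : HasFDerivAt (fun b ↦ x.1.2 - fderiv ℝ u b x.1.1)
        (-((fderiv ℝ (fderiv ℝ u) a).flip x.1.1)) a := by
      have := ((hua.fderiv_right (m := ∞) (by simp)).differentiableAt
        (by simp)).hasFDerivAt.clm_apply (hasFDerivAt_const x.1.1 a)
      simpa using this.const_sub x.1.2
    have d4 := (d1.hasFDerivAt.mul_const (x.1.1 μ)).add (d2.hasFDerivAt.clm_apply d3)
    refine (congrArg (fun f ↦ f (frame n μ)) d4.fderiv).trans ?_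
    simp
    ring
  have hD : ∑ μ, (fderiv ℝ (fun b ↦ l (locJet u b) * ρ b) a (frame n μ)) * x.1.1 μ
      = fderiv ℝ (fun b ↦ l (locJet u b) * ρ b) a x.1.1 := by
    conv_rhs => rw [← sum_smul_frame x.1.1]
    simp [map_sum, mul_comm]
  have hE : fderiv ℝ (fun b ↦ l (locJet u b) * ρ b) a x.1.1
      = fderiv ℝ l (locJet u a) ((x.1.1, fderiv ℝ u a x.1.1), fderiv ℝ (fderiv ℝ u) a x.1.1) * ρ a
        + l (locJet u a) * fderiv ℝ ρ a x.1.1 := by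
    have hcomp : HasFDerivAt (fun b ↦ l (locJet u b)) _ a :=
      hdl.hasFDerivAt.comp a (hasFDerivAt_locJet hua)
    refine (congrArg (fun f ↦ f x.1.1) (hcomp.mul hdρ.hasFDerivAt).fderiv).trans ?_
    simp
    ring
  have hsymm : ∀ v w, fderiv ℝ (fderiv ℝ u) a v w = fderiv ℝ (fderiv ℝ u) a w v := by
    have := hua.isSymmSndFDerivAt (by simpa using ENat.LEInfty.out)
    exact fun v w ↦ this v w
  have hF : ∑ μ, momentum ρ l u μ a (fderiv ℝ (fderiv ℝ u) a (frame n μ) x.1.1)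
      = ρ a * fderiv ℝ l (locJet u a) (inZ (fderiv ℝ (fderiv ℝ u) a x.1.1)) := by
    simp only [hsymm _ x.1.1]
    conv_rhs => rw [← sum_dxTensor (fderiv ℝ (fderiv ℝ u) a x.1.1)]
    simp [momentum, map_sum, Finset.mul_sum]
  rw [← hE, ← hD, ← hF, sum_apply, ← Finset.sum_add_distrib, ← Finset.sum_sub_distrib]
  refine Finset.sum_congr rfl fun μ _ ↦ ?_
  rw [hC]
  ring

/-- The exterior derivative is the parameter derivative minus the divergence in the base directions.
Decompose `x` into the tangent vector of the 1-jet over `x.1.1`, the vertical vector `x.1.2 - Du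
x.1.1` and a `∂/∂z` vector. The first and the last cancel between the two expressions; the vertical
part leaves `ρ ∂ℓ/∂y - ∂_μ p_μ`. -/
theorem extDeriv_locTheta (hρ : ContDiffAt ℝ ∞ ρ a) (hl : ContDiffAt ℝ ∞ l (locJet u a))
    (hu : ∀ᶠ b in 𝓝 a, ContDiffAt ℝ ∞ u b) (x : EJet n m)
    {κ : ℝ × EBase n → (ℝ × EBase n) [⋀^Fin (n + 1)]→L[ℝ] ℝ} (hκ : DifferentiableAt ℝ κ (0, a))
    (h : ∀ᶠ q in 𝓝 ((0 : ℝ), a), ∀ W, κ q W = locTheta ρ l (locJet u q.2 + q.1 • x)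
      (fun i ↦ fderiv ℝ (locJet u) q.2 (W i).2 + (W i).1 • x)) :
    extDeriv κ (0, a) (Fin.cons (1, 0) (fun i ↦ (0, frame n i)))
      = eulerLagrange ρ l u a (x.1.2 - fderiv ℝ u a x.1.1) := by
  rw [extDeriv_apply hκ, Fin.sum_univ_succ]
  have hr0 : (Fin.removeNth 0 (Fin.cons (1, 0) (fun i ↦ (0, frame n i)) :
      Fin (n + 2) → ℝ × EBase n)) = fun i ↦ (0, frame n i) := by
    funext j
    simp [Fin.removeNth]
  have hrs : ∀ μ : Fin (n + 1), (Fin.removeNth μ.succ (Fin.cons (1, 0) (fun i ↦ (0, frame n i)) :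
      Fin (n + 2) → ℝ × EBase n)) = Fin.cons (1, 0) (μ.removeNth fun i ↦ (0, frame n i)) := by
    intro μ
    funext j
    refine Fin.cases ?_ (fun k ↦ ?_) j
    · simp [Fin.removeNth]
    · simp [Fin.removeNth]
  simp only [hr0, hrs, Fin.cons_zero, Fin.cons_succ, fderiv_locTheta_param hρ hl hu x hκ h,
    fderiv_locTheta_base hρ hl hu x hκ h, Fin.val_zero, pow_zero, one_smul,
    Fin.val_succ]
  have hs : ∀ (k : ℕ) (r : ℝ), (-1 : ℤ) ^ (k + 1) • ((-1) ^ k * r) = -r := by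
    intro k r
    have : (-1 : ℝ) ^ k * (-1) ^ k = 1 := by simp [← mul_pow]
    rw [zsmul_eq_mul]
    push_cast
    linear_combination (-r) * this
  simp only [hs, Finset.sum_neg_distrib]
  rw [sum_fderiv_momentum hρ hl hu.self_of_nhds]
  have s1 : x = ((x.1.1, fderiv ℝ u a x.1.1), fderiv ℝ (fderiv ℝ u) a x.1.1)
      + inY (x.1.2 - fderiv ℝ u a x.1.1) + inZ x.2 - inZ (fderiv ℝ (fderiv ℝ u) a x.1.1) := by
    rw [inY_apply, inZ_apply, inZ_apply]
    ext <;> simp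
  have s2 := congrArg (fderiv ℝ l (locJet u a)) s1
  rw [map_sub, map_add, map_add] at s2
  rw [s2]
  simp only [eulerLagrange, sub_apply, smul_apply,
    ContinuousLinearMap.comp_apply, smul_eq_mul]
  ring

end EulerLagrange

/-! ### Pullbacks of forms and changes of charts -/

section SmoothCharts

variable {E : Type*} [NormedAddCommGroup E] [NormedSpace ℝ E]
  {M : Type*} [TopologicalSpace M] [ChartedSpace E M]
  {E' : Type*} [NormedAddCommGroup E'] [NormedSpace ℝ E']
  {N : Type*} [TopologicalSpace N] [ChartedSpace E' N]
  {E'' : Type*} [NormedAddCommGroup E''] [NormedSpace ℝ E'']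
  {N' : Type*} [TopologicalSpace N'] [ChartedSpace E'' N']
  {F : Type*} [NormedAddCommGroup F] [NormedSpace ℝ F]
  {k : ℕ}

variable (E E') in
/-- The differential of a map, as a continuous linear map between the model spaces. -/
def tder (f : M → N) (x : M) : E →L[ℝ] E' := mfderiv 𝓘(ℝ, E) 𝓘(ℝ, E') f x

theorem tder_comp {g : N → N'} {f : M → N} {x : M}
    (hg : MDifferentiableAt 𝓘(ℝ, E') 𝓘(ℝ, E'') g (f x))
    (hf : MDifferentiableAt 𝓘(ℝ, E) 𝓘(ℝ, E') f x) :
    tder E E'' (g ∘ f) x = (tder E' E'' g (f x)).comp (tder E E' f x) :=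
  mfderiv_comp x hg hf

theorem tder_congr {f g : M → N} {x : M} (h : f =ᶠ[𝓝 x] g) : tder E E' f x = tder E E' g x :=
  h.mfderiv_eq

theorem tder_eq_fderiv (f : E → F) (x : E) : tder E F f x = fderiv ℝ f x := mfderiv_eq_fderiv

theorem tder_clm (f : E →L[ℝ] F) (x : E) : tder E F f x = f := by
  rw [tder_eq_fderiv, f.fderiv]

theorem pullback_comp {g : N → N'} {f : M → N} {x : M} (α : DiffForm E'' N' k)
    (hg : MDifferentiableAt 𝓘(ℝ, E') 𝓘(ℝ, E'') g (f x))
    (hf : MDifferentiableAt 𝓘(ℝ, E) 𝓘(ℝ, E') f x) :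
    pullback (E := E) (E' := E'') (g ∘ f) α x
      = (pullback (E := E') (E' := E'') g α (f x)).compContinuousLinearMap
        (mfderiv 𝓘(ℝ, E) 𝓘(ℝ, E') f x : E →L[ℝ] E') := by
  unfold pullback
  rw [mfderiv_comp x hg hf]
  rfl

theorem pullback_congr {f g : M → N} {x : M} (α : DiffForm E' N k) (h : f =ᶠ[𝓝 x] g) :
    pullback (E := E) (E' := E') f α x = pullback (E := E) (E' := E') g α x := by
  unfold pullback
  rw [h.mfderiv_eq, h.self_of_nhds]

/-- An open partial homeomorphism to a normed space which is a diffeomorphism. -/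
structure IsSmoothChart (e : OpenPartialHomeomorph M F) : Prop where
  smooth : ContMDiffOn 𝓘(ℝ, E) 𝓘(ℝ, F) ∞ e e.source
  symm_smooth : ContMDiffOn 𝓘(ℝ, F) 𝓘(ℝ, E) ∞ e.symm e.target

theorem isSmoothChart_chartAt [IsManifold 𝓘(ℝ, E) ∞ M] (x : M) :
    IsSmoothChart (E := E) (chartAt E x) :=
  ⟨contMDiffOn_chart, contMDiffOn_chart_symm⟩

theorem isSmoothChart_of_mem_maximalAtlas [IsManifold 𝓘(ℝ, E) ∞ M]
    {e : OpenPartialHomeomorph M E} (he : e ∈ IsManifold.maximalAtlas 𝓘(ℝ, E) ∞ M) :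
    IsSmoothChart (E := E) e :=
  ⟨contMDiffOn_of_mem_maximalAtlas he, contMDiffOn_symm_of_mem_maximalAtlas he⟩

namespace IsSmoothChart

variable {e : OpenPartialHomeomorph M F}

theorem contMDiffAt (he : IsSmoothChart (E := E) e) {x : M} (hx : x ∈ e.source) :
    ContMDiffAt 𝓘(ℝ, E) 𝓘(ℝ, F) ∞ e x :=
  he.smooth.contMDiffAt (e.open_source.mem_nhds hx)

theorem contMDiffAt_symm (he : IsSmoothChart (E := E) e) {a : F} (ha : a ∈ e.target) :
    ContMDiffAt 𝓘(ℝ, F) 𝓘(ℝ, E) ∞ e.symm a :=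
  he.symm_smooth.contMDiffAt (e.open_target.mem_nhds ha)

theorem mdiffAt (he : IsSmoothChart (E := E) e) {x : M} (hx : x ∈ e.source) :
    MDifferentiableAt 𝓘(ℝ, E) 𝓘(ℝ, F) e x :=
  (he.contMDiffAt hx).mdifferentiableAt (by simp)

theorem mdiffAt_symm (he : IsSmoothChart (E := E) e) {a : F} (ha : a ∈ e.target) :
    MDifferentiableAt 𝓘(ℝ, F) 𝓘(ℝ, E) e.symm a :=
  (he.contMDiffAt_symm ha).mdifferentiableAt (by simp)

/-- The differential of the chart at a point of the manifold. -/
theorem mfderiv_symm_mfderiv (he : IsSmoothChart (E := E) e) {x : M} (hx : x ∈ e.source) (v : E) :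
    (mfderiv 𝓘(ℝ, F) 𝓘(ℝ, E) e.symm (e x) : F →L[ℝ] E)
      ((mfderiv 𝓘(ℝ, E) 𝓘(ℝ, F) e x : E →L[ℝ] F) v) = v := by
  have h := mfderiv_comp x (he.mdiffAt_symm (e.map_source hx)) (he.mdiffAt hx)
  have he' : (e.symm ∘ e) =ᶠ[𝓝 x] id := by
    filter_upwards [e.open_source.mem_nhds hx] with y hy using e.left_inv hy
  rw [he'.mfderiv_eq, mfderiv_id] at h
  exact (congrArg (fun f : E →L[ℝ] E ↦ f v) h).symm

theorem contDiffAt_change {F' : Type*} [NormedAddCommGroup F'] [NormedSpace ℝ F']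
    {e' : OpenPartialHomeomorph M F'} (he : IsSmoothChart (E := E) e)
    (he' : IsSmoothChart (E := E) e') {a : F} (ha : a ∈ e.target) (ha' : e.symm a ∈ e'.source) :
    ContDiffAt ℝ ∞ (e' ∘ e.symm) a :=
  contMDiffAt_iff_contDiffAt.1 ((he'.contMDiffAt ha').comp a (he.contMDiffAt_symm ha))

end IsSmoothChart

/-- The expression of a form in one chart in terms of its expression in another chart. -/
theorem pullback_symm_change {F' : Type*} [NormedAddCommGroup F'] [NormedSpace ℝ F']
    {e : OpenPartialHomeomorph M F} {e' : OpenPartialHomeomorph M F'}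
    (he : IsSmoothChart (E := E) e) (he' : IsSmoothChart (E := E) e') (α : DiffForm E M k)
    {a : F} (ha : a ∈ e.target) (ha' : e.symm a ∈ e'.source) :
    pullback (E := F) (E' := E) e.symm α a
      = (pullback (E := F') (E' := E) e'.symm α ((e' ∘ e.symm) a)).compContinuousLinearMap
        (fderiv ℝ (e' ∘ e.symm) a) := by
  have h1 : e.symm =ᶠ[𝓝 a] e'.symm ∘ (e' ∘ e.symm) := by
    have hc := (e.continuousAt_symm ha).preimage_mem_nhds (e'.open_source.mem_nhds ha')
    filter_upwards [hc] with b hb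
    exact (e'.left_inv hb).symm
  have h2 : MDifferentiableAt 𝓘(ℝ, F) 𝓘(ℝ, F') (e' ∘ e.symm) a :=
    ((he'.contMDiffAt ha').comp a (he.contMDiffAt_symm ha)).mdifferentiableAt (by simp)
  rw [pullback_congr α h1, pullback_comp (f := e' ∘ e.symm) (x := a) α
      (he'.mdiffAt_symm (e'.map_source ha')) h2,
    mfderiv_eq_fderiv]
  rfl

end SmoothCharts

/-! ### The density of a volume form in a chart -/

section Density

variable {n : ℕ} {X : Type*} [TopologicalSpace X] [ChartedSpace (EBase n) X]
  {η : DiffForm (EBase n) X (n + 1)}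

/-- The density `ρ` of the form `η = ρ dx^0 ∧ ⋯ ∧ dx^n` in the coordinates `e`. -/
def chartDensity (η : DiffForm (EBase n) X (n + 1)) (e : OpenPartialHomeomorph X (EBase n))
    (a : EBase n) : ℝ :=
  pullback (E := EBase n) (E' := EBase n) e.symm η a (frame n)

theorem pullback_symm_eq (η : DiffForm (EBase n) X (n + 1))
    (e : OpenPartialHomeomorph X (EBase n)) (a : EBase n) :
    pullback (E := EBase n) (E' := EBase n) e.symm η a = chartDensity η e a • stdVol n :=
  eq_smul_stdVol _

theorem stdVol_comp (A : EBase n →L[ℝ] EBase n) :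
    stdVol n (fun i ↦ A (frame n i)) = A.det := by
  have h := (baseBasis n).det_comp (A : EBase n →ₗ[ℝ] EBase n) (frame n)
  rw [← coe_baseBasis, (baseBasis n).det_self, mul_one] at h
  rw [← coe_baseBasis]
  exact h

theorem chartDensity_change {e e' : OpenPartialHomeomorph X (EBase n)}
    (he : IsSmoothChart (E := EBase n) e) (he' : IsSmoothChart (E := EBase n) e')
    (η : DiffForm (EBase n) X (n + 1)) {a : EBase n} (ha : a ∈ e.target)
    (ha' : e.symm a ∈ e'.source) :
    chartDensity η e a
      = chartDensity η e' ((e' ∘ e.symm) a) * (fderiv ℝ (e' ∘ e.symm) a).det := by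
  rw [chartDensity, pullback_symm_change he he' η ha ha', pullback_symm_eq]
  change chartDensity η e' ((e' ∘ e.symm) a) •
    stdVol n (fun i ↦ fderiv ℝ (e' ∘ e.symm) a (frame n i)) = _
  rw [stdVol_comp]
  rfl

theorem chartDensity_ne_zero {e : OpenPartialHomeomorph X (EBase n)}
    (he : IsSmoothChart (E := EBase n) e) (hη : IsVolumeForm η) {a : EBase n}
    (ha : a ∈ e.target) : chartDensity η e a ≠ 0 := by
  intro h
  have h0 : pullback (E := EBase n) (E' := EBase n) e.symm η a = 0 := eq_zero_of_apply_frame h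
  apply hη.ne_zero (e.symm a)
  ext v
  have h1 := congrArg (fun f ↦ f (fun i ↦
    (mfderiv 𝓘(ℝ, EBase n) 𝓘(ℝ, EBase n) e (e.symm a) : EBase n →L[ℝ] EBase n) (v i))) h0
  have hx := e.map_target ha
  have h2 := fun w ↦ he.mfderiv_symm_mfderiv hx w
  rw [e.right_inv ha] at h2
  refine Eq.trans ?_ h1
  change _ = η (e.symm a) (fun i ↦ (mfderiv 𝓘(ℝ, EBase n) 𝓘(ℝ, EBase n) e.symm a :
    EBase n →L[ℝ] EBase n) ((mfderiv 𝓘(ℝ, EBase n) 𝓘(ℝ, EBase n) e (e.symm a) :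
      EBase n →L[ℝ] EBase n) (v i)))
  exact congrArg (η (e.symm a)) (funext fun i ↦ (h2 (v i)).symm)

/-- Smoothness of `η` is given in the preferred charts only. The density in another chart is
obtained by composing with the change of coordinates and multiplying by its Jacobian determinant,
both smooth. -/
theorem contDiffAt_chartDensity [IsManifold (𝓡 (n + 1)) ∞ X]
    {e : OpenPartialHomeomorph X (EBase n)}
    (he : IsSmoothChart (E := EBase n) e) (hη : IsVolumeForm η) {a : EBase n}
    (ha : a ∈ e.target) : ContDiffAt ℝ ∞ (chartDensity η e) a := by
  set e' := chartAt (EBase n) (e.symm a) with he'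
  have hs' : IsSmoothChart (E := EBase n) e' := isSmoothChart_chartAt _
  have ha' : e.symm a ∈ e'.source := mem_chart_source _ _
  have hc := (e.continuousAt_symm ha).preimage_mem_nhds (e'.open_source.mem_nhds ha')
  have hev : chartDensity η e =ᶠ[𝓝 a] fun b ↦ chartDensity η e' ((e' ∘ e.symm) b) *
      stdVol n (fun i ↦ fderiv ℝ (e' ∘ e.symm) b (frame n i)) := by
    filter_upwards [hc, e.open_target.mem_nhds ha] with b hb hb'
    rw [chartDensity_change he hs' η hb' hb, stdVol_comp]
  refine ContDiffAt.congr_of_eventuallyEq ?_ hev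
  have hτ := he.contDiffAt_change hs' ha ha'
  have h1 : ContDiffAt ℝ ∞ (formInChart (e.symm a) η) ((e' ∘ e.symm) a) :=
    (hη.smooth (e.symm a)).contDiffAt (e'.open_target.mem_nhds (e'.map_source ha'))
  have h2 : ContDiffAt ℝ ∞ (chartDensity η e') ((e' ∘ e.symm) a) :=
    (ContinuousAlternatingMap.apply ℝ (EBase n) ℝ (frame n)).contDiff.contDiffAt.comp _ h1
  refine (h2.comp a hτ).mul ?_
  refine (stdVol n).toContinuousMultilinearMap.contDiff.contDiffAt.comp a ?_
  rw [contDiffAt_pi]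
  intro i
  exact (hτ.fderiv_right (m := ∞) (by simp)).clm_apply contDiffAt_const

end Density

/-! ### The measure of a volume form -/

section Measure

variable {n : ℕ} {X : Type*} [TopologicalSpace X] [ChartedSpace (EBase n) X]
  [IsManifold (𝓡 (n + 1)) ∞ X] [MeasurableSpace X] [BorelSpace X]
  {η : DiffForm (EBase n) X (n + 1)} {e e' : OpenPartialHomeomorph X (EBase n)}

/-- The measure with density `|ρ|` in the coordinates `e`. -/
def coordMeasure (η : DiffForm (EBase n) X (n + 1)) (e : OpenPartialHomeomorph X (EBase n)) :
    Measure X :=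
  ((volume.restrict e.target).withDensity
    (fun a ↦ ENNReal.ofReal |chartDensity η e a|)).map e.symm

theorem aemeasurable_symm (e : OpenPartialHomeomorph X (EBase n)) :
    AEMeasurable e.symm ((volume : Measure (EBase n)).restrict e.target) :=
  e.continuousOn_symm.aemeasurable e.open_target.measurableSet

theorem aemeasurable_density (he : IsSmoothChart (E := EBase n) e) (hη : IsVolumeForm η) :
    AEMeasurable (fun a ↦ ENNReal.ofReal |chartDensity η e a|)
      ((volume : Measure (EBase n)).restrict e.target) := by
  have h : ContinuousOn (fun a ↦ |chartDensity η e a|) e.target := fun a ha ↦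
    (contDiffAt_chartDensity he hη ha).continuousAt.abs.continuousWithinAt
  exact (h.aemeasurable e.open_target.measurableSet).ennreal_ofReal

theorem measurableSet_image (e : OpenPartialHomeomorph X (EBase n)) {A : Set X}
    (hA : MeasurableSet A) (hAe : A ⊆ e.source) : MeasurableSet (e '' A) := by
  rw [e.image_eq_target_inter_inv_preimage hAe]
  have h := (continuousOn_iff_continuous_domRestrict.1 e.continuousOn_symm).measurable hA
  have h2 := e.open_target.measurableSet.subtype_image h
  convert h2 using 1
  ext a
  simp [and_comm]

theorem coordMeasure_apply (e : OpenPartialHomeomorph X (EBase n)) {A : Set X}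
    (hA : MeasurableSet A) :
    coordMeasure η e A
      = ∫⁻ a in e '' (A ∩ e.source), ENNReal.ofReal |chartDensity η e a| := by
  have hm := measurableSet_image e (hA.inter e.open_source.measurableSet) inter_subset_right
  have himg : e '' (A ∩ e.source) = e.symm ⁻¹' A ∩ e.target := by
    rw [inter_comm A, e.image_source_inter_eq', inter_comm]
  rw [coordMeasure, Measure.map_apply_of_aemeasurable
    ((aemeasurable_symm e).mono_ac (withDensity_absolutelyContinuous _ _)) hA]
  have hrestr : (volume.restrict e.target).withDensity
      (fun a ↦ ENNReal.ofReal |chartDensity η e a|)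
      = ((volume : Measure (EBase n)).withDensity
      (fun a ↦ ENNReal.ofReal |chartDensity η e a|)).restrict e.target :=
    (restrict_withDensity e.open_target.measurableSet _).symm
  have h0 : (volume.restrict e.target).withDensity
      (fun a ↦ ENNReal.ofReal |chartDensity η e a|) (e.symm ⁻¹' A)
      = (volume.restrict e.target).withDensity
      (fun a ↦ ENNReal.ofReal |chartDensity η e a|) (e '' (A ∩ e.source)) := by
    rw [hrestr, Measure.restrict_apply' e.open_target.measurableSet,
      Measure.restrict_apply' e.open_target.measurableSet, himg, inter_assoc, inter_self]
  rw [h0, withDensity_apply _ hm, Measure.restrict_restrict hm, himg, inter_assoc, inter_self]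

/-- The change of variables formula: densities transform with the signed Jacobian determinant, and
the absolute values in the measure discard the sign. -/
theorem coordMeasure_eq_of_subset (he : IsSmoothChart (E := EBase n) e)
    (he' : IsSmoothChart (E := EBase n) e') {A : Set X}
    (hA : MeasurableSet A) (hAe : A ⊆ e.source) (hAe' : A ⊆ e'.source) :
    coordMeasure η e A = coordMeasure η e' A := by
  rw [coordMeasure_apply e hA, coordMeasure_apply e' hA, inter_eq_left.2 hAe,
    inter_eq_left.2 hAe']
  have hm := measurableSet_image e hA hAe
  have himg : e' '' A = (e' ∘ e.symm) '' (e '' A) := by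
    rw [image_image]
    refine image_congr fun x hx ↦ ?_
    simp [e.left_inv (hAe hx)]
  have hmem : ∀ a ∈ e '' A, a ∈ e.target ∧ e.symm a ∈ A := by
    rintro _ ⟨x, hx, rfl⟩
    exact ⟨e.map_source (hAe hx), by rwa [e.left_inv (hAe hx)]⟩
  rw [himg, lintegral_image_eq_lintegral_abs_det_fderiv_mul volume hm
    (f' := fun a ↦ fderiv ℝ (e' ∘ e.symm) a)]
  · refine setLIntegral_congr_fun hm fun a ha ↦ ?_
    obtain ⟨h1, h2⟩ := hmem a ha
    rw [chartDensity_change he he' η h1 (hAe' h2), abs_mul, ← ENNReal.ofReal_mul (abs_nonneg _),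
      mul_comm]
  · intro a ha
    obtain ⟨h1, h2⟩ := hmem a ha
    exact ((he.contDiffAt_change he' h1 (hAe' h2)).differentiableAt
      (by simp)).hasFDerivAt.hasFDerivWithinAt
  · rintro _ ⟨x, hx, rfl⟩ _ ⟨y, hy, rfl⟩ hxy
    simp only [Function.comp_apply, e.left_inv (hAe hx), e.left_inv (hAe hy)] at hxy
    rw [e'.injOn (hAe' hx) (hAe' hy) hxy]

theorem chartMeasure_eq_coordMeasure (x : X) :
    chartMeasure η x = coordMeasure η (chartAt (EBase n) x) := rfl

theorem coordMeasure_inter_source (e : OpenPartialHomeomorph X (EBase n)) {A : Set X}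
    (hA : MeasurableSet A) : coordMeasure η e A = coordMeasure η e (A ∩ e.source) := by
  rw [coordMeasure_apply e hA, coordMeasure_apply e (hA.inter e.open_source.measurableSet),
    inter_assoc, inter_self]

/-- A supremum of measures is bounded through a common upper bound. The measure equal to
`coordMeasure η e` on the domain of `e`, with an added infinite part off that domain, dominates all
chart measures; on subsets of the domain the infinite part is not seen. -/
theorem volumeMeasure_le_of_subset (he : IsSmoothChart (E := EBase n) e) {A : Set X}
    (hAe : A ⊆ e.source) : volumeMeasure η A ≤ coordMeasure η e A := by
  set ν : Measure X := coordMeasure η e + (⊤ : Measure X).restrict e.sourceᶜ with hν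
  have hle : volumeMeasure η ≤ ν := by
    refine iSup_le fun x ↦ ?_
    rw [chartMeasure_eq_coordMeasure, Measure.le_iff]
    intro B hB
    have hBs := hB.inter e.open_source.measurableSet
    rw [← measure_inter_add_sdiff B e.open_source.measurableSet, hν, Measure.add_apply]
    refine add_le_add ?_ ?_
    · rw [coordMeasure_inter_source _ hBs]
      rw [coordMeasure_eq_of_subset (isSmoothChart_chartAt x) he
        (hBs.inter (chartAt (EBase n) x).open_source.measurableSet) inter_subset_right
        (fun y hy ↦ hy.1.2)]
      exact measure_mono fun y hy ↦ hy.1.1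
    · rw [Measure.restrict_apply' e.open_source.measurableSet.compl]
      exact (le_top : coordMeasure η (chartAt (EBase n) x) ≤ ⊤) _
  have h2 : ν A = coordMeasure η e A := by
    rw [hν, Measure.add_apply, Measure.restrict_apply' e.open_source.measurableSet.compl,
      (disjoint_compl_right_iff_subset.2 hAe).inter_eq, measure_empty, add_zero]
  exact (hle A).trans h2.le

variable [SecondCountableTopology X]

/-- The measure associated with a volume form has density `|ρ|` in every chart. -/
theorem volumeMeasure_restrict_source (he : IsSmoothChart (E := EBase n) e) :
    (volumeMeasure η).restrict e.source = (coordMeasure η e).restrict e.source := by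
  -- By second countability it suffices to compare on subsets of a single preferred chart domain.
  -- There one inequality is `volumeMeasure_le_of_subset`, and for the other the supremum dominates
  -- its members.
  obtain ⟨s, hs, hcov⟩ := TopologicalSpace.countable_cover_nhds
    (fun x : X ↦ chart_source_mem_nhds (EBase n) x)
  refine Measure.ext_of_biUnion_eq_univ hs hcov fun x _ ↦ ?_
  ext B hB
  have hm := (chartAt (EBase n) x).open_source.measurableSet
  rw [Measure.restrict_apply hB, Measure.restrict_apply hB, Measure.restrict_apply (hB.inter hm),
    Measure.restrict_apply (hB.inter hm)]
  apply le_antisymm (volumeMeasure_le_of_subset he inter_subset_right)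
  rw [coordMeasure_eq_of_subset he (isSmoothChart_chartAt x)
    ((hB.inter hm).inter e.open_source.measurableSet) inter_subset_right (fun y hy ↦ hy.1.2),
    ← chartMeasure_eq_coordMeasure]
  exact (le_iSup (fun x ↦ chartMeasure η x) x) _

/-- The integral with respect to the measure of a volume form, in coordinates. -/
theorem setIntegral_volumeMeasure (he : IsSmoothChart (E := EBase n) e) (hη : IsVolumeForm η)
    {A : Set X} (hA : MeasurableSet A) (hAe : A ⊆ e.source) {g : X → ℝ}
    (hg : AEStronglyMeasurable g ((volumeMeasure η).restrict A)) :
    ∫ x in A, g x ∂(volumeMeasure η)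
      = ∫ a in e '' A, |chartDensity η e a| * g (e.symm a) := by
  have hm := measurableSet_image e hA hAe
  have himg : e '' A = e.target ∩ e.symm ⁻¹' A := e.image_eq_target_inter_inv_preimage hAe
  have hres : (volumeMeasure η).restrict A = (coordMeasure η e).restrict A := by
    have := congrArg (fun μ : Measure X ↦ μ.restrict A) (volumeMeasure_restrict_source (η := η) he)
    simpa only [Measure.restrict_restrict hA, inter_eq_left.2 hAe] using this
  set ν := (volume.restrict e.target).withDensity
    (fun a ↦ ENNReal.ofReal |chartDensity η e a|) with hν
  have haem : AEMeasurable e.symm ν :=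
    (aemeasurable_symm e).mono_ac (withDensity_absolutelyContinuous _ _)
  have hmap : (coordMeasure η e).restrict A = (ν.restrict (e '' A)).map e.symm := by
    ext B hB
    rw [Measure.restrict_apply hB, Measure.map_apply_of_aemeasurable
      (haem.mono_measure Measure.restrict_le_self) hB, coordMeasure,
      Measure.map_apply_of_aemeasurable haem (hB.inter hA), Measure.restrict_apply' hm, himg]
    have hr : ν = ν.restrict e.target := by
      rw [hν, restrict_withDensity e.open_target.measurableSet,
        Measure.restrict_restrict e.open_target.measurableSet, inter_self]
    rw [hr, Measure.restrict_apply' e.open_target.measurableSet,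
      Measure.restrict_apply' e.open_target.measurableSet]
    congr 1
    ext a
    simp only [mem_inter_iff, mem_preimage]
    tauto
  rw [hres, hmap] at hg ⊢
  rw [integral_map (haem.mono_measure Measure.restrict_le_self) hg, hν,
    setIntegral_withDensity_eq_setIntegral_toReal_smul₀ _ _ _ hm, Measure.restrict_restrict hm,
    inter_eq_left.2 (himg ▸ inter_subset_left)]
  · simp
  · exact (aemeasurable_density he hη).restrict
  · simp

/-- The density is bounded near each point, so small coordinate balls have finite measure. Compact
sets then have finite measure, as integration of continuous functions over `C` requires. -/
theorem isLocallyFiniteMeasure_volumeMeasure (hη : IsVolumeForm η) :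
    IsLocallyFiniteMeasure (volumeMeasure η) := by
  refine ⟨fun x ↦ ?_⟩
  set e := chartAt (EBase n) x with hedef
  have he : IsSmoothChart (E := EBase n) e := isSmoothChart_chartAt x
  have hx : x ∈ e.source := mem_chart_source _ _
  have hc := (contDiffAt_chartDensity he hη (e.map_source hx)).continuousAt.abs
  obtain ⟨r, hr, hball⟩ := Metric.mem_nhds_iff.1 (Filter.inter_mem
    (e.open_target.mem_nhds (e.map_source hx))
    (hc.eventually_le_const (lt_add_one |chartDensity η e (e x)|)))
  refine ⟨e.source ∩ e ⁻¹' Metric.ball (e x) r, ?_, ?_⟩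
  · exact Filter.inter_mem (e.open_source.mem_nhds hx)
      ((e.continuousAt hx).preimage_mem_nhds (Metric.ball_mem_nhds _ hr))
  · have hopen : IsOpen (e.source ∩ e ⁻¹' Metric.ball (e x) r) :=
      e.isOpen_inter_preimage Metric.isOpen_ball
    refine (volumeMeasure_le_of_subset he inter_subset_left).trans_lt ?_
    rw [coordMeasure_apply e hopen.measurableSet]
    refine lt_of_le_of_lt (lintegral_mono_set (t := Metric.ball (e x) r) ?_) ?_
    · rintro _ ⟨y, hy, rfl⟩
      exact hy.1.2
    refine lt_of_le_of_lt (setLIntegral_mono measurable_const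
      (g := fun _ ↦ ENNReal.ofReal (|chartDensity η e (e x)| + 1)) fun a ha ↦
        ENNReal.ofReal_le_ofReal (hball ha).2) ?_
    rw [setLIntegral_const]
    exact ENNReal.mul_lt_top ENNReal.ofReal_lt_top measure_ball_lt_top

end Measure

/-! ### Induced coordinates on the jet bundle -/

section JetCharts

variable {n m : ℕ} {X Y : Type*}
  [TopologicalSpace X] [ChartedSpace (EBase n) X]
  [TopologicalSpace Y] [ChartedSpace (ETot n m) Y]
  {P : Fibration n m X Y}

namespace FiberedChart

theorem isSmoothChart_base (c : FiberedChart P) : IsSmoothChart (E := EBase n) c.base :=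
  ⟨c.base_smooth, c.base_symm_smooth⟩

theorem isSmoothChart_total (c : FiberedChart P) : IsSmoothChart (E := ETot n m) c.total :=
  ⟨c.total_smooth, c.total_symm_smooth⟩

/-- The induced coordinates on the jet bundle, as an open partial homeomorphism. -/
def jetHomeo (c : FiberedChart P) (z₀ : Jet P) : OpenPartialHomeomorph (Jet P) (EJet n m) :=
  (jetCore P).openPartialHomeomorph (c.jetChart z₀) ⟨c, z₀, rfl⟩

theorem jetHomeo_mem_atlas (c : FiberedChart P) (z₀ : Jet P) :
    c.jetHomeo z₀ ∈ atlas (EJet n m) (Jet P) := by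
  simp only [atlas, ChartedSpace.atlas, mem_iUnion, mem_singleton_iff]
  exact ⟨_, ⟨c, z₀, rfl⟩, rfl⟩

theorem isSmoothChart_jetHomeo (c : FiberedChart P) (z₀ : Jet P) :
    IsSmoothChart (E := EJet n m) (c.jetHomeo z₀) :=
  isSmoothChart_of_mem_maximalAtlas (IsManifold.subset_maximalAtlas (c.jetHomeo_mem_atlas z₀))

theorem mem_jetHomeo_source (c : FiberedChart P) (z₀ z : Jet P) :
    z ∈ (c.jetHomeo z₀).source ↔ z.pt ∈ c.total.source := Iff.rfl

theorem jetHomeo_apply_fst (c : FiberedChart P) (z₀ z : Jet P) :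
    (c.jetHomeo z₀ z).1 = c.total z.pt := rfl

theorem jetHomeo_apply_snd (c : FiberedChart P) (z₀ z : Jet P) :
    (c.jetHomeo z₀ z).2 = (ContinuousLinearMap.snd ℝ (EBase n) (EFib m)).comp
    ((c.dTot z.pt).comp (z.lin.comp (c.dBaseSymm (c.base (P.proj z.pt))))) := rfl

theorem jetHomeo_symm_pt (c : FiberedChart P) (z₀ : Jet P) {p : EJet n m}
    (hp : p.1 ∈ c.total.target) : ((c.jetHomeo z₀).symm p).pt = c.total.symm p.1 := by
  have : (c.jetHomeo z₀).symm p = ⟨c.total.symm p.1, _, c.dproj_comp_lift hp p.2⟩ := dif_pos hp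
  rw [this]

theorem jetHomeo_symm_lin (c : FiberedChart P) (z₀ : Jet P) {p : EJet n m}
    (hp : p.1 ∈ c.total.target) : ((c.jetHomeo z₀).symm p).lin =
      (c.dTotSymm p.1).comp (((ContinuousLinearMap.id ℝ (EBase n)).prod p.2).comp
          (c.dBase (P.proj (c.total.symm p.1)))) := by
  have : (c.jetHomeo z₀).symm p = ⟨c.total.symm p.1, _, c.dproj_comp_lift hp p.2⟩ := dif_pos hp
  rw [this]

/-- The base point of the preimage of `(x, y)`. -/
theorem proj_total_symm (c : FiberedChart P) {q : EBase n × EFib m} (hq : q ∈ c.total.target) :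
    q.1 ∈ c.base.target ∧ P.proj (c.total.symm q) = c.base.symm q.1 := by
  have h1 := c.base_proj _ (c.total.map_target hq)
  have h2 := c.proj_mem _ (c.total.map_target hq)
  rw [c.total.right_inv hq] at h1
  rw [← h1]
  exact ⟨c.base.map_source h2, (c.base.left_inv h2).symm⟩

end FiberedChart

namespace Jet

theorem contMDiff_pt : ContMDiff 𝓘(ℝ, EJet n m) (𝓡 (n + 1 + m)) ∞ (Jet.pt : Jet P → Y) := by
  intro z
  obtain ⟨c, hc⟩ := P.exists_fiberedChart z.pt
  have he := c.isSmoothChart_jetHomeo z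
  have h1 : ContMDiffAt 𝓘(ℝ, EJet n m) 𝓘(ℝ, EBase n × EFib m) ∞
      (fun z' ↦ (c.jetHomeo z z').1) z :=
    (contDiff_fst.contMDiff.contMDiffAt (x := c.jetHomeo z z)).comp z (he.contMDiffAt hc)
  have h2 : ContMDiffAt 𝓘(ℝ, EBase n × EFib m) (𝓡 (n + 1 + m)) ∞ c.total.symm
      ((c.jetHomeo z z).1) :=
    c.isSmoothChart_total.contMDiffAt_symm (c.total.map_source hc)
  refine (h2.comp z h1).congr_of_eventuallyEq ?_
  filter_upwards [(c.jetHomeo z).open_source.mem_nhds hc] with z' hz'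
  exact (c.total.left_inv hz').symm

theorem contMDiff_toBase : ContMDiff 𝓘(ℝ, EJet n m) (𝓡 (n + 1)) ∞ (Jet.toBase : Jet P → X) :=
  P.contMDiff.comp contMDiff_pt

end Jet

namespace FiberedChart

/-- The differential of the inverse of the induced coordinates. -/
def dJetSymm (c : FiberedChart P) (z₀ : Jet P) (p : EJet n m) : EJet n m →L[ℝ] EJet n m :=
  mfderiv 𝓘(ℝ, EJet n m) 𝓘(ℝ, EJet n m) (c.jetHomeo z₀).symm p

/-- In induced coordinates `Jet.pt` is the linear projection `(x, y, z) ↦ (x, y)`. -/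
theorem dpt_dJetSymm (c : FiberedChart P) (z₀ : Jet P) {p : EJet n m}
    (hp : p.1 ∈ c.total.target) (V : EJet n m) :
    ((c.jetHomeo z₀).symm p).dpt (c.dJetSymm z₀ p V) = c.dTotSymm p.1 V.1 := by
  have he := c.isSmoothChart_jetHomeo z₀
  have h1 := tder_comp (x := p) ((Jet.contMDiff_pt _).mdifferentiableAt (by simp))
    (he.mdiffAt_symm hp)
  have h2 := tder_comp (x := p) (g := c.total.symm)
    (f := ContinuousLinearMap.fst ℝ (EBase n × EFib m) (EBase n →L[ℝ] EFib m))
    (c.isSmoothChart_total.mdiffAt_symm hp) (ContinuousLinearMap.mdifferentiableAt _)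
  have h3 : (Jet.pt ∘ (c.jetHomeo z₀).symm : EJet n m → Y)
      =ᶠ[𝓝 p] c.total.symm ∘
        ContinuousLinearMap.fst ℝ (EBase n × EFib m) (EBase n →L[ℝ] EFib m) := by
    filter_upwards [(c.jetHomeo z₀).open_target.mem_nhds hp] with q hq
    exact c.jetHomeo_symm_pt z₀ hq
  rw [tder_congr h3, h2, tder_clm] at h1
  exact (congrArg (fun f : EJet n m →L[ℝ] ETot n m ↦ f V) h1).symm

theorem dproj_dTotSymm (c : FiberedChart P) {q : EBase n × EFib m} (hq : q ∈ c.total.target)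
    (w : EBase n × EFib m) :
    P.dproj (c.total.symm q) (c.dTotSymm q w) = c.dBaseSymm q.1 w.1 := by
  have hy := c.total.map_target hq
  have h1 := congrArg (fun f ↦ c.dBaseSymm q.1 (f (c.dTotSymm q w))) (c.fst_comp_dTot hy)
  have h2 := congrArg (fun f ↦ f w) (c.dTot_comp_dTotSymm hy)
  have hx := c.proj_mem _ hy
  have h3 := congrArg (fun f ↦ f (P.dproj (c.total.symm q) (c.dTotSymm q w)))
    (c.dBaseSymm_comp_dBase hx)
  rw [c.base_proj _ hy] at h3
  rw [c.total.right_inv hq] at h2 h3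
  simp only [ContinuousLinearMap.comp_apply, ContinuousLinearMap.id_apply,
    ContinuousLinearMap.coe_fst'] at h1 h2 h3
  rw [h2] at h1
  rw [h1, h3]

theorem dtoBase_dJetSymm (c : FiberedChart P) (z₀ : Jet P) {p : EJet n m}
    (hp : p.1 ∈ c.total.target) (V : EJet n m) :
    ((c.jetHomeo z₀).symm p).dtoBase (c.dJetSymm z₀ p V) = c.dBaseSymm p.1.1 V.1.1 := by
  rw [← c.dproj_dTotSymm hp, ← c.dpt_dJetSymm z₀ hp, ← c.jetHomeo_symm_pt z₀ hp]
  have h := mfderiv_comp ((c.jetHomeo z₀).symm p)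
    ((P.contMDiff _).mdifferentiableAt (by simp))
    ((Jet.contMDiff_pt ((c.jetHomeo z₀).symm p)).mdifferentiableAt (by simp))
  exact congrArg (fun f : EJet n m →L[ℝ] EBase n ↦ f (c.dJetSymm z₀ p V)) h

/-- The contact form in coordinates. -/
theorem dTot_contact (c : FiberedChart P) (z₀ : Jet P) {p : EJet n m}
    (hp : p.1 ∈ c.total.target) (V : EJet n m) :
    c.dTot (c.total.symm p.1) (((c.jetHomeo z₀).symm p).contact (c.dJetSymm z₀ p V))
      = (0, V.1.2 - p.2 V.1.1) := by
  have hy := c.total.map_target hp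
  have h2 := fun w ↦ congrArg (fun f ↦ f w) (c.dTot_comp_dTotSymm hy)
  have hx := c.proj_mem _ hy
  have h3 := fun w ↦ congrArg (fun f ↦ f w) (c.dBase_comp_dBaseSymm hx)
  rw [c.base_proj _ hy] at h3
  rw [c.total.right_inv hp] at h2 h3
  simp only [ContinuousLinearMap.comp_apply, ContinuousLinearMap.id_apply] at h2 h3
  have h4 : ((c.jetHomeo z₀).symm p).contact (c.dJetSymm z₀ p V)
      = c.dTotSymm p.1 V.1 - c.dTotSymm p.1 (V.1.1, p.2 V.1.1) := by
    change ((c.jetHomeo z₀).symm p).dpt (c.dJetSymm z₀ p V)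
      - ((c.jetHomeo z₀).symm p).lin (P.dproj ((c.jetHomeo z₀).symm p).pt
        (((c.jetHomeo z₀).symm p).dpt (c.dJetSymm z₀ p V))) = _
    rw [c.dpt_dJetSymm z₀ hp, c.jetHomeo_symm_pt z₀ hp, c.dproj_dTotSymm hp,
      c.jetHomeo_symm_lin z₀ hp]
    simp only [ContinuousLinearMap.comp_apply, h3, ContinuousLinearMap.prod_apply,
      ContinuousLinearMap.id_apply]
  rw [h4, map_sub, h2, h2]
  ext <;> simp

end FiberedChart

end JetCharts

section

theorem tder_comp_affine {W F E N : Type*} [NormedAddCommGroup W] [NormedSpace ℝ W]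
    [NormedAddCommGroup F] [NormedSpace ℝ F] [NormedAddCommGroup E] [NormedSpace ℝ E]
    [TopologicalSpace N] [ChartedSpace E N] {g : F → N} {p : F} (A : W →L[ℝ] F)
    (hg : MDifferentiableAt 𝓘(ℝ, F) 𝓘(ℝ, E) g p) :
    tder W E (fun w ↦ g (p + A w)) 0 = (tder F E g p).comp A := by
  have h : HasFDerivAt (fun w ↦ p + A w) A 0 := A.hasFDerivAt.const_add p
  have h0 : p + A 0 = p := by simp
  have hd : MDifferentiableAt 𝓘(ℝ, F) 𝓘(ℝ, E) g (p + A 0) := by rwa [h0]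
  have := tder_comp (g := g) (f := fun w ↦ p + A w) (x := 0) hd
    h.differentiableAt.mdifferentiableAt
  rw [tder_eq_fderiv, h.fderiv, h0] at this
  exact this

end

/-! ### Vertical lift, Poincaré–Cartan form and prolongations in induced coordinates -/

section JetCharts

variable {n m : ℕ} {X Y : Type*}
  [TopologicalSpace X] [ChartedSpace (EBase n) X]
  [TopologicalSpace Y] [ChartedSpace (ETot n m) Y]
  {P : Fibration n m X Y}

namespace FiberedChart

/-- The coordinate expression of a linear map from the base to the vertical space at a jet. -/
def vertCoord (c : FiberedChart P) (z : Jet P) : z.vertHom →L[ℝ] (EBase n →L[ℝ] EFib m) :=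
  ((ContinuousLinearMap.compL ℝ (EBase n) (ETot n m) (EFib m)
    ((ContinuousLinearMap.snd ℝ (EBase n) (EFib m)).comp (c.dTot z.pt))).comp
    ((ContinuousLinearMap.compL ℝ (EBase n) (EBase n) (ETot n m)).flip
      (c.dBaseSymm (c.base (P.proj z.pt))))).comp z.vertHom.subtypeL

theorem vertCoord_apply (c : FiberedChart P) (z : Jet P) (f : z.vertHom) (w : EBase n) :
    c.vertCoord z f w = (c.dTot z.pt ((f : EBase n →L[ℝ] ETot n m)
      (c.dBaseSymm (c.base (P.proj z.pt)) w))).2 := rfl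

/-- The coordinate `z` is linear in the differential of the jet and the coordinates `(x, y)` do not
see it. Translation in a fibre is thus translation in coordinates, and the vertical lift is a `∂/∂z`
direction. -/
theorem jetHomeo_translate (c : FiberedChart P) (z₀ z : Jet P) (f : z.vertHom) :
    c.jetHomeo z₀ (z.translate f) = c.jetHomeo z₀ z + inZ (c.vertCoord z f) := by
  refine Prod.ext ?_ ?_
  · rw [jetHomeo_apply_fst, inZ_apply]
    exact (add_zero (c.total z.pt)).symm
  · ext1 w
    change (c.dTot z.pt ((z.lin + f) (c.dBaseSymm (c.base (P.proj z.pt)) w))).2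
      = (c.dTot z.pt (z.lin (c.dBaseSymm (c.base (P.proj z.pt)) w))).2
        + c.vertCoord z f w
    rw [vertCoord_apply, add_apply, map_add]
    rfl

theorem vertLift_eq (c : FiberedChart P) (z₀ z : Jet P) (hz : z.pt ∈ c.total.source)
    (f : z.vertHom) :
    z.vertLift f = c.dJetSymm z₀ (c.jetHomeo z₀ z) (inZ (c.vertCoord z f)) := by
  have h1 : z.translate
      = fun f ↦ (c.jetHomeo z₀).symm (c.jetHomeo z₀ z + (inZ.comp (c.vertCoord z)) f) := by
    funext f
    have : c.jetHomeo z₀ z + (inZ.comp (c.vertCoord z)) f = c.jetHomeo z₀ (z.translate f) :=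
      (c.jetHomeo_translate z₀ z f).symm
    rw [this, (c.jetHomeo z₀).left_inv]
    exact hz
  have h2 := tder_comp_affine (W := z.vertHom) (inZ.comp (c.vertCoord z))
    ((c.isSmoothChart_jetHomeo z₀).mdiffAt_symm
    ((c.jetHomeo z₀).map_source hz))
  rw [← h1] at h2
  exact congrArg (fun A : z.vertHom →L[ℝ] EJet n m ↦ A f) h2

/-- The Lagrangian in coordinates. -/
def locLag (c : FiberedChart P) (z₀ : Jet P) (L : Jet P → ℝ) : EJet n m → ℝ :=
  L ∘ (c.jetHomeo z₀).symm

theorem contDiffAt_locLag (c : FiberedChart P) (z₀ : Jet P) {L : Jet P → ℝ}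
    (hL : ContMDiff 𝓘(ℝ, EJet n m) 𝓘(ℝ, ℝ) ∞ L) {p : EJet n m} (hp : p.1 ∈ c.total.target) :
    ContDiffAt ℝ ∞ (c.locLag z₀ L) p :=
  contMDiffAt_iff_contDiffAt.1
    ((hL _).comp p ((c.isSmoothChart_jetHomeo z₀).contMDiffAt_symm hp))

theorem dJet_dJetSymm (c : FiberedChart P) (z₀ : Jet P) {L : Jet P → ℝ}
    (hL : ContMDiff 𝓘(ℝ, EJet n m) 𝓘(ℝ, ℝ) ∞ L) {p : EJet n m} (hp : p.1 ∈ c.total.target)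
    (V : EJet n m) :
    dJet L ((c.jetHomeo z₀).symm p) (c.dJetSymm z₀ p V) = fderiv ℝ (c.locLag z₀ L) p V := by
  have h := tder_comp (x := p) (g := L) (f := (c.jetHomeo z₀).symm)
    ((hL _).mdifferentiableAt (by simp))
    ((c.isSmoothChart_jetHomeo z₀).mdiffAt_symm hp)
  rw [tder_eq_fderiv] at h
  exact (congrArg (fun A : EJet n m →L[ℝ] ℝ ↦ A V) h).symm

/-- The Poincaré–Cartan form in coordinates. -/
theorem pullback_poincareCartan (c : FiberedChart P) (z₀ : Jet P) {L : Jet P → ℝ}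
    (hL : ContMDiff 𝓘(ℝ, EJet n m) 𝓘(ℝ, ℝ) ∞ L) (η : DiffForm (EBase n) X (n + 1))
    {p : EJet n m} (hp : p.1 ∈ c.total.target) (V : Fin (n + 1) → EJet n m) :
    pullback (E := EJet n m) (E' := EJet n m) (c.jetHomeo z₀).symm (poincareCartan η L) p V
      = locTheta (chartDensity η c.base) (c.locLag z₀ L) p V := by
  set z := (c.jetHomeo z₀).symm p with hz
  have hpt : z.pt = c.total.symm p.1 := c.jetHomeo_symm_pt z₀ hp
  have hzs : z.pt ∈ c.total.source := hpt ▸ c.total.map_target hp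
  have hχz : c.jetHomeo z₀ z = p := (c.jetHomeo z₀).right_inv hp
  have hbase : z.toBase = c.base.symm p.1.1 := by
    rw [Jet.toBase, hpt]
    exact (c.proj_total_symm hp).2
  have hcb : c.base (P.proj z.pt) = p.1.1 := by
    rw [c.base_proj _ hzs, hpt, c.total.right_inv hp]
  have hη : ∀ W : Fin (n + 1) → EBase n, η (c.base.symm p.1.1)
      (fun i ↦ c.dBaseSymm p.1.1 (W i)) = chartDensity η c.base p.1.1 * stdVol n W := by
    intro W
    exact congrArg (fun A ↦ A W) (pullback_symm_eq η c.base p.1.1)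
  have h1 : lagrangianForm η L z (fun i ↦ c.dJetSymm z₀ p (V i))
      = c.locLag z₀ L p * chartDensity η c.base p.1.1 * stdVol n (fun i ↦ (V i).1.1) := by
    have e1 : lagrangianForm η L z (fun i ↦ c.dJetSymm z₀ p (V i))
        = L z * η z.toBase (fun i ↦ z.dtoBase (c.dJetSymm z₀ p (V i))) := rfl
    rw [e1, hbase]
    simp only [hz, c.dtoBase_dJetSymm z₀ hp]
    rw [hη, mul_assoc]
    rfl
  -- One summand of `S_η^*(dL)`: the lift of `α ⊗ θ(W)` is a `∂/∂z` direction by `vertLift_eq`, and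
  -- `dTot_contact` gives the coordinates of `θ(W)`.
  have h2 : ∀ (W : EJet n m) (α : EBase n →L[ℝ] ℝ),
      dJet L z (z.vertLift (z.tensorContact (c.dJetSymm z₀ p W) α))
      = fderiv ℝ (c.locLag z₀ L) p (inZ ((α.comp (c.dBaseSymm p.1.1)).smulRight
        (W.1.2 - p.2 W.1.1))) := by
    intro W α
    rw [c.vertLift_eq z₀ z hzs, hχz, hz, c.dJet_dJetSymm z₀ hL hp]
    congr 2
    ext1 w
    rw [vertCoord_apply, ← hz, hcb]
    have e1 : ((z.tensorContact (c.dJetSymm z₀ p W) α : z.vertHom) : EBase n →L[ℝ] ETot n m)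
        (c.dBaseSymm p.1.1 w) = α (c.dBaseSymm p.1.1 w) • z.contact (c.dJetSymm z₀ p W) := rfl
    have e2 := c.dTot_contact z₀ hp W
    rw [← hz] at e2
    rw [e1, hpt, map_smul, e2]
    rfl
  -- The covector `η_i` is `ρ` times the corresponding contraction of the standard volume form.
  have h3 : ∀ i : Fin (n + 1), ((η z.toBase).curryLeft.flipAlternating
      (fun j ↦ z.dtoBase (i.removeNth (fun i ↦ c.dJetSymm z₀ p (V i)) j))).comp
        (c.dBaseSymm p.1.1) = chartDensity η c.base p.1.1 •
        (stdVol n).curryLeft.flipAlternating (i.removeNth fun j ↦ (V j).1.1) := by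
    intro i
    ext1 w
    have e1 : (fun j ↦ z.dtoBase (i.removeNth (fun i ↦ c.dJetSymm z₀ p (V i)) j))
        = fun j ↦ c.dBaseSymm p.1.1 (i.removeNth (fun j ↦ (V j).1.1) j) := by
      funext j
      exact c.dtoBase_dJetSymm z₀ hp _
    rw [e1, hbase]
    have e2 := hη (Fin.cons w (i.removeNth fun j ↦ (V j).1.1))
    have e3 : (fun k ↦ c.dBaseSymm p.1.1
        ((Fin.cons w (i.removeNth fun j ↦ (V j).1.1) : Fin (n + 1) → EBase n) k))
        = Fin.cons (c.dBaseSymm p.1.1 w)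
          (fun j ↦ c.dBaseSymm p.1.1 (i.removeNth (fun j ↦ (V j).1.1) j)) := by
      funext k
      refine Fin.cases ?_ (fun j ↦ ?_) k <;> simp
    rw [e3] at e2
    exact e2
  have h4 : pullback (E := EJet n m) (E' := EJet n m) (c.jetHomeo z₀).symm (poincareCartan η L) p V
      = lagrangianForm η L z (fun i ↦ c.dJetSymm z₀ p (V i))
        + dJet L z (z.vertEndo η (fun i ↦ c.dJetSymm z₀ p (V i))) := rfl
  rw [h4, h1, Jet.vertEndo_apply, map_sum, locTheta]
  congr 1
  refine Finset.sum_congr rfl fun i _ ↦ ?_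
  rw [map_zsmul, h2, h3, zsmul_eq_mul]
  push_cast
  congr 1
  have hsm : ∀ (r : ℝ) (α : EBase n →L[ℝ] ℝ) (v : EFib m),
      (r • α).smulRight v = r • α.smulRight v := by
    intro r α v
    ext1 w
    exact mul_smul r (α w) v
  rw [hsm]
  exact ((fderiv ℝ (c.locLag z₀ L) p).comp inZ).map_smul _ _

/-- The coordinate expression of a map from the base to the total space. -/
def rep (c : FiberedChart P) (ψ : X → Y) (a : EBase n) : EFib m :=
  (c.total (ψ (c.base.symm a))).2

end FiberedChart

/-- Differentiating `π ∘ ψ = id` shows that `jet1` takes its meaningful branch and not its default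
value. -/
theorem jet1_eq {ψ : X → Y} {x : X} (hd : MDifferentiableAt (𝓡 (n + 1)) (𝓡 (n + 1 + m)) ψ x)
    (hs : ∀ᶠ x' in 𝓝 x, P.proj (ψ x') = x') :
    (P.jet1 ψ x).pt = ψ x ∧ (P.jet1 ψ x).lin = tder (EBase n) (ETot n m) ψ x := by
  have h : P.proj (ψ x) = x ∧ (P.dproj (ψ x)).comp
      (mfderiv (𝓡 (n + 1)) (𝓡 (n + 1 + m)) ψ x : EBase n →L[ℝ] ETot n m)
        = ContinuousLinearMap.id ℝ (EBase n) := by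
    refine ⟨hs.self_of_nhds, ?_⟩
    have h1 := tder_comp (x := x) (g := P.proj) (f := ψ)
      ((P.contMDiff _).mdifferentiableAt (by simp)) hd
    have h2 : P.proj ∘ ψ =ᶠ[𝓝 x] id := hs
    rw [tder_congr h2] at h1
    exact h1.symm.trans mfderiv_id
  rw [Fibration.jet1, dif_pos h]
  exact ⟨rfl, rfl⟩

theorem FiberedChart.total_eq (c : FiberedChart P) {ψ : X → Y} {x : X} (hx : P.proj (ψ x) = x)
    (hc : ψ x ∈ c.total.source) :
    x ∈ c.base.source ∧ c.total (ψ x) = (c.base x, c.rep ψ (c.base x)) := by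
  have hb : x ∈ c.base.source := by
    have := c.proj_mem _ hc
    rwa [hx] at this
  have h1 := c.base_proj _ hc
  rw [hx] at h1
  refine ⟨hb, Prod.ext h1.symm ?_⟩
  rw [FiberedChart.rep, c.base.left_inv hb]

/-- The 1-jet of a section in induced coordinates. -/
theorem FiberedChart.jetHomeo_jet1 (c : FiberedChart P) (z₀ : Jet P) {ψ : X → Y} {x : X}
    (hd : MDifferentiableAt (𝓡 (n + 1)) (𝓡 (n + 1 + m)) ψ x)
    (hs : ∀ᶠ x' in 𝓝 x, P.proj (ψ x') = x') (hc : ψ x ∈ c.total.source) :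
    c.jetHomeo z₀ (P.jet1 ψ x) = locJet (c.rep ψ) (c.base x) := by
  obtain ⟨h1, h2⟩ := jet1_eq hd hs
  obtain ⟨hb, ht⟩ := c.total_eq hs.self_of_nhds hc
  have hinv := c.base.left_inv hb
  refine Prod.ext ?_ ?_
  · rw [jetHomeo_apply_fst, h1, ht]
    rfl
  · rw [jetHomeo_apply_snd, h2, h1, hs.self_of_nhds]
    have d1 : MDifferentiableAt 𝓘(ℝ, EBase n) (𝓡 (n + 1)) c.base.symm (c.base x) :=
      c.isSmoothChart_base.mdiffAt_symm (c.base.map_source hb)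
    have d2 : MDifferentiableAt (𝓡 (n + 1)) (𝓡 (n + 1 + m)) ψ (c.base.symm (c.base x)) := by
      rwa [hinv]
    have d3 : MDifferentiableAt (𝓡 (n + 1 + m)) 𝓘(ℝ, EBase n × EFib m) c.total
        ((ψ ∘ c.base.symm) (c.base x)) := by
      rw [Function.comp_apply, hinv]
      exact c.isSmoothChart_total.mdiffAt hc
    have e1 := tder_comp d2 d1
    have e2 := tder_comp d3 (d2.comp _ d1)
    have e3 := tder_comp (x := c.base x) (g := ContinuousLinearMap.snd ℝ (EBase n) (EFib m))
      (f := c.total ∘ (ψ ∘ c.base.symm)) (ContinuousLinearMap.mdifferentiableAt _)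
      (d3.comp _ (d2.comp _ d1))
    rw [tder_eq_fderiv, tder_clm, e2, e1, Function.comp_apply, hinv] at e3
    exact e3.symm

end JetCharts

/-! ### Prolongations of local sections -/

section LocalSections

variable {n m : ℕ} {X Y : Type*}
  [TopologicalSpace X] [ChartedSpace (EBase n) X]
  [TopologicalSpace Y] [ChartedSpace (ETot n m) Y]
  {P : Fibration n m X Y}

/-- The map `ψ` is a smooth section of `π` on a neighbourhood of `x`. -/
def IsSectionNear (P : Fibration n m X Y) (ψ : X → Y) (x : X) : Prop :=
  ∀ᶠ x' in 𝓝 x, ContMDiffAt (𝓡 (n + 1)) (𝓡 (n + 1 + m)) ∞ ψ x' ∧ P.proj (ψ x') = x'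

theorem Fibration.IsSection.isSectionNear {φ : X → Y} (hφ : P.IsSection φ) (x : X) :
    IsSectionNear P φ x :=
  Eventually.of_forall fun x' ↦ ⟨hφ.smooth x', hφ.proj_apply x'⟩

theorem IsSectionNear.jet1_pt {ψ : X → Y} {x : X} (h : IsSectionNear P ψ x) :
    (P.jet1 ψ x).pt = ψ x :=
  (jet1_eq (h.self_of_nhds.1.mdifferentiableAt (by simp)) (h.mono fun _ h ↦ h.2)).1

namespace FiberedChart

variable (c : FiberedChart P)

theorem contDiffAt_rep {ψ : X → Y} {x : X} (hψ : ContMDiffAt (𝓡 (n + 1)) (𝓡 (n + 1 + m)) ∞ ψ x)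
    (hx : x ∈ c.base.source) (hc : ψ x ∈ c.total.source) :
    ContDiffAt ℝ ∞ (c.rep ψ) (c.base x) := by
  have hinv := c.base.left_inv hx
  have d1 := c.isSmoothChart_base.contMDiffAt_symm (c.base.map_source hx)
  have d2 : ContMDiffAt (𝓡 (n + 1)) (𝓡 (n + 1 + m)) ∞ ψ (c.base.symm (c.base x)) := by rwa [hinv]
  have d3 : ContMDiffAt (𝓡 (n + 1 + m)) 𝓘(ℝ, EBase n × EFib m) ∞ c.total
      ((ψ ∘ c.base.symm) (c.base x)) := by
    rw [Function.comp_apply, hinv]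
    exact c.isSmoothChart_total.contMDiffAt hc
  have h := contMDiffAt_iff_contDiffAt.1 (d3.comp _ (d2.comp _ d1))
  exact contDiffAt_snd.comp _ h

/-- The coordinate description of a section near a point. -/
theorem eventually_rep {ψ : X → Y} {x : X} (h : IsSectionNear P ψ x)
    (hc : ψ x ∈ c.total.source) (z₀ : Jet P) :
    x ∈ c.base.source ∧ ∀ᶠ x' in 𝓝 x, x' ∈ c.base.source ∧ ψ x' ∈ c.total.source ∧
      ContDiffAt ℝ ∞ (c.rep ψ) (c.base x') ∧
      (locJet (c.rep ψ) (c.base x')).1 ∈ c.total.target ∧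
      c.jetHomeo z₀ (P.jet1 ψ x') = locJet (c.rep ψ) (c.base x') ∧
      (c.jetHomeo z₀).symm (locJet (c.rep ψ) (c.base x')) = P.jet1 ψ x' := by
  have hx := (c.total_eq h.self_of_nhds.2 hc).1
  refine ⟨hx, ?_⟩
  have hnhds : ∀ᶠ x' in 𝓝 x, ψ x' ∈ c.total.source :=
    h.self_of_nhds.1.continuousAt.preimage_mem_nhds (c.total.open_source.mem_nhds hc)
  filter_upwards [hnhds, eventually_eventually_nhds.2 h, c.base.open_source.mem_nhds hx]
    with x' h1 h2 h3
  have hsec : ∀ᶠ y in 𝓝 x', P.proj (ψ y) = y := h2.mono fun _ h ↦ h.2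
  have hmd := h2.self_of_nhds.1.mdifferentiableAt (by simp)
  have hj := c.jetHomeo_jet1 z₀ hmd hsec h1
  have hpt := (jet1_eq (P := P) hmd hsec).1
  refine ⟨h3, h1, c.contDiffAt_rep h2.self_of_nhds.1 h3 h1, ?_, hj, ?_⟩
  · rw [← hj, jetHomeo_apply_fst, hpt]
    exact c.total.map_source h1
  · rw [← hj]
    refine (c.jetHomeo z₀).left_inv ?_
    rw [c.mem_jetHomeo_source, hpt]
    exact h1

theorem eventually_base {p : X → Prop} {x : X} (hx : x ∈ c.base.source) (h : ∀ᶠ x' in 𝓝 x, p x') :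
    ∀ᶠ a in 𝓝 (c.base x), p (c.base.symm a) ∧ a ∈ c.base.target := by
  have hc : Tendsto c.base.symm (𝓝 (c.base x)) (𝓝 x) := c.base.tendsto_symm hx
  exact (hc.eventually h).and (c.base.open_target.mem_nhds (c.base.map_source hx))

end FiberedChart

theorem IsSectionNear.contMDiffAt_jet1 {ψ : X → Y} {x : X} (h : IsSectionNear P ψ x) :
    ContMDiffAt (𝓡 (n + 1)) 𝓘(ℝ, EJet n m) ∞ (P.jet1 ψ) x := by
  obtain ⟨c, hc⟩ := P.exists_fiberedChart (ψ x)
  obtain ⟨hx, hev⟩ := c.eventually_rep h hc (P.jet1 ψ x)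
  obtain ⟨-, -, h1, h2, -, -⟩ := hev.self_of_nhds
  have d1 : ContMDiffAt (𝓡 (n + 1)) 𝓘(ℝ, EJet n m) ∞ (locJet (c.rep ψ) ∘ c.base) x :=
    (contDiffAt_locJet h1).contMDiffAt.comp x (c.isSmoothChart_base.contMDiffAt hx)
  have d2 := ((c.isSmoothChart_jetHomeo (P.jet1 ψ x)).contMDiffAt_symm h2).comp x d1
  refine d2.congr_of_eventuallyEq ?_
  filter_upwards [hev] with x' hx'
  exact hx'.2.2.2.2.2.symm

theorem IsSectionNear.eventually {ψ : X → Y} {x : X} (h : IsSectionNear P ψ x) :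
    ∀ᶠ x' in 𝓝 x, IsSectionNear P ψ x' := eventually_eventually_nhds.2 h

/-- The Lagrangian form pulled back by the prolongation of a section. -/
theorem IsSectionNear.pullback_lagrangianForm {ψ : X → Y} {x : X} (h : IsSectionNear P ψ x)
    (η : DiffForm (EBase n) X (n + 1)) (L : Jet P → ℝ) :
    pullback (E := EBase n) (E' := EJet n m) (P.jet1 ψ) (lagrangianForm η L) x
      = L (P.jet1 ψ x) • η x := by
  have hd := h.contMDiffAt_jet1.mdifferentiableAt (by simp)
  have h1 := tder_comp (x := x) (g := (Jet.toBase : Jet P → X)) (f := P.jet1 ψ)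
    ((Jet.contMDiff_toBase _).mdifferentiableAt (by simp)) hd
  have h2 : (Jet.toBase : Jet P → X) ∘ P.jet1 ψ =ᶠ[𝓝 x] id := by
    filter_upwards [eventually_eventually_nhds.2 h] with x' hx'
    have : IsSectionNear P ψ x' := hx'
    rw [Function.comp_apply, Jet.toBase, this.jet1_pt]
    exact this.self_of_nhds.2
  rw [tder_congr h2] at h1
  have h3 : ∀ v : EBase n, tder (EJet n m) (EBase n) (Jet.toBase : Jet P → X) (P.jet1 ψ x)
      (tder (EBase n) (EJet n m) (P.jet1 ψ) x v) = v := fun v ↦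
    (congrArg (fun A : EBase n →L[ℝ] EBase n ↦ A v) (h1.symm.trans mfderiv_id))
  ext v
  change L (P.jet1 ψ x) * η ((Jet.toBase ∘ P.jet1 ψ) x) (fun i ↦
    tder (EJet n m) (EBase n) (Jet.toBase : Jet P → X) (P.jet1 ψ x)
      (tder (EBase n) (EJet n m) (P.jet1 ψ) x (v i))) = L (P.jet1 ψ x) * η x v
  rw [h2.self_of_nhds]
  simp only [h3]
  rfl

end LocalSections

/-! ### Deformations of a 1-jet by a constant vector -/

section JetFamily

variable {n m : ℕ} {u : EBase n → EFib m}

/-- The family of deformations `(s, a) ↦ j¹u(a) + s V` of the 1-jet of `u`. -/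
def jetFamily (u : EBase n → EFib m) (V : EJet n m) (q : ℝ × EBase n) : EJet n m :=
  locJet u q.2 + q.1 • V

theorem jetFamily_zero (V : EJet n m) (b : EBase n) : jetFamily u V (0, b) = locJet u b := by
  rw [jetFamily, zero_smul ℝ V, add_zero]

theorem contDiffAt_jetFamily (V : EJet n m) {q : ℝ × EBase n} (hq : ContDiffAt ℝ ∞ u q.2) :
    ContDiffAt ℝ ∞ (jetFamily u V) q :=
  (ContDiffAt.comp q (g := locJet u) (f := Prod.snd) (contDiffAt_locJet hq) contDiffAt_snd).add
    ((ContinuousLinearMap.fst ℝ ℝ (EBase n)).smulRight V).contDiff.contDiffAt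

theorem fderiv_jetFamily (V : EJet n m) {q : ℝ × EBase n} (hq : ContDiffAt ℝ ∞ u q.2)
    (W : ℝ × EBase n) :
    fderiv ℝ (jetFamily u V) q W = fderiv ℝ (locJet u) q.2 W.2 + W.1 • V := by
  have d1 : HasFDerivAt (fun q : ℝ × EBase n ↦ locJet u q.2) _ q :=
    ((hasFDerivAt_locJet hq).differentiableAt.hasFDerivAt).comp q hasFDerivAt_snd
  have d2 : HasFDerivAt (fun q : ℝ × EBase n ↦ q.1 • V)
      ((ContinuousLinearMap.fst ℝ ℝ (EBase n)).smulRight V) q :=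
    ((ContinuousLinearMap.fst ℝ ℝ (EBase n)).smulRight V).hasFDerivAt
  exact congrArg (fun A ↦ A W) (d1.add d2).fderiv

end JetFamily

/-! ### The differential of the Poincaré–Cartan form along a section -/

section Pointwise

variable {n m : ℕ} {X Y : Type*}
  [TopologicalSpace X] [ChartedSpace (EBase n) X] [IsManifold (𝓡 (n + 1)) ∞ X]
  [TopologicalSpace Y] [ChartedSpace (ETot n m) Y]
  {P : Fibration n m X Y} {η : DiffForm (EBase n) X (n + 1)} {L : Jet P → ℝ}

/-- The preferred chart of the jet bundle at `z` is itself an induced chart, so the form is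
`locTheta` in it, and smoothness may be tested on constant vectors. -/
theorem contDiffAt_formInChart_poincareCartan (hη : IsVolumeForm η)
    (hL : ContMDiff 𝓘(ℝ, EJet n m) 𝓘(ℝ, ℝ) ∞ L) (z : Jet P) :
    ContDiffAt ℝ ∞ (formInChart z (poincareCartan η L)) (chartAt (EJet n m) z z) := by
  set c := P.fiberedChartAt z.pt with hcdef
  have hp : (c.jetHomeo z z).1 ∈ c.total.target :=
    c.total.map_source (P.mem_fiberedChartAt z.pt)
  refine contDiffAt_alternating_of_apply fun V ↦ ?_
  have hev : (fun q ↦ formInChart z (poincareCartan η L) q V) =ᶠ[𝓝 (c.jetHomeo z z)]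
      fun q ↦ locTheta (chartDensity η c.base) (c.locLag z L) q V := by
    filter_upwards [(c.jetHomeo z).open_target.mem_nhds hp] with q hq
    exact c.pullback_poincareCartan z hL η hq V
  refine ContDiffAt.congr_of_eventuallyEq ?_ hev
  exact contDiffAt_locTheta (contDiffAt_chartDensity c.isSmoothChart_base hη
    (c.proj_total_symm hp).1) (c.contDiffAt_locLag z hL hp) V

/-- The Euler–Lagrange expression of a section in fibered coordinates. -/
def FiberedChart.EL (c : FiberedChart P) (η : DiffForm (EBase n) X (n + 1)) (L : Jet P → ℝ)
    (z₀ : Jet P) (φ : X → Y) : EBase n → EFib m →L[ℝ] ℝ :=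
  eulerLagrange (chartDensity η c.base) (c.locLag z₀ L) (c.rep φ)

/-- Differentiation of the identity between `j¹φ ∘ base⁻¹` and the inverse jet chart applied to
`locJet`: tangent vectors of the coordinate 1-jet represent those of `j¹φ`. -/
theorem FiberedChart.dJetSymm_fderiv_locJet (c : FiberedChart P) {φ : X → Y} {x : X}
    (h : IsSectionNear P φ x) (hc : φ x ∈ c.total.source) (z₀ : Jet P) (v : EBase n) :
    c.dJetSymm z₀ (locJet (c.rep φ) (c.base x)) (fderiv ℝ (locJet (c.rep φ)) (c.base x) v)
      = tder (EBase n) (EJet n m) (P.jet1 φ) x (c.dBaseSymm (c.base x) v) := by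
  obtain ⟨hx, hev⟩ := c.eventually_rep h hc z₀
  obtain ⟨-, -, hua, hja, hjz, hjz'⟩ := hev.self_of_nhds
  have hinv : c.base.symm (c.base x) = x := c.base.left_inv hx
  have hs := c.isSmoothChart_jetHomeo z₀
  have e1 : (P.jet1 φ) ∘ c.base.symm =ᶠ[𝓝 (c.base x)] (c.jetHomeo z₀).symm ∘ locJet (c.rep φ) := by
    filter_upwards [c.eventually_base hx hev] with b hb
    have := hb.1.2.2.2.2.2
    rw [c.base.right_inv hb.2] at this
    exact this.symm
  have e2 := tder_comp (x := c.base x) (g := P.jet1 φ) (f := c.base.symm)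
    (by rw [hinv]; exact h.contMDiffAt_jet1.mdifferentiableAt (by simp))
    (c.isSmoothChart_base.mdiffAt_symm (c.base.map_source hx))
  have e3 := tder_comp (x := c.base x) (g := (c.jetHomeo z₀).symm) (f := locJet (c.rep φ))
    (hs.mdiffAt_symm hja)
    ((contDiffAt_locJet hua).differentiableAt (by simp)).mdifferentiableAt
  rw [tder_congr e1, e3, hinv, tder_eq_fderiv] at e2
  exact (congrArg (fun A : EBase n →L[ℝ] EJet n m ↦ A v) e2)

set_option maxHeartbeats 800000 in
/-- The contraction of the Poincaré–Cartan `(n+2)`-form along a section in terms of the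
Euler–Lagrange expression. -/
theorem extDer_poincareCartan_apply (hη : IsVolumeForm η)
    (hL : ContMDiff 𝓘(ℝ, EJet n m) 𝓘(ℝ, ℝ) ∞ L) {φ : X → Y} {x : X}
    (h : IsSectionNear P φ x) (c : FiberedChart P) (hc : φ x ∈ c.total.source) (z₀ : Jet P)
    (V : EJet n m) :
    extDer (poincareCartan η L) (P.jet1 φ x) (Fin.cons
      (c.dJetSymm z₀ (c.jetHomeo z₀ (P.jet1 φ x)) V)
      (fun i ↦ tder (EBase n) (EJet n m) (P.jet1 φ) x (c.dBaseSymm (c.base x) (frame n i))))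
    = c.EL η L z₀ φ (c.base x) (V.1.2 - fderiv ℝ (c.rep φ) (c.base x) V.1.1) := by
  obtain ⟨hx, hev⟩ := c.eventually_rep h hc z₀
  set z := P.jet1 φ x with hz
  set a := c.base x with ha
  set u := c.rep φ with hu
  have hinv : c.base.symm a = x := c.base.left_inv hx
  obtain ⟨-, -, hua, hja, hjz, hjz'⟩ := hev.self_of_nhds
  have hs := c.isSmoothChart_jetHomeo z₀
  have hs' : IsSmoothChart (E := EJet n m) (chartAt (EJet n m) z) := isSmoothChart_chartAt z
  -- `extDer` is computed in the preferred chart `χ` at `z`, whereas the formula refers to the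
  -- coordinates `c`; `τ` is the change of coordinates between them.
  set χ := chartAt (EJet n m) z with hχ
  set τ : EJet n m → EJet n m := χ ∘ (c.jetHomeo z₀).symm with hτ
  set Ψ : ℝ × EBase n → EJet n m := jetFamily u V with hΨ
  have hΨ0 : ∀ b, Ψ (0, b) = locJet u b := jetFamily_zero V
  have hzmem : z ∈ χ.source := mem_chart_source _ z
  have hmem : (c.jetHomeo z₀).symm (Ψ (0, a)) ∈ χ.source := by
    rw [hΨ0, hjz']
    exact hzmem
  have htar : Ψ (0, a) ∈ (c.jetHomeo z₀).target := by
    rw [hΨ0]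
    exact hja
  have hτd : ContDiffAt ℝ ∞ τ (Ψ (0, a)) := hs.contDiffAt_change hs' htar hmem
  have hcu : ∀ᶠ b in 𝓝 a, ContDiffAt ℝ ∞ u b := by
    filter_upwards [c.eventually_base hx hev] with b hb
    have := hb.1.2.2.1
    rwa [c.base.right_inv hb.2] at this
  have hΨd : ∀ q : ℝ × EBase n, ContDiffAt ℝ ∞ u q.2 → ContDiffAt ℝ ∞ Ψ q :=
    fun q hq ↦ contDiffAt_jetFamily V hq
  have hΨf : ∀ q : ℝ × EBase n, ContDiffAt ℝ ∞ u q.2 → ∀ W, fderiv ℝ Ψ q W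
      = fderiv ℝ (locJet u) q.2 W.2 + W.1 • V := fun q hq ↦ fderiv_jetFamily V hq
  have hfd : ContDiffAt ℝ ∞ (τ ∘ Ψ) (0, a) := hτd.comp _ (hΨd (0, a) hua)
  have hτz : (τ ∘ Ψ) (0, a) = χ z := by
    rw [Function.comp_apply, hΨ0, hτ, Function.comp_apply, hjz']
  set κ := formInChart z (poincareCartan η L) with hκ
  have hκd : ContDiffAt ℝ ∞ κ ((τ ∘ Ψ) (0, a)) := by
    rw [hτz]
    exact contDiffAt_formInChart_poincareCartan hη hL z
  -- Naturality of the exterior derivative under `τ ∘ Ψ` relates the computation on `ℝ × EBase n`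
  -- directly to the chart `χ`, so chart independence of `extDer` is not needed.
  have hpb := extDeriv_pullback (hκd.differentiableAt (by simp)) hfd
    (by simpa using ENat.LEInfty.out)
  have hkey := extDeriv_locTheta (ρ := chartDensity η c.base) (l := c.locLag z₀ L) (u := u) (a := a)
    (κ := fun q ↦ (κ ((τ ∘ Ψ) q)).compContinuousLinearMap (fderiv ℝ (τ ∘ Ψ) q))
    (contDiffAt_chartDensity c.isSmoothChart_base hη (c.base.map_source hx))
    (c.contDiffAt_locLag z₀ hL hja) hcu V ?_ ?_
  · rw [FiberedChart.EL, ← hkey, hpb, hτz]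
    change extDeriv κ (χ z) (fun i ↦ tder (EJet n m) (EJet n m) χ z _)
      = extDeriv κ (χ z) (fun i ↦ fderiv ℝ (τ ∘ Ψ) (0, a) _)
    congr 1
    funext i
    have hcomp : fderiv ℝ (τ ∘ Ψ) (0, a)
        = (fderiv ℝ τ (Ψ (0, a))).comp (fderiv ℝ Ψ (0, a)) :=
      fderiv_comp _ (hτd.differentiableAt (by simp)) ((hΨd (0, a) hua).differentiableAt (by simp))
    have hτt : fderiv ℝ τ (Ψ (0, a)) = (tder (EJet n m) (EJet n m) χ z).comp
        (c.dJetSymm z₀ (locJet u a)) := by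
      have := tder_comp (x := locJet u a) (g := χ) (f := (c.jetHomeo z₀).symm)
        (by rw [hjz']; exact hs'.mdiffAt hzmem) (hs.mdiffAt_symm hja)
      rw [hjz', tder_eq_fderiv] at this
      rw [hΨ0]
      exact this
    rw [hcomp]
    refine Fin.cases ?_ (fun i ↦ ?_) i
    · simp only [Fin.cons_zero, ContinuousLinearMap.comp_apply]
      rw [hΨf (0, a) hua, hτt, hjz]
      simp [ha]
    · simp only [Fin.cons_succ, ContinuousLinearMap.comp_apply]
      rw [hΨf (0, a) hua, hτt]
      simp only [ContinuousLinearMap.comp_apply]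
      rw [zero_smul ℝ V, add_zero]
      congr 1
      exact (c.dJetSymm_fderiv_locJet h hc z₀ (frame n i)).symm
  · exact DifferentiableAt.continuousAlternatingMapCompContinuousLinearMap
      ((hκd.comp (0, a) hfd).differentiableAt (by simp))
      ((hfd.fderiv_right (m := ∞) (by simp)).differentiableAt (by simp))
  -- Near `(0, a)` the pulled back form is `locTheta` along `Ψ`: pulling back by `τ` passes from `χ`
  -- to the coordinates `c`, where `pullback_poincareCartan` applies.
  · have hcont : ContinuousAt Ψ (0, a) := (hΨd (0, a) hua).continuousAt
    have ev1 : ∀ᶠ q in 𝓝 ((0 : ℝ), a), Ψ q ∈ (c.jetHomeo z₀).target :=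
      hcont.preimage_mem_nhds ((c.jetHomeo z₀).open_target.mem_nhds htar)
    have ev2 : ∀ᶠ q in 𝓝 ((0 : ℝ), a), (c.jetHomeo z₀).symm (Ψ q) ∈ χ.source := by
      refine ContinuousAt.preimage_mem_nhds (f := (c.jetHomeo z₀).symm ∘ Ψ) ?_
        (χ.open_source.mem_nhds hmem)
      exact ContinuousAt.comp (((c.jetHomeo z₀).continuousAt_symm htar)) hcont
    have ev3 : ∀ᶠ q in 𝓝 ((0 : ℝ), a), ContDiffAt ℝ ∞ u q.2 :=
      (continuousAt_snd (p := ((0 : ℝ), a))).eventually hcu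
    filter_upwards [ev1, ev2, ev3] with q h1 h2 h3 W
    have hτq : ContDiffAt ℝ ∞ τ (Ψ q) := hs.contDiffAt_change hs' h1 h2
    have hcomp : fderiv ℝ (τ ∘ Ψ) q = (fderiv ℝ τ (Ψ q)).comp (fderiv ℝ Ψ q) :=
      fderiv_comp _ (hτq.differentiableAt (by simp)) ((hΨd q h3).differentiableAt (by simp))
    have e1 := pullback_symm_change hs hs' (poincareCartan η L) h1 h2
    have e2 := c.pullback_poincareCartan z₀ hL η h1 (fun i ↦ fderiv ℝ Ψ q (W i))
    rw [e1] at e2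
    have e3 : (fun i ↦ fderiv ℝ (locJet u) q.2 (W i).2 + (W i).1 • V)
        = fun i ↦ fderiv ℝ Ψ q (W i) := funext fun i ↦ (hΨf q h3 (W i)).symm
    rw [e3]
    refine Eq.trans ?_ e2
    rw [hcomp]
    rfl

end Pointwise

/-! ### Vector fields supported in a chart -/

section Fields

variable {E : Type*} [NormedAddCommGroup E] [NormedSpace ℝ E]
  {M : Type*} [TopologicalSpace M] [ChartedSpace E M] [IsManifold 𝓘(ℝ, E) ∞ M]
  {F : Type*} [NormedAddCommGroup F] [NormedSpace ℝ F]

/-- A vector field with smooth components in a chart, vanishing off a closed subset of the domain of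
the chart, is smooth. -/
theorem smoothField_of_chart {e : OpenPartialHomeomorph M F} (he : IsSmoothChart (E := E) e)
    {g : M → F} (hg : ContMDiffOn 𝓘(ℝ, E) 𝓘(ℝ, F) ∞ g e.source) {K : Set M} (hK : IsClosed K)
    (hKe : K ⊆ e.source) (h0 : ∀ x, x ∉ K → g x = 0) :
    SmoothField (E := E) (M := M) (fun x ↦ tder F E e.symm (e x) (g x)) := by
  intro x₀
  refine (Bundle.contMDiffAt_section (F := E) (E := (TangentSpace 𝓘(ℝ, E) : M → Type _)) (n := ∞)
    (IB := 𝓘(ℝ, E)) (s := fun x ↦ tder F E e.symm (e x) (g x)) x₀).2 ?_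
  have hχ : IsSmoothChart (E := E) (chartAt E x₀) := isSmoothChart_chartAt x₀
  -- The trivialization of the tangent bundle at `x₀` reads a vector through the differential of the
  -- preferred chart, so the fibre component of the field is a derivative of a change of coordinates
  -- applied to `g`.
  have htriv : ∀ x ∈ (chartAt E x₀).source, ∀ v : E,
      (trivializationAt E (TangentSpace 𝓘(ℝ, E) : M → Type _) x₀ ⟨x, v⟩).2
        = tder E E (chartAt E x₀) x v := by
    intro x hx v
    have h1 := TangentBundle.continuousLinearMapAt_trivializationAt (𝕜 := ℝ) (I := 𝓘(ℝ, E)) hx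
    have h2 := congrArg (fun A : E →L[ℝ] E ↦ A v) h1
    have h3 := Bundle.Trivialization.continuousLinearMapAt_apply_of_mem (R := ℝ)
      (trivializationAt E (TangentSpace 𝓘(ℝ, E) : M → Type _) x₀) (b := x) hx v
    exact h3.symm.trans h2
  have hsrc : ∀ᶠ x in 𝓝 x₀, x ∈ (chartAt E x₀).source :=
    (chartAt E x₀).open_source.mem_nhds (mem_chart_source E x₀)
  by_cases hx₀ : x₀ ∈ K
  · have hxe := hKe hx₀
    have hev : ∀ᶠ x in 𝓝 x₀, x ∈ e.source := e.open_source.mem_nhds hxe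
    have hd : ContDiffAt ℝ ∞ (fderiv ℝ (chartAt E x₀ ∘ e.symm)) (e x₀) :=
      (he.contDiffAt_change hχ (e.map_source hxe) (by
        rw [e.left_inv hxe]; exact mem_chart_source E x₀)).fderiv_right (by simp)
    have hd' : ContMDiffAt 𝓘(ℝ, E) 𝓘(ℝ, F →L[ℝ] E) ∞
        (fun x ↦ fderiv ℝ (chartAt E x₀ ∘ e.symm) (e x)) x₀ :=
      hd.contMDiffAt.comp x₀ (he.contMDiffAt hxe)
    have hg' : ContMDiffAt 𝓘(ℝ, E) 𝓘(ℝ, F) ∞ g x₀ :=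
      hg.contMDiffAt (e.open_source.mem_nhds hxe)
    refine (hd'.clm_apply hg').congr_of_eventuallyEq ?_
    filter_upwards [hsrc, hev] with x h1 h2
    rw [htriv x h1]
    have h3 := tder_comp (x := e x) (g := chartAt E x₀) (f := e.symm)
      (by rw [e.left_inv h2]; exact hχ.mdiffAt h1) (he.mdiffAt_symm (e.map_source h2))
    rw [tder_eq_fderiv, e.left_inv h2] at h3
    rw [h3]
    rfl
  · have hev : ∀ᶠ x in 𝓝 x₀, x ∉ K := hK.isOpen_compl.mem_nhds hx₀
    refine contMDiffAt_const (c := (0 : E)) |>.congr_of_eventuallyEq ?_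
    filter_upwards [hsrc, hev] with x h1 h2
    rw [htriv x h1, h0 x h2]
    exact (congrArg _ (map_zero _)).trans (map_zero _)

end Fields

/-! ### Contractions of `Ω_L` and the Euler–Lagrange equations -/

section Pointwise

variable {n m : ℕ} {X Y : Type*}
  [TopologicalSpace X] [ChartedSpace (EBase n) X] [IsManifold (𝓡 (n + 1)) ∞ X]
  [TopologicalSpace Y] [ChartedSpace (ETot n m) Y]
  {P : Fibration n m X Y} {η : DiffForm (EBase n) X (n + 1)} {L : Jet P → ℝ}

/-- Contraction puts `ξ` in the first slot and the pullback puts tangent vectors of `j¹φ` in the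
others, which is the configuration of `extDer_poincareCartan_apply`. The sign is that of `Ω_L =
-dΘ_L`. -/
theorem pullback_interiorProduct_apply (hη : IsVolumeForm η)
    (hL : ContMDiff 𝓘(ℝ, EJet n m) 𝓘(ℝ, ℝ) ∞ L) {φ : X → Y} {x : X}
    (h : IsSectionNear P φ x) (c : FiberedChart P) (hc : φ x ∈ c.total.source) (z₀ : Jet P)
    (ξ : (z : Jet P) → TangentSpace 𝓘(ℝ, EJet n m) z) (V : EJet n m)
    (hV : ξ (P.jet1 φ x) = c.dJetSymm z₀ (c.jetHomeo z₀ (P.jet1 φ x)) V) :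
    pullback (E := EBase n) (P.jet1 φ) (interiorProduct ξ (poincareCartanTwo η L)) x
        (fun i ↦ c.dBaseSymm (c.base x) (frame n i))
      = -(c.EL η L z₀ φ (c.base x) (V.1.2 - fderiv ℝ (c.rep φ) (c.base x) V.1.1)) := by
  rw [← extDer_poincareCartan_apply hη hL h c hc z₀ V, ← hV]
  rfl

/-- A top-degree form on a tangent space is determined by its value on one frame, and every value of
`ξ` at the jet has coordinates `V`. The argument is pointwise in `ξ`. -/
theorem pullback_interiorProduct_eq_zero (hη : IsVolumeForm η)
    (hL : ContMDiff 𝓘(ℝ, EJet n m) 𝓘(ℝ, ℝ) ∞ L) {φ : X → Y} {x : X}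
    (h : IsSectionNear P φ x) (c : FiberedChart P) (hc : φ x ∈ c.total.source) (z₀ : Jet P)
    (hEL : c.EL η L z₀ φ (c.base x) = 0)
    (ξ : (z : Jet P) → TangentSpace 𝓘(ℝ, EJet n m) z) :
    pullback (E := EBase n) (P.jet1 φ) (interiorProduct ξ (poincareCartanTwo η L)) x = 0 := by
  obtain ⟨hx, hev⟩ := c.eventually_rep h hc z₀
  have hs := c.isSmoothChart_jetHomeo z₀
  have hz : P.jet1 φ x ∈ (c.jetHomeo z₀).source := by
    rw [c.mem_jetHomeo_source, h.jet1_pt]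
    exact hc
  have h1 := pullback_interiorProduct_apply hη hL h c hc z₀ ξ
    (mfderiv 𝓘(ℝ, EJet n m) 𝓘(ℝ, EJet n m) (c.jetHomeo z₀) (P.jet1 φ x) (ξ (P.jet1 φ x)))
    (hs.mfderiv_symm_mfderiv hz _).symm
  rw [hEL] at h1
  set κ := pullback (E := EBase n) (P.jet1 φ) (interiorProduct ξ (poincareCartanTwo η L)) x with hκ
  have h2 : κ.compContinuousLinearMap (c.dBaseSymm (c.base x)) = 0 :=
    eq_zero_of_apply_frame (h1.trans (by simp))
  ext v
  have h3 := congrArg (fun κ ↦ κ (fun i ↦ c.dBase x (v i))) h2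
  have h4 : ∀ w, c.dBaseSymm (c.base x) (c.dBase x w) = w := fun w ↦
    congrArg (fun A : EBase n →L[ℝ] EBase n ↦ A w) (c.dBaseSymm_comp_dBase hx)
  simpa [h4, Function.comp_def] using h3

/-- The test fields are `∂/∂y` in the direction `v`, multiplied by a bump function on `Y` pulled
back to the jet bundle. No cut-off along the fibres of `J¹π → Y` is required, since an induced chart
contains whole fibres. -/
theorem EL_eq_zero_of_pullback [IsManifold (𝓡 (n + 1 + m)) ∞ Y] [T2Space Y] (hη : IsVolumeForm η)
    (hL : ContMDiff 𝓘(ℝ, EJet n m) 𝓘(ℝ, ℝ) ∞ L) {φ : X → Y} {x : X}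
    (h : IsSectionNear P φ x) (c : FiberedChart P) (hc : φ x ∈ c.total.source) (z₀ : Jet P)
    (hpb : ∀ ξ : (z : Jet P) → TangentSpace 𝓘(ℝ, EJet n m) z, SmoothField ξ →
      pullback (E := EBase n) (P.jet1 φ) (interiorProduct ξ (poincareCartanTwo η L)) x = 0) :
    c.EL η L z₀ φ (c.base x) = 0 := by
  ext v
  obtain ⟨f, -, hf⟩ := (SmoothBumpFunction.nhds_basis_tsupport (I := 𝓡 (n + 1 + m))
    (φ x)).mem_iff.1 (c.total.open_source.mem_nhds hc)
  set V : EJet n m := ((0, v), 0) with hV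
  have hsm : SmoothField (E := EJet n m) (M := Jet P) (fun z ↦ tder (EJet n m) (EJet n m)
      (c.jetHomeo z₀).symm (c.jetHomeo z₀ z) (f z.pt • V)) := by
    refine smoothField_of_chart (c.isSmoothChart_jetHomeo z₀) (K := Jet.pt ⁻¹' tsupport f) ?_
      ((isClosed_tsupport f).preimage Jet.contMDiff_pt.continuous) (fun z hz ↦ hf hz) ?_
    · have h1 : ContMDiff 𝓘(ℝ, EJet n m) 𝓘(ℝ, ℝ) ∞ (fun z : Jet P ↦ f z.pt) :=
        f.contMDiff.comp Jet.contMDiff_pt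
      exact (h1.smul contMDiff_const).contMDiffOn
    · intro z hz
      have h1 : f z.pt = 0 := image_eq_zero_of_notMem_tsupport hz
      rw [h1]
      exact zero_smul ℝ V
  have h1 := pullback_interiorProduct_apply hη hL h c hc z₀ (fun z ↦ tder (EJet n m) (EJet n m)
      (c.jetHomeo z₀).symm (c.jetHomeo z₀ z) (f z.pt • V)) V (by
    beta_reduce
    rw [h.jet1_pt, f.eq_one, one_smul ℝ V]
    rfl)
  rw [hpb _ hsm] at h1
  have h2 := neg_eq_zero.1 h1.symm
  rwa [hV, map_zero, sub_zero] at h2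

end Pointwise

/-! ### Families of maps between model spaces and their 1-jets -/

section EuclideanFamilies

variable {n m : ℕ} {U : ℝ × EBase n → EFib m} {q : ℝ × EBase n}

/-- The 1-jets `j¹(U t)(a)` of a family of maps. -/
def famJet (U : ℝ × EBase n → EFib m) (q : ℝ × EBase n) : EJet n m :=
  ((q.2, U q), (fderiv ℝ U q).comp (ContinuousLinearMap.inr ℝ ℝ (EBase n)))

theorem contDiffAt_famJet (hU : ContDiffAt ℝ ∞ U q) : ContDiffAt ℝ ∞ (famJet U) q :=
  (contDiffAt_snd.prodMk hU).prodMk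
    ((hU.fderiv_right (m := ∞) (by simp)).clm_comp contDiffAt_const)

theorem hasFDerivAt_slice (hU : ContDiffAt ℝ ∞ U q) :
    HasFDerivAt (fun a ↦ U (q.1, a))
      ((fderiv ℝ U q).comp (ContinuousLinearMap.inr ℝ ℝ (EBase n))) q.2 := by
  have h1 : HasFDerivAt U (fderiv ℝ U q) (q.1, q.2) :=
    (hU.differentiableAt (by simp)).hasFDerivAt
  exact h1.comp q.2 (hasFDerivAt_prodMk_right q.1 q.2)

theorem famJet_eq (hU : ContDiffAt ℝ ∞ U q) :
    famJet U q = locJet (fun a ↦ U (q.1, a)) q.2 := by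
  rw [locJet, (hasFDerivAt_slice hU).fderiv]
  rfl

/-- The velocity of the family of 1-jets is the 1-jet of the velocity. -/
theorem fderiv_famJet (hU : ContDiffAt ℝ ∞ U q) :
    fderiv ℝ (famJet U) q (1, 0)
      = ((0, fderiv ℝ U q (1, 0)), fderiv ℝ (fun a ↦ fderiv ℝ U (q.1, a) (1, 0)) q.2) := by
  have hU1 : ContDiffAt ℝ ∞ (fderiv ℝ U) q := hU.fderiv_right (m := ∞) (by simp)
  have d1 : HasFDerivAt U (fderiv ℝ U q) q := (hU.differentiableAt (by simp)).hasFDerivAt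
  have d2 : HasFDerivAt (fderiv ℝ U) (fderiv ℝ (fderiv ℝ U) q) q :=
    (hU1.differentiableAt (by simp)).hasFDerivAt
  have d3 := d2.clm_comp (hasFDerivAt_const (ContinuousLinearMap.inr ℝ ℝ (EBase n)) q)
  have d4 := (hasFDerivAt_snd.prodMk d1).prodMk d3
  have d5 : HasFDerivAt (fun a ↦ fderiv ℝ U (q.1, a) (1, 0)) _ q.2 :=
    (HasFDerivAt.comp (g := fderiv ℝ U) (f := fun a ↦ (q.1, a)) q.2
      (show HasFDerivAt (fderiv ℝ U) (fderiv ℝ (fderiv ℝ U) q) (q.1, q.2) from d2)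
      (hasFDerivAt_prodMk_right q.1 q.2)).clm_apply (hasFDerivAt_const _ _)
  -- Symmetry of the second derivative of `U` interchanges the derivative in `t` with those in the
  -- base directions.
  have hsym := hU.isSymmSndFDerivAt (by simpa using ENat.LEInfty.out)
  refine (congrArg (fun f ↦ f (1, 0)) d4.fderiv).trans ?_
  rw [d5.fderiv]
  refine Prod.ext rfl ?_
  ext1 v
  simpa using hsym.eq (1, 0) (0, v)

end EuclideanFamilies

/-! ### Families of sections and the first variation of the Lagrangian -/

section Families

variable {n m : ℕ} {X Y : Type*}
  [TopologicalSpace X] [ChartedSpace (EBase n) X]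
  [TopologicalSpace Y] [ChartedSpace (ETot n m) Y]
  {P : Fibration n m X Y} {Φ : ℝ → X → Y} {L : Jet P → ℝ}

/-- The map `(t, x) ↦ Φ t x` is a smooth family of sections of `π` near `p`. -/
def IsSectionFamily (P : Fibration n m X Y) (Φ : ℝ → X → Y) (p : ℝ × X) : Prop :=
  ∀ᶠ q in 𝓝 p, ContMDiffAt (𝓘(ℝ, ℝ).prod (𝓡 (n + 1))) (𝓡 (n + 1 + m)) ∞
    (fun q : ℝ × X ↦ Φ q.1 q.2) q ∧ P.proj (Φ q.1 q.2) = q.2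

theorem IsSectionFamily.eventually {p : ℝ × X} (h : IsSectionFamily P Φ p) :
    ∀ᶠ q in 𝓝 p, IsSectionFamily P Φ q := eventually_eventually_nhds.2 h

theorem IsSectionFamily.isSectionNear {p : ℝ × X} (h : IsSectionFamily P Φ p) :
    IsSectionNear P (Φ p.1) p.2 := by
  have hc : Tendsto (fun x ↦ (p.1, x)) (𝓝 p.2) (𝓝 p) :=
    (Continuous.prodMk_right p.1).continuousAt
  filter_upwards [hc.eventually h] with x hx
  refine ⟨?_, hx.2⟩
  exact ContMDiffAt.comp x (g := fun q : ℝ × X ↦ Φ q.1 q.2) (f := fun x ↦ (p.1, x)) hx.1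
    (contMDiffAt_const.prodMk contMDiffAt_id)

namespace FiberedChart

variable (c : FiberedChart P)

/-- The coordinate expression of a family of sections. -/
def repFam (Φ : ℝ → X → Y) (q : ℝ × EBase n) : EFib m := c.rep (Φ q.1) q.2

/-- The velocity `∂/∂t` at `t = 0` of a family of sections in coordinates. -/
def velocity (Φ : ℝ → X → Y) (a : EBase n) : EFib m := fderiv ℝ (c.repFam Φ) (0, a) (1, 0)

variable {c}

theorem contDiffAt_repFam {p : ℝ × X} (h : IsSectionFamily P Φ p)
    (hc : Φ p.1 p.2 ∈ c.total.source) :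
    p.2 ∈ c.base.source ∧ ContDiffAt ℝ ∞ (c.repFam Φ) (p.1, c.base p.2) := by
  have hx := (c.total_eq h.self_of_nhds.2 hc).1
  refine ⟨hx, ?_⟩
  have hinv := c.base.left_inv hx
  have d1 : ContMDiffAt 𝓘(ℝ, ℝ × EBase n) (𝓘(ℝ, ℝ).prod (𝓡 (n + 1))) ∞
      (fun q : ℝ × EBase n ↦ (q.1, c.base.symm q.2)) (p.1, c.base p.2) := by
    refine contDiff_fst.contMDiff.contMDiffAt.prodMk ?_
    exact ContMDiffAt.comp (g := c.base.symm) (f := Prod.snd) (p.1, c.base p.2)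
      (c.isSmoothChart_base.contMDiffAt_symm (c.base.map_source hx))
      contDiff_snd.contMDiff.contMDiffAt
  have d2 : ContMDiffAt 𝓘(ℝ, ℝ × EBase n) (𝓡 (n + 1 + m)) ∞
      (fun q : ℝ × EBase n ↦ Φ q.1 (c.base.symm q.2)) (p.1, c.base p.2) := by
    refine ContMDiffAt.comp (g := fun q : ℝ × X ↦ Φ q.1 q.2) (p.1, c.base p.2) ?_ d1
    rw [hinv]
    exact h.self_of_nhds.1
  have d3 : ContMDiffAt 𝓘(ℝ, ℝ × EBase n) 𝓘(ℝ, EBase n × EFib m) ∞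
      (fun q : ℝ × EBase n ↦ c.total (Φ q.1 (c.base.symm q.2))) (p.1, c.base p.2) := by
    refine ContMDiffAt.comp (g := c.total) (p.1, c.base p.2) ?_ d2
    rw [hinv]
    exact c.isSmoothChart_total.contMDiffAt hc
  exact contDiffAt_snd.comp _ (contMDiffAt_iff_contDiffAt.1 d3)

theorem eventually_mem_total {p : ℝ × X} (h : IsSectionFamily P Φ p)
    (hc : Φ p.1 p.2 ∈ c.total.source) : ∀ᶠ q in 𝓝 p, Φ q.1 q.2 ∈ c.total.source :=
  ContinuousAt.preimage_mem_nhds (f := fun q : ℝ × X ↦ Φ q.1 q.2) h.self_of_nhds.1.continuousAt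
    (c.total.open_source.mem_nhds hc)

theorem tendsto_prod_base {x : X} (hx : x ∈ c.base.source) (t : ℝ) :
    Tendsto (fun q : ℝ × EBase n ↦ (q.1, c.base.symm q.2)) (𝓝 (t, c.base x)) (𝓝 (t, x)) := by
  rw [nhds_prod_eq, nhds_prod_eq]
  exact tendsto_id.prodMap (c.base.tendsto_symm hx)

/-- The coordinate expression of the Lagrangian along a family of sections. -/
theorem eventually_lag_eq {p : ℝ × X} (h : IsSectionFamily P Φ p)
    (hc : Φ p.1 p.2 ∈ c.total.source) (z₀ : Jet P) :
    (fun q : ℝ × EBase n ↦ L (P.jet1 (Φ q.1) (c.base.symm q.2)))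
      =ᶠ[𝓝 (p.1, c.base p.2)] fun q ↦ c.locLag z₀ L (famJet (c.repFam Φ) q) := by
  have hx := (contDiffAt_repFam h hc).1
  have hev := (tendsto_prod_base hx p.1).eventually (h.eventually.and (eventually_mem_total h hc))
  have hb : ∀ᶠ q : ℝ × EBase n in 𝓝 (p.1, c.base p.2), q.2 ∈ c.base.target :=
    continuousAt_snd.preimage_mem_nhds (c.base.open_target.mem_nhds (c.base.map_source hx))
  filter_upwards [hev, hb] with q hq hqb
  have h1 := (contDiffAt_repFam hq.1 hq.2).2
  have h2 := (c.eventually_rep hq.1.isSectionNear hq.2 z₀).2.self_of_nhds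
  rw [show ((q.1, c.base.symm q.2) : ℝ × X).2 = c.base.symm q.2 from rfl,
    c.base.right_inv hqb] at h1 h2
  rw [famJet_eq h1]
  exact congrArg L h2.2.2.2.2.2.symm

theorem famJet_mem {p : ℝ × X} (h : IsSectionFamily P Φ p)
    (hc : Φ p.1 p.2 ∈ c.total.source) :
    (famJet (c.repFam Φ) (p.1, c.base p.2)).1 ∈ c.total.target := by
  have h1 := (c.total_eq h.self_of_nhds.2 hc).2
  have h2 := c.total.map_source hc
  rw [h1] at h2
  exact h2

theorem contDiffAt_lag (hL : ContMDiff 𝓘(ℝ, EJet n m) 𝓘(ℝ, ℝ) ∞ L) {p : ℝ × X}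
    (h : IsSectionFamily P Φ p) (hc : Φ p.1 p.2 ∈ c.total.source) :
    ContDiffAt ℝ ∞ (fun q : ℝ × EBase n ↦ L (P.jet1 (Φ q.1) (c.base.symm q.2)))
      (p.1, c.base p.2) := by
  have z₀ : Jet P := P.jet1 (Φ p.1) p.2
  refine ContDiffAt.congr_of_eventuallyEq ?_ (eventually_lag_eq h hc z₀)
  exact ContDiffAt.comp (g := c.locLag z₀ L) _ (c.contDiffAt_locLag z₀ hL (famJet_mem h hc))
    (contDiffAt_famJet (contDiffAt_repFam h hc).2)

end FiberedChart

/-- The derivative of the Lagrangian along a family of sections. -/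
def varLag (L : Jet P → ℝ) (Φ : ℝ → X → Y) (p : ℝ × X) : ℝ :=
  deriv (fun t ↦ L (P.jet1 (Φ t) p.2)) p.1

namespace FiberedChart

variable {c : FiberedChart P}

theorem hasDerivAt_lag (hL : ContMDiff 𝓘(ℝ, EJet n m) 𝓘(ℝ, ℝ) ∞ L) {p : ℝ × X}
    (h : IsSectionFamily P Φ p) (hc : Φ p.1 p.2 ∈ c.total.source) :
    HasDerivAt (fun t ↦ L (P.jet1 (Φ t) p.2))
      (fderiv ℝ (fun q : ℝ × EBase n ↦ L (P.jet1 (Φ q.1) (c.base.symm q.2)))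
        (p.1, c.base p.2) (1, 0)) p.1 := by
  have hx := (contDiffAt_repFam h hc).1
  have h1 := ((contDiffAt_lag hL h hc).differentiableAt (by simp)).hasFDerivAt
  have h2 := h1.comp_hasDerivAt p.1 (f := fun t ↦ (t, c.base p.2))
    ((hasDerivAt_id p.1).prodMk (hasDerivAt_const p.1 (c.base p.2)))
  simpa [Function.comp_def, c.base.left_inv hx] using h2

/-- The first variation of the Lagrangian in coordinates. -/
theorem varLag_eq (hL : ContMDiff 𝓘(ℝ, EJet n m) 𝓘(ℝ, ℝ) ∞ L) {x : X}
    (h : IsSectionFamily P Φ (0, x)) (hc : Φ 0 x ∈ c.total.source) (z₀ : Jet P) :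
    varLag L Φ (0, x) = fderiv ℝ (c.locLag z₀ L) (locJet (c.rep (Φ 0)) (c.base x))
      ((0, c.velocity Φ (c.base x)), fderiv ℝ (c.velocity Φ) (c.base x)) := by
  have h1 := (contDiffAt_repFam h hc).2
  have h2 := famJet_eq h1
  rw [varLag, (hasDerivAt_lag hL h hc).deriv, (eventually_lag_eq h hc z₀).fderiv_eq]
  have h3 := ((c.contDiffAt_locLag z₀ hL (famJet_mem h hc)).differentiableAt
    (by simp)).hasFDerivAt.comp _ ((contDiffAt_famJet h1).differentiableAt (by simp)).hasFDerivAt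
  refine (congrArg (fun f ↦ f (1, 0)) h3.fderiv).trans ?_
  rw [ContinuousLinearMap.comp_apply, fderiv_famJet h1, h2]
  rfl

end FiberedChart

theorem IsSectionFamily.hasDerivAt (hL : ContMDiff 𝓘(ℝ, EJet n m) 𝓘(ℝ, ℝ) ∞ L) {p : ℝ × X}
    (h : IsSectionFamily P Φ p) :
    HasDerivAt (fun t ↦ L (P.jet1 (Φ t) p.2)) (varLag L Φ p) p.1 := by
  obtain ⟨c, hc⟩ := P.exists_fiberedChart (Φ p.1 p.2)
  exact (FiberedChart.hasDerivAt_lag hL h hc).differentiableAt.hasDerivAt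

theorem IsSectionFamily.continuousAt_lag (hL : ContMDiff 𝓘(ℝ, EJet n m) 𝓘(ℝ, ℝ) ∞ L) {p : ℝ × X}
    (h : IsSectionFamily P Φ p) : ContinuousAt (fun p : ℝ × X ↦ L (P.jet1 (Φ p.1) p.2)) p := by
  obtain ⟨c, hc⟩ := P.exists_fiberedChart (Φ p.1 p.2)
  have hx := (FiberedChart.contDiffAt_repFam h hc).1
  have h1 : ContinuousAt (fun q : ℝ × X ↦ (q.1, c.base q.2)) p :=
    continuousAt_fst.prodMk ((c.base.continuousAt hx).comp continuousAt_snd)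
  have h2 := ContinuousAt.comp (f := fun q : ℝ × X ↦ (q.1, c.base q.2)) (x := p)
    (FiberedChart.contDiffAt_lag hL h hc).continuousAt h1
  refine h2.congr ?_
  have hs : ∀ᶠ q : ℝ × X in 𝓝 p, q.2 ∈ c.base.source :=
    continuousAt_snd.preimage_mem_nhds (c.base.open_source.mem_nhds hx)
  filter_upwards [hs] with q hq
  simp [c.base.left_inv hq]

/-- Continuity is joint in `(t, x)`; over a compact set it yields the uniform bound needed to
differentiate under the integral. -/
theorem IsSectionFamily.continuousAt_varLag (hL : ContMDiff 𝓘(ℝ, EJet n m) 𝓘(ℝ, ℝ) ∞ L)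
    {p : ℝ × X} (h : IsSectionFamily P Φ p) : ContinuousAt (varLag L Φ) p := by
  obtain ⟨c, hc⟩ := P.exists_fiberedChart (Φ p.1 p.2)
  have hx := (FiberedChart.contDiffAt_repFam h hc).1
  have h1 : ContinuousAt (fun q : ℝ × X ↦ (q.1, c.base q.2)) p :=
    continuousAt_fst.prodMk ((c.base.continuousAt hx).comp continuousAt_snd)
  have h2 := ContinuousAt.comp (f := fun q : ℝ × X ↦ (q.1, c.base q.2)) (x := p)
    ((((FiberedChart.contDiffAt_lag hL h hc).fderiv_right (m := ∞)
      (by simp)).continuousAt).clm_apply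
      (continuousAt_const (y := ((1 : ℝ), (0 : EBase n))))) h1
  refine h2.congr ?_
  filter_upwards [h.eventually, FiberedChart.eventually_mem_total h hc] with q hq hqc
  exact (FiberedChart.hasDerivAt_lag hL hq hqc).deriv.symm

end Families

/-! ### The derivative of the action -/

section ActionDerivative

variable {n m : ℕ} {X Y : Type*}
  [TopologicalSpace X] [T2Space X] [SecondCountableTopology X]
  [ChartedSpace (EBase n) X] [IsManifold (𝓡 (n + 1)) ∞ X] [MeasurableSpace X] [BorelSpace X]
  [TopologicalSpace Y] [ChartedSpace (ETot n m) Y]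
  {P : Fibration n m X Y} {Φ : ℝ → X → Y} {η : DiffForm (EBase n) X (n + 1)} {L : Jet P → ℝ}

/-- The pullback of `L η` by the prolongation of a section is `L(j¹ψ) η`, so dividing by `η` leaves
the function `L ∘ j¹ψ`. -/
theorem action_eq (hη : IsVolumeForm η) {C : Set X} (hC : MeasurableSet C) {ψ : X → Y}
    (h : ∀ x ∈ C, IsSectionNear P ψ x) :
    action η L C ψ = ∫ x in C, L (P.jet1 ψ x) ∂volumeMeasure η := by
  refine setIntegral_congr_fun hC fun x hx ↦ ?_
  have h0 : η x (frame n) ≠ 0 := fun h0 ↦ hη.ne_zero x (eq_zero_of_apply_frame h0)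
  beta_reduce
  rw [(h x hx).pullback_lagrangianForm]
  simp [h0]

/-- Differentiation of the action under the integral sign. -/
theorem hasDerivAt_action (hη : IsVolumeForm η) (hL : ContMDiff 𝓘(ℝ, EJet n m) 𝓘(ℝ, ℝ) ∞ L)
    {C : Set X} (hC : IsCompact C) (h : ∀ x ∈ C, IsSectionFamily P Φ (0, x)) :
    HasDerivAt (fun t ↦ action η L C (Φ t))
      (∫ x in C, varLag L Φ (0, x) ∂volumeMeasure η) 0 := by
  have := isLocallyFiniteMeasure_volumeMeasure hη
  have hcont0 : ContinuousOn (fun x ↦ varLag L Φ (0, x)) C := fun x hx ↦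
    (ContinuousAt.comp (f := fun x ↦ ((0 : ℝ), x)) (x := x) ((h x hx).continuousAt_varLag hL)
      (Continuous.prodMk_right (0 : ℝ)).continuousAt).continuousWithinAt
  obtain ⟨B, hB⟩ := hC.exists_bound_of_continuousOn hcont0
  -- Compactness of `C` makes both local statements uniform in `x` for small `t`. Since `B` bounds
  -- `varLag` at time zero, `B + 1` bounds it for nearby times.
  have hev : ∀ᶠ t in 𝓝 (0 : ℝ), ∀ x ∈ C,
      IsSectionFamily P Φ (t, x) ∧ ‖varLag L Φ (t, x)‖ < B + 1 := by
    refine hC.eventually_forall_of_forall_eventually fun x hx ↦ ?_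
    have h2 : ∀ᶠ p in 𝓝 ((0 : ℝ), x), ‖varLag L Φ p‖ < B + 1 :=
      ((h x hx).continuousAt_varLag hL).norm.eventually_lt_const
        (lt_of_le_of_lt (hB x hx) (lt_add_one B))
    exact (h x hx).eventually.and h2
  have hcont : ∀ t, (∀ x ∈ C, IsSectionFamily P Φ (t, x)) →
      ContinuousOn (fun x ↦ L (P.jet1 (Φ t) x)) C := fun t ht x hx ↦
    (ContinuousAt.comp (f := fun x ↦ (t, x)) (x := x) ((ht x hx).continuousAt_lag hL)
      (Continuous.prodMk_right t).continuousAt).continuousWithinAt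
  have hfin : IsFiniteMeasure ((volumeMeasure η).restrict C) := ⟨by
    rw [Measure.restrict_apply_univ]
    exact hC.measure_lt_top⟩
  have hder := (hasDerivAt_integral_of_dominated_loc_of_deriv_le
    (μ := (volumeMeasure η).restrict C) (F := fun t x ↦ L (P.jet1 (Φ t) x))
    (F' := fun t x ↦ varLag L Φ (t, x)) (x₀ := (0 : ℝ)) (bound := fun _ ↦ B + 1) hev
    (hev.mono fun t ht ↦ (hcont t fun x hx ↦ (ht x hx).1).aestronglyMeasurable_of_isCompact hC
      hC.measurableSet)
    ((hcont 0 h).integrableOn_compact hC)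
    (hcont0.aestronglyMeasurable_of_isCompact hC hC.measurableSet)
    ((ae_restrict_iff' hC.measurableSet).2 (ae_of_all _ fun x hx t ht ↦ ((ht x hx).2).le))
    (integrable_const _)
    ((ae_restrict_iff' hC.measurableSet).2 (ae_of_all _ fun x hx t ht ↦
      (ht x hx).1.hasDerivAt hL))).2
  refine hder.congr_of_eventuallyEq ?_
  filter_upwards [hev] with t ht
  exact action_eq hη hC.measurableSet fun x hx ↦ (ht x hx).1.isSectionNear

end ActionDerivative

/-! ### Supports and velocities of variations -/

section LocalFirstVariation

theorem contDiff_of_open_of_closed {E F : Type*} [NormedAddCommGroup E] [NormedSpace ℝ E]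
    [NormedAddCommGroup F] [NormedSpace ℝ F] {f : E → F} {N K : Set E} (hK : IsClosed K)
    (hKN : K ⊆ N) (hN : ∀ a ∈ N, ContDiffAt ℝ ∞ f a) (h0 : ∀ a, a ∉ K → f a = 0) :
    ContDiff ℝ ∞ f := by
  refine contDiff_iff_contDiffAt.2 fun a ↦ ?_
  by_cases ha : a ∈ K
  · exact hN a (hKN ha)
  · refine (contDiffAt_const (c := (0 : F))).congr_of_eventuallyEq ?_
    filter_upwards [hK.isOpen_compl.mem_nhds ha] with b hb using h0 b hb

/-- The image of `C ∩ N` may acquire additional frontier along the edge of `N`; at points of the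
open set `N` only the frontier of `C` remains. -/
theorem mem_frontier_of_image {X F : Type*} [TopologicalSpace X] [TopologicalSpace F]
    {e : OpenPartialHomeomorph X F} {C N : Set X} (hN : IsOpen N) (hNs : N ⊆ e.source) {x : X}
    (hx : x ∈ N) (hfr : e x ∈ frontier (e '' (C ∩ N))) : x ∈ frontier C := by
  have hopen : ∀ O : Set X, IsOpen O → x ∈ O → e '' (O ∩ N) ∈ 𝓝 (e x) := fun O hO hxO ↦
    (e.isOpen_image_of_subset_source (hO.inter hN) (inter_subset_right.trans hNs)).mem_nhds
      (mem_image_of_mem _ ⟨hxO, hx⟩)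
  refine ⟨by_contra fun h ↦ ?_, fun h ↦ ?_⟩
  · obtain ⟨_, ⟨y, hy, rfl⟩, y', hy', he⟩ :=
      mem_closure_iff_nhds.1 hfr.1 _ (hopen _ isClosed_closure.isOpen_compl h)
    rw [e.injOn (hNs hy'.2) (hNs hy.2) he] at hy'
    exact hy.1 (subset_closure hy'.1)
  · refine hfr.2 (mem_interior_iff_mem_nhds.2 (mem_of_superset (hopen _ isOpen_interior h) ?_))
    exact image_mono (inter_subset_inter_left _ interior_subset)

variable {n m : ℕ} {X Y : Type*}
  [TopologicalSpace X] [ChartedSpace (EBase n) X]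
  [TopologicalSpace Y] [ChartedSpace (ETot n m) Y]
  {P : Fibration n m X Y} {Φ : ℝ → X → Y} {η : DiffForm (EBase n) X (n + 1)} {L : Jet P → ℝ}
  {c : FiberedChart P}

namespace FiberedChart

theorem velocity_eq_zero {x : X} (h : IsSectionFamily P Φ (0, x)) (hc : Φ 0 x ∈ c.total.source)
    (hst : ∀ᶠ t in 𝓝 (0 : ℝ), Φ t x = Φ 0 x) : c.velocity Φ (c.base x) = 0 := by
  obtain ⟨hx, hd⟩ := contDiffAt_repFam h hc
  have h1 := (hd.differentiableAt (by simp)).hasFDerivAt.comp_hasDerivAt (0 : ℝ)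
    (f := fun t ↦ (t, c.base x)) ((hasDerivAt_id (0 : ℝ)).prodMk (hasDerivAt_const _ (c.base x)))
  refine h1.unique ((hasDerivAt_const (0 : ℝ) (c.repFam Φ (0, c.base x))).congr_of_eventuallyEq ?_)
  filter_upwards [hst] with t ht
  simp [repFam, rep, c.base.left_inv hx, ht]

theorem contDiffAt_velocity {x : X} (h : IsSectionFamily P Φ (0, x))
    (hc : Φ 0 x ∈ c.total.source) : ContDiffAt ℝ ∞ (c.velocity Φ) (c.base x) := by
  have h1 := ((contDiffAt_repFam h hc).2.fderiv_right (m := ∞) (by simp))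
  exact (ContDiffAt.comp (g := fderiv ℝ (c.repFam Φ)) (f := fun a ↦ ((0 : ℝ), a)) (c.base x) h1
    (contDiffAt_const.prodMk contDiffAt_id)).clm_apply contDiffAt_const

/-- Stationarity on a whole neighbourhood makes the derivative of the velocity vanish together with
its value, and the first variation involves both. -/
theorem eventually_velocity {x : X} (h : IsSectionFamily P Φ (0, x))
    (hc : Φ 0 x ∈ c.total.source)
    (hst : ∀ᶠ p in 𝓝 ((0 : ℝ), x), Φ p.1 p.2 = Φ 0 p.2) :
    c.velocity Φ =ᶠ[𝓝 (c.base x)] 0 := by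
  have hx := (contDiffAt_repFam h hc).1
  have hev := (h.eventually.and (eventually_mem_total h hc)).and
    (eventually_eventually_nhds.2 hst)
  have hev' : ∀ᶠ x' in 𝓝 x, (IsSectionFamily P Φ (0, x') ∧ Φ 0 x' ∈ c.total.source) ∧
      ∀ᶠ p in 𝓝 ((0 : ℝ), x'), Φ p.1 p.2 = Φ 0 p.2 :=
    ((Continuous.prodMk_right (0 : ℝ)).tendsto x).eventually hev
  filter_upwards [c.eventually_base hx hev'] with a ha
  have h1 := velocity_eq_zero ha.1.1.1 ha.1.1.2
    (((Continuous.prodMk_left (c.base.symm a)).tendsto (0 : ℝ)).eventually ha.1.2)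
  rwa [c.base.right_inv ha.2] at h1

end FiberedChart

theorem varLag_eq_zero (hL : ContMDiff 𝓘(ℝ, EJet n m) 𝓘(ℝ, ℝ) ∞ L) {x : X}
    (h : IsSectionFamily P Φ (0, x)) (hst : ∀ᶠ p in 𝓝 ((0 : ℝ), x), Φ p.1 p.2 = Φ 0 p.2) :
    varLag L Φ (0, x) = 0 := by
  obtain ⟨c, hc⟩ := P.exists_fiberedChart (Φ 0 x)
  have h1 := FiberedChart.eventually_velocity h hc hst
  rw [FiberedChart.varLag_eq hL h hc (P.jet1 (Φ 0) x), h1.fderiv_eq, h1.self_of_nhds]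
  have h2 : (((0, (0 : EBase n → EFib m) (c.base x)), fderiv ℝ (0 : EBase n → EFib m) (c.base x))
      : EJet n m) = 0 := by
    simp
  rw [h2, map_zero]

end LocalFirstVariation

/-! ### The first variation formula in a chart -/

section LocalFormula

variable {n m : ℕ} {X Y : Type*}
  [TopologicalSpace X] [T2Space X] [SecondCountableTopology X]
  [ChartedSpace (EBase n) X] [IsManifold (𝓡 (n + 1)) ∞ X] [MeasurableSpace X] [BorelSpace X]
  [TopologicalSpace Y] [ChartedSpace (ETot n m) Y]
  {P : Fibration n m X Y} {Φ : ℝ → X → Y} {η : DiffForm (EBase n) X (n + 1)} {L : Jet P → ℝ}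

set_option maxHeartbeats 800000 in
/-- The first variation formula for a family of sections which is stationary off a compact subset of
a coordinate domain and on the boundary of the domain of integration. -/
theorem integral_varLag_eq (hη : IsVolumeForm η) (hL : ContMDiff 𝓘(ℝ, EJet n m) 𝓘(ℝ, ℝ) ∞ L)
    {C : Set X} (hC : IsCompact C) (hfam : ∀ x ∈ C, IsSectionFamily P Φ (0, x))
    (c : FiberedChart P) (z₀ : Jet P) {N K : Set X} (hN : IsOpen N) (hK : IsCompact K)
    (hKN : K ⊆ N) (hNc : ∀ x ∈ N, Φ 0 x ∈ c.total.source)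
    (hNfam : ∀ x ∈ N, IsSectionFamily P Φ (0, x))
    (hst : ∀ x, x ∉ K → ∀ᶠ p in 𝓝 ((0 : ℝ), x), Φ p.1 p.2 = Φ 0 p.2) (s : ℝ)
    (hs : ∀ x ∈ N, |chartDensity η c.base (c.base x)| = s * chartDensity η c.base (c.base x))
    (hfr : ∀ x ∈ frontier C ∩ N, ∀ᶠ t in 𝓝 (0 : ℝ), Φ t x = Φ 0 x)
    (hnull : volume (c.base '' (frontier C ∩ N)) = 0) :
    ∫ x in C, varLag L Φ (0, x) ∂volumeMeasure η
      = s * ∫ a in c.base '' (C ∩ N), c.EL η L z₀ (Φ 0) a (c.velocity Φ a) := by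
  have hNs : N ⊆ c.base.source := fun x hx ↦
    (FiberedChart.contDiffAt_repFam (hNfam x hx) (hNc x hx)).1
  have hN' : IsOpen (c.base '' N) := c.base.isOpen_image_of_subset_source hN hNs
  have hK' : IsCompact (c.base '' K) :=
    hK.image_of_continuousOn (c.base.continuousOn.mono (hKN.trans hNs))
  have hKN' : c.base '' K ⊆ c.base '' N := image_mono hKN
  set ρ := chartDensity η c.base with hρ
  set ℓ := c.locLag z₀ L with hℓ
  set u := c.rep (Φ 0) with hu
  -- Extended by zero, the velocity gives functions `f μ` and `g` that are smooth and compactly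
  -- supported on the entire model space, because it already vanishes on the image of `N` off that
  -- of `K`.
  set w := (c.base '' N).indicator (c.velocity Φ) with hw
  have hρd : ∀ x ∈ N, ContDiffAt ℝ ∞ ρ (c.base x) := fun x hx ↦
    contDiffAt_chartDensity c.isSmoothChart_base hη (c.base.map_source (hNs hx))
  have hud : ∀ x ∈ N, ContDiffAt ℝ ∞ u (c.base x) ∧ ContDiffAt ℝ ∞ ℓ (locJet u (c.base x)) := by
    intro x hx
    have h1 := (c.eventually_rep (hNfam x hx).isSectionNear (hNc x hx) z₀).2.self_of_nhds
    exact ⟨h1.2.2.1, c.contDiffAt_locLag z₀ hL h1.2.2.2.1⟩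
  have hwv : ∀ x ∈ N, w =ᶠ[𝓝 (c.base x)] c.velocity Φ := fun x hx ↦ by
    filter_upwards [hN'.mem_nhds (mem_image_of_mem _ hx)] with b hb
    exact indicator_of_mem hb _
  have hw0 : ∀ a, a ∉ c.base '' K → w a = 0 := by
    intro a ha
    by_cases haN : a ∈ c.base '' N
    · obtain ⟨x, hx, rfl⟩ := haN
      rw [(hwv x hx).self_of_nhds]
      exact (FiberedChart.eventually_velocity (hNfam x hx) (hNc x hx)
        (hst x fun hxK ↦ ha (mem_image_of_mem _ hxK))).self_of_nhds
    · exact indicator_of_notMem haN _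
  have hwd : ∀ x ∈ N, ContDiffAt ℝ ∞ w (c.base x) := fun x hx ↦
    (FiberedChart.contDiffAt_velocity (hNfam x hx) (hNc x hx)).congr_of_eventuallyEq (hwv x hx)
  set f : Fin (n + 1) → EBase n → ℝ := fun μ b ↦ momentum ρ ℓ u μ b (w b) with hf
  have hf0 : ∀ μ a, a ∉ c.base '' K → f μ a = 0 := fun μ a ha ↦ by
    simp only [hf, hw0 a ha, map_zero]
  have hfd : ∀ μ, ContDiff ℝ ∞ (f μ) := fun μ ↦ by
    refine contDiff_of_open_of_closed hK'.isClosed hKN' ?_ (hf0 μ)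
    rintro _ ⟨x, hx, rfl⟩
    exact (contDiffAt_momentum (hρd x hx) (hud x hx).2 (hud x hx).1 μ).clm_apply (hwd x hx)
  have hfc : ∀ μ, HasCompactSupport (f μ) := fun μ ↦
    HasCompactSupport.intro hK' fun a ha ↦ hf0 μ a ha
  set g : EBase n → ℝ := fun b ↦ c.EL η L z₀ (Φ 0) b (w b) with hg
  have hg0 : ∀ a, a ∉ c.base '' K → g a = 0 := fun a ha ↦ by
    simp only [hg, hw0 a ha, map_zero]
  have hgd : ContDiff ℝ ∞ g := by
    refine contDiff_of_open_of_closed hK'.isClosed hKN' ?_ hg0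
    rintro _ ⟨x, hx, rfl⟩
    exact (contDiffAt_eulerLagrange (hρd x hx) (hud x hx).2 (hud x hx).1).clm_apply (hwd x hx)
  have hgi : Integrable g :=
    hgd.continuous.integrable_of_hasCompactSupport (HasCompactSupport.intro hK' fun a ha ↦ hg0 a ha)
  have hfi : ∀ μ v, Integrable (fun a ↦ fderiv ℝ (f μ) a v) := fun μ v ↦ by
    refine Continuous.integrable_of_hasCompactSupport ?_ ((hfc μ).fderiv_apply ℝ v)
    exact ((hfd μ).continuous_fderiv (by simp)).clm_apply continuous_const
  set S := c.base '' (C ∩ N) with hS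
  have hSm : MeasurableSet S := measurableSet_image c.base
    (hC.measurableSet.inter hN.measurableSet) (inter_subset_right.trans hNs)
  have hfrS : frontier S ∩ c.base '' N ⊆ c.base '' (frontier C ∩ N) := by
    rintro _ ⟨hfS, x, hx, rfl⟩
    exact ⟨x, ⟨mem_frontier_of_image hN hNs hx hfS, hx⟩, rfl⟩
  -- The divergence terms. On the frontier of `S`, either the point comes from `∂C`, where the
  -- variation is stationary, or it lies off the image of `K`; in both cases `f μ` is zero.
  have hfz : ∀ μ, ∫ a in S, fderiv ℝ (f μ) a (frame n μ) = 0 := fun μ ↦ by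
    refine setIntegral_fderiv_eq_zero volume hSm ((hfd μ).of_le (by simp)) (hfc μ) ?_ ?_ _
    · intro a ha
      by_cases haN : a ∈ c.base '' N
      · obtain ⟨x, hx, rfl⟩ := hfrS ⟨ha, haN⟩
        have h1 : w (c.base x) = 0 := by
          rw [(hwv x hx.2).self_of_nhds]
          exact FiberedChart.velocity_eq_zero (hNfam x hx.2) (hNc x hx.2) (hfr x hx)
        simp only [hf, h1, map_zero]
      · exact hf0 μ a fun haK ↦ haN (hKN' haK)
    · refine measure_mono_null ?_ hnull
      rintro a ⟨ha, ha'⟩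
      refine hfrS ⟨ha, hKN' ?_⟩
      exact closure_minimal (fun b hb ↦ by_contra fun hbK ↦
        (Function.mem_support.1 hb) (hf0 μ b hbK)) hK'.isClosed ha'
  have hcont : ContinuousOn (fun x ↦ varLag L Φ (0, x)) C := fun x hx ↦
    (ContinuousAt.comp (f := fun x ↦ ((0 : ℝ), x)) (x := x) ((hfam x hx).continuousAt_varLag hL)
      (Continuous.prodMk_right (0 : ℝ)).continuousAt).continuousWithinAt
  have hmeas := hcont.aestronglyMeasurable_of_isCompact (μ := volumeMeasure η) hC hC.measurableSet
  -- The family is stationary off `K`, so the integral may be restricted to `C ∩ N` and written in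
  -- coordinates.
  rw [setIntegral_eq_of_subset_of_forall_sdiff_eq_zero (s := C ∩ N) hC.measurableSet
      inter_subset_left (fun x hx ↦ varLag_eq_zero hL (hfam x hx.1)
        (hst x fun hxK ↦ hx.2 ⟨hx.1, hKN hxK⟩)),
    setIntegral_volumeMeasure c.isSmoothChart_base hη (hC.measurableSet.inter hN.measurableSet)
      (inter_subset_right.trans hNs)
      (hmeas.mono_measure (Measure.restrict_mono inter_subset_left le_rfl))]
  -- The measure has density `|ρ|` while the Euler–Lagrange expression carries `ρ` itself; the
  -- constant `s` accounts for the orientation of the chart.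
  have hcongr : ∀ a ∈ S, |ρ a| * varLag L Φ (0, c.base.symm a)
      = s * (g a + ∑ μ, fderiv ℝ (f μ) a (frame n μ)) := by
    rintro _ ⟨x, hx, rfl⟩
    have hxN := hx.2
    rw [c.base.left_inv (hNs hxN), hs x hxN, FiberedChart.varLag_eq hL (hNfam x hxN) (hNc x hxN) z₀,
      ← (hwv x hxN).fderiv_eq, ← (hwv x hxN).self_of_nhds, mul_assoc]
    congr 1
    exact firstVariation_eq (hρd x hxN) (hud x hxN).2 (hud x hxN).1
      ((hwd x hxN).differentiableAt (by simp))
  rw [setIntegral_congr_fun hSm hcongr, integral_const_mul, integral_add hgi.integrableOn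
    (integrable_finsetSum _ fun μ _ ↦ (hfi μ (frame n μ)).integrableOn),
    integral_finsetSum _ fun μ _ ↦ (hfi μ (frame n μ)).integrableOn]
  simp only [hfz, Finset.sum_const_zero, add_zero]
  congr 1
  refine setIntegral_congr_fun hSm ?_
  rintro _ ⟨x, hx, rfl⟩
  simp only [hg, (hwv x hx.2).self_of_nhds]

end LocalFormula

/-! ### The boundary of a compact domain is a null set -/

section Boundary

variable {n : ℕ} {X : Type*} [TopologicalSpace X] [ChartedSpace (EBase n) X]

theorem volume_hyperplane (n : ℕ) : volume {a : EBase n | a 0 = 0} = 0 := by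
  have h := Measure.addHaar_submodule (volume : Measure (EBase n))
    (LinearMap.ker (EuclideanSpace.proj (𝕜 := ℝ) (0 : Fin (n + 1)) : EBase n →ₗ[ℝ] ℝ)) (by
      intro h
      have h1 : frame n 0 ∈ LinearMap.ker
          (EuclideanSpace.proj (𝕜 := ℝ) (0 : Fin (n + 1)) : EBase n →ₗ[ℝ] ℝ) := by
        rw [h]; trivial
      simp [frame] at h1)
  exact h

theorem eq_zero_of_mem_frontier [T2Space X] {C : Set X} (hC : IsCompact C)
    {e : OpenPartialHomeomorph X (EBase n)} (h : ∀ x ∈ e.source, (x ∈ C ↔ 0 ≤ e x 0)) {x : X}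
    (hx : x ∈ frontier C) (hxe : x ∈ e.source) : e x 0 = 0 := by
  have h1 : 0 ≤ e x 0 := (h x hxe).1 (hC.isClosed.frontier_subset hx)
  refine le_antisymm (not_lt.1 fun h2 ↦ hx.2 ?_) h1
  have hcont : ContinuousAt (fun y ↦ e y 0) x :=
    (EuclideanSpace.proj (𝕜 := ℝ) (0 : Fin (n + 1))).continuous.continuousAt.comp
      (e.continuousAt hxe)
  refine mem_interior_iff_mem_nhds.2 ?_
  filter_upwards [hcont.eventually_const_lt h2, e.open_source.mem_nhds hxe] with y h3 h4
  exact (h y h4).2 h3.le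

/-- The boundary of a compact domain is a null set in coordinates. -/
theorem eventually_null_frontier [IsManifold (𝓡 (n + 1)) ∞ X] [T2Space X] {C : Set X}
    (hC : IsCompactDomain n C) {e : OpenPartialHomeomorph X (EBase n)}
    (he : IsSmoothChart (E := EBase n) e) {x : X} (hx : x ∈ e.source) :
    ∃ N ∈ 𝓝 x, volume (e '' (frontier C ∩ N)) = 0 := by
  by_cases hxC : x ∈ frontier C
  · obtain ⟨e', he'm, hxe', hC'⟩ := hC.boundary x hxC
    have he' : IsSmoothChart (E := EBase n) e' := isSmoothChart_of_mem_maximalAtlas he'm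
    refine ⟨e'.source ∩ e.source, (e'.open_source.inter e.open_source).mem_nhds ⟨hxe', hx⟩, ?_⟩
    -- In a boundary chart the frontier lies in a hyperplane, and the change of coordinates, being
    -- differentiable, preserves null sets.
    set S : Set (EBase n) := {a | a 0 = 0} ∩ (e'.target ∩ e'.symm ⁻¹' e.source) with hS
    have hSn : volume S = 0 := measure_mono_null inter_subset_left (volume_hyperplane n)
    refine measure_mono_null ?_ (addHaar_image_eq_zero_of_differentiableOn_of_addHaar_eq_zero
      volume (f := e ∘ e'.symm) (s := S) (fun a ha ↦ ?_) hSn)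
    · rintro _ ⟨y, ⟨hyC, hye', hye⟩, rfl⟩
      refine ⟨e' y, ⟨eq_zero_of_mem_frontier hC.isCompact hC' hyC hye', e'.map_source hye', ?_⟩, ?_⟩
      · rw [mem_preimage, e'.left_inv hye']
        exact hye
      · rw [Function.comp_apply, e'.left_inv hye']
    · exact ((he'.contDiffAt_change he ha.2.1 ha.2.2).differentiableAt
        (by simp)).differentiableWithinAt
  · refine ⟨(frontier C)ᶜ, isClosed_frontier.isOpen_compl.mem_nhds hxC, ?_⟩
    simp

end Boundary

/-! ### Localization of families by rescaling time -/

section Rescaling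

variable {n m : ℕ} {X Y : Type*}
  [TopologicalSpace X] [ChartedSpace (EBase n) X]
  [TopologicalSpace Y] [ChartedSpace (ETot n m) Y]
  {P : Fibration n m X Y} {Φ : ℝ → X → Y} {L : Jet P → ℝ} {c : FiberedChart P}

/-- The family of sections with the parameter rescaled by a function on the base. -/
def rescale (χ : X → ℝ) (Φ : ℝ → X → Y) (t : ℝ) (x : X) : Y := Φ (χ x * t) x

theorem rescale_zero (χ : X → ℝ) (Φ : ℝ → X → Y) : rescale χ Φ 0 = Φ 0 := by
  funext x
  simp [rescale]

theorem tendsto_rescale {χ : X → ℝ} {x : X} (hχ : ContinuousAt χ x) :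
    Tendsto (fun p : ℝ × X ↦ (χ p.2 * p.1, p.2)) (𝓝 (0, x)) (𝓝 (0, x)) := by
  have h1 : ContinuousAt (fun p : ℝ × X ↦ (χ p.2 * p.1, p.2)) (0, x) :=
    ((ContinuousAt.comp (g := χ) (f := Prod.snd) (x := ((0 : ℝ), x)) hχ continuousAt_snd).mul
      continuousAt_fst).prodMk continuousAt_snd
  simpa [ContinuousAt] using h1

theorem IsSectionFamily.rescale {x : X} (h : IsSectionFamily P Φ (0, x)) {χ : X → ℝ}
    (hχ : ContMDiff (𝓡 (n + 1)) 𝓘(ℝ, ℝ) ∞ χ) : IsSectionFamily P (rescale χ Φ) (0, x) := by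
  filter_upwards [(tendsto_rescale hχ.continuous.continuousAt).eventually h] with p hp
  refine ⟨?_, hp.2⟩
  refine ContMDiffAt.comp p (g := fun q : ℝ × X ↦ Φ q.1 q.2)
    (f := fun p : ℝ × X ↦ (χ p.2 * p.1, p.2)) hp.1 ?_
  have h1 : ContMDiff (𝓘(ℝ, ℝ).prod (𝓡 (n + 1))) 𝓘(ℝ, ℝ) ∞ (fun p : ℝ × X ↦ χ p.2 * p.1) :=
    (hχ.comp contMDiff_snd).mul contMDiff_fst
  exact (h1.prodMk contMDiff_snd).contMDiffAt

theorem FiberedChart.hasDerivAt_repFam {x : X} (h : IsSectionFamily P Φ (0, x))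
    (hc : Φ 0 x ∈ c.total.source) :
    HasDerivAt (fun t ↦ c.repFam Φ (t, c.base x)) (c.velocity Φ (c.base x)) 0 :=
  ((contDiffAt_repFam h hc).2.differentiableAt (by simp)).hasFDerivAt.comp_hasDerivAt (0 : ℝ)
    (f := fun t ↦ (t, c.base x)) ((hasDerivAt_id (0 : ℝ)).prodMk (hasDerivAt_const _ (c.base x)))

/-- The chain rule. Rescaling time pointwise multiplies the velocity by `χ` and still gives
sections, so a partition of unity can localize an arbitrary family without constructing new flows.
-/
theorem FiberedChart.velocity_rescale {x : X} (h : IsSectionFamily P Φ (0, x))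
    (hc : Φ 0 x ∈ c.total.source) {χ : X → ℝ} (hχ : ContMDiff (𝓡 (n + 1)) 𝓘(ℝ, ℝ) ∞ χ) :
    c.velocity (ClassicalField.rescale χ Φ) (c.base x) = χ x • c.velocity Φ (c.base x) := by
  have hx := (contDiffAt_repFam h hc).1
  have h1 := hasDerivAt_repFam (h.rescale hχ) (by rw [rescale_zero]; exact hc)
  have h2 : HasDerivAt (fun t ↦ χ x * t) (χ x) (0 : ℝ) := by
    simpa using (hasDerivAt_id (0 : ℝ)).const_mul (χ x)
  have h3 : HasDerivAt (fun t ↦ c.repFam Φ (t, c.base x)) (c.velocity Φ (c.base x)) (χ x * 0) := by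
    rw [mul_zero]
    exact hasDerivAt_repFam h hc
  refine h1.unique ((h3.scomp (0 : ℝ) h2).congr_of_eventuallyEq (Eventually.of_forall fun t ↦ ?_))
  simp [repFam, rep, ClassicalField.rescale, c.base.left_inv hx]

/-- Additivity of the first variation of the Lagrangian in the velocity. -/
theorem varLag_eq_sum_rescale {ι : Type*} [Fintype ι] (hL : ContMDiff 𝓘(ℝ, EJet n m) 𝓘(ℝ, ℝ) ∞ L)
    {x : X} (h : IsSectionFamily P Φ (0, x)) {χ : ι → X → ℝ}
    (hχ : ∀ i, ContMDiff (𝓡 (n + 1)) 𝓘(ℝ, ℝ) ∞ (χ i)) (hsum : ∀ x, ∑ i, χ i x = 1) :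
    varLag L Φ (0, x) = ∑ i, varLag L (rescale (χ i) Φ) (0, x) := by
  obtain ⟨c, hc⟩ := P.exists_fiberedChart (Φ 0 x)
  have hc' : ∀ i, rescale (χ i) Φ 0 x ∈ c.total.source := fun i ↦ by
    rw [rescale_zero]
    exact hc
  set z₀ := P.jet1 (Φ 0) x with hz₀
  have hx := (FiberedChart.contDiffAt_repFam h hc).1
  have hev' : ∀ᶠ x' in 𝓝 x, IsSectionFamily P Φ (0, x') ∧ Φ 0 x' ∈ c.total.source :=
    ((Continuous.prodMk_right (0 : ℝ)).tendsto x).eventually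
      (h.eventually.and (FiberedChart.eventually_mem_total h hc))
  -- Since the `χ i` sum to 1, the rescaled velocities add up to the original one near the point;
  -- `varLag` is linear in the 1-jet of the velocity.
  have hv : c.velocity Φ =ᶠ[𝓝 (c.base x)] fun a ↦ ∑ i, c.velocity (rescale (χ i) Φ) a := by
    filter_upwards [c.eventually_base hx hev'] with a ha
    have h1 := fun i ↦ FiberedChart.velocity_rescale ha.1.1 ha.1.2 (hχ i)
    simp only [c.base.right_inv ha.2] at h1
    simp only [h1, ← Finset.sum_smul, hsum, one_smul]
  have hd : ∀ i, HasFDerivAt (c.velocity (rescale (χ i) Φ)) _ (c.base x) := fun i ↦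
    ((FiberedChart.contDiffAt_velocity (h.rescale (hχ i)) (hc' i)).differentiableAt
      (by simp)).hasFDerivAt
  rw [FiberedChart.varLag_eq hL h hc z₀, hv.fderiv_eq, hv.self_of_nhds,
    (HasFDerivAt.fun_sum fun i _ ↦ hd i).fderiv]
  have h2 := fun i ↦ FiberedChart.varLag_eq hL (h.rescale (hχ i)) (hc' i) z₀
  simp only [rescale_zero] at h2
  simp only [h2]
  rw [← map_sum]
  congr 1
  refine Prod.ext (Prod.ext ?_ ?_) ?_
  · simp [Prod.fst_sum]
  · simp [Prod.fst_sum, Prod.snd_sum]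
  · simp [Prod.snd_sum]

end Rescaling

/-! ### The Euler–Lagrange equations annihilate the first variation -/

section Vanishing

variable {n m : ℕ} {X Y : Type*}
  [TopologicalSpace X] [T2Space X] [SecondCountableTopology X]
  [ChartedSpace (EBase n) X] [IsManifold (𝓡 (n + 1)) ∞ X] [MeasurableSpace X] [BorelSpace X]
  [TopologicalSpace Y] [ChartedSpace (ETot n m) Y]
  {P : Fibration n m X Y} {Φ : ℝ → X → Y} {η : DiffForm (EBase n) X (n + 1)} {L : Jet P → ℝ}
  {C : Set X}

theorem exists_sign {f : X → ℝ} {x : X} (hf : ContinuousAt f x) (h0 : f x ≠ 0) :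
    ∃ s : ℝ, ∀ᶠ y in 𝓝 x, |f y| = s * f y := by
  rcases h0.lt_or_gt with h | h
  · refine ⟨-1, ?_⟩
    filter_upwards [hf.eventually_lt_const h] with y hy
    rw [abs_of_neg hy]
    ring
  · refine ⟨1, ?_⟩
    filter_upwards [hf.eventually_const_lt h] with y hy
    rw [abs_of_pos hy]
    ring

theorem eventually_stationary_rescale {χ : X → ℝ} {x : X} (hx : x ∉ tsupport χ) :
    ∀ᶠ p in 𝓝 ((0 : ℝ), x), rescale χ Φ p.1 p.2 = rescale χ Φ 0 p.2 := by
  have h1 : ∀ᶠ p in 𝓝 ((0 : ℝ), x), p.2 ∉ tsupport χ :=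
    (continuousAt_snd (p := ((0 : ℝ), x))).preimage_mem_nhds
      ((isClosed_tsupport χ).isOpen_compl.mem_nhds hx)
  filter_upwards [h1] with p hp
  simp [rescale, image_eq_zero_of_notMem_tsupport hp]

/-- Locally, the first variation of the action vanishes if the Euler–Lagrange equations hold. -/
theorem exists_nhds_integral_rescale_eq_zero (hη : IsVolumeForm η)
    (hL : ContMDiff 𝓘(ℝ, EJet n m) 𝓘(ℝ, ℝ) ∞ L) (hC : IsCompactDomain n C)
    (hfam : ∀ x ∈ C, IsSectionFamily P Φ (0, x))
    (hfr : ∀ x ∈ frontier C, ∀ᶠ t in 𝓝 (0 : ℝ), Φ t x = Φ 0 x)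
    (hEL : ∀ x ∈ C, ∀ (c : FiberedChart P) (z₀ : Jet P), Φ 0 x ∈ c.total.source →
      c.EL η L z₀ (Φ 0) (c.base x) = 0) {x : X} (hx : x ∈ C) :
    ∃ N : Set X, IsOpen N ∧ x ∈ N ∧ ∀ χ : X → ℝ, ContMDiff (𝓡 (n + 1)) 𝓘(ℝ, ℝ) ∞ χ →
      tsupport χ ⊆ N → ∫ x in C, varLag L (rescale χ Φ) (0, x) ∂volumeMeasure η = 0 := by
  have : LocallyCompactSpace X := ChartedSpace.locallyCompactSpace (EBase n) X
  obtain ⟨c, hc⟩ := P.exists_fiberedChart (Φ 0 x)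
  have h := hfam x hx
  have hxb := (FiberedChart.contDiffAt_repFam h hc).1
  obtain ⟨s, hs⟩ := exists_sign (f := fun y ↦ chartDensity η c.base (c.base y)) (x := x)
    (ContinuousAt.comp (contDiffAt_chartDensity c.isSmoothChart_base hη
      (c.base.map_source hxb)).continuousAt (c.base.continuousAt hxb))
    (chartDensity_ne_zero c.isSmoothChart_base hη (c.base.map_source hxb))
  obtain ⟨N₀, hN₀, hnull⟩ := eventually_null_frontier hC c.isSmoothChart_base hxb
  obtain ⟨K₀, hK₀, hxK₀⟩ := exists_compact_mem_nhds x
  have hev : ∀ᶠ x' in 𝓝 x, IsSectionFamily P Φ (0, x') ∧ Φ 0 x' ∈ c.total.source :=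
    ((Continuous.prodMk_right (0 : ℝ)).tendsto x).eventually
      (h.eventually.and (FiberedChart.eventually_mem_total h hc))
  -- `N` is so small that the family stays in the chart, the density has constant sign, `∂C` is null
  -- in coordinates, and closed subsets of `X` contained in `N` are compact, lying in `K₀`.
  obtain ⟨N, hN, hNo, hxN⟩ := mem_nhds_iff.1 ((hev.and hs).and
    ((eventually_mem_set.2 hN₀).and (eventually_mem_set.2 hxK₀)))
  refine ⟨N, hNo, hxN, fun χ hχ hsupp ↦ ?_⟩
  rw [integral_varLag_eq hη hL hC.isCompact (fun y hy ↦ (hfam y hy).rescale hχ) c (P.jet1 (Φ 0) x)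
    hNo (hK₀.of_isClosed_subset (isClosed_tsupport χ) (hsupp.trans fun y hy ↦ (hN hy).2.2)) hsupp
    (fun y hy ↦ by rw [rescale_zero]; exact (hN hy).1.1.2)
    (fun y hy ↦ (hN hy).1.1.1.rescale hχ) (fun y hy ↦ eventually_stationary_rescale hy) s
    (fun y hy ↦ (hN hy).1.2) ?_
    (measure_mono_null (image_mono (inter_subset_inter_right _ fun y hy ↦ (hN hy).2.1)) hnull)]
  · rw [setIntegral_eq_zero_of_forall_eq_zero, mul_zero]
    rintro _ ⟨y, hy, rfl⟩
    rw [rescale_zero, hEL y hy.1 c _ (hN hy.2).1.1.2]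
    rfl
  · intro y hy
    have h1 : Tendsto (fun t : ℝ ↦ χ y * t) (𝓝 0) (𝓝 0) := by
      simpa using (continuous_const_mul (χ y)).tendsto 0
    filter_upwards [h1.eventually (hfr y hy.1)] with t ht
    rw [rescale_zero]
    exact ht

/-- The first variation of the action vanishes if the Euler–Lagrange equations hold. -/
theorem integral_varLag_eq_zero (hη : IsVolumeForm η)
    (hL : ContMDiff 𝓘(ℝ, EJet n m) 𝓘(ℝ, ℝ) ∞ L) (hC : IsCompactDomain n C)
    (hfam : ∀ x ∈ C, IsSectionFamily P Φ (0, x))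
    (hfr : ∀ x ∈ frontier C, ∀ᶠ t in 𝓝 (0 : ℝ), Φ t x = Φ 0 x)
    (hEL : ∀ x ∈ C, ∀ (c : FiberedChart P) (z₀ : Jet P), Φ 0 x ∈ c.total.source →
      c.EL η L z₀ (Φ 0) (c.base x) = 0) :
    ∫ x in C, varLag L Φ (0, x) ∂volumeMeasure η = 0 := by
  have := isLocallyFiniteMeasure_volumeMeasure hη
  have : LocallyCompactSpace X := ChartedSpace.locallyCompactSpace (EBase n) X
  choose N hNo hxN hN using fun (x : X) (hx : x ∈ C) ↦
    exists_nhds_integral_rescale_eq_zero hη hL hC hfam hfr hEL hx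
  obtain ⟨s, hs⟩ := hC.isCompact.elim_nhds_subcover' N
    (fun x hx ↦ (hNo x hx).mem_nhds (hxN x hx))
  -- The index `none` stands for the complement of `C`. Its function vanishes near every point of
  -- `C`, so the corresponding family is stationary there; the other indices form the finite
  -- subcover.
  let W : Option s → Set X := fun i ↦ i.elim Cᶜ fun x ↦ N x.1 x.1.2
  obtain ⟨f, hf⟩ := SmoothPartitionOfUnity.exists_isSubordinate (𝓡 (n + 1)) isClosed_univ W
    (by
      rintro (_ | x)
      · exact hC.isCompact.isClosed.isOpen_compl
      · exact hNo _ _)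
    (by
      intro x _
      by_cases hx : x ∈ C
      · obtain ⟨y, hy, hxy⟩ := mem_iUnion₂.1 (hs hx)
        exact mem_iUnion.2 ⟨some ⟨y, hy⟩, hxy⟩
      · exact mem_iUnion.2 ⟨none, hx⟩)
  have hsum : ∀ x, ∑ i, f i x = 1 := fun x ↦ by
    rw [← finsum_eq_sum_of_fintype]
    exact f.sum_eq_one (mem_univ x)
  have hfd : ∀ i, ContMDiff (𝓡 (n + 1)) 𝓘(ℝ, ℝ) ∞ (f i) := fun i ↦ (f i).contMDiff
  rw [setIntegral_congr_fun hC.isCompact.measurableSet fun x hx ↦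
    varLag_eq_sum_rescale (χ := fun i ↦ f i) hL (hfam x hx) hfd hsum, integral_finsetSum]
  · refine Finset.sum_eq_zero fun i _ ↦ ?_
    rcases i with _ | x
    · refine setIntegral_eq_zero_of_forall_eq_zero fun x hx ↦
        varLag_eq_zero hL ((hfam x hx).rescale (hfd none))
          (eventually_stationary_rescale fun hx' ↦ hf none hx' hx)
    · exact hN x.1 x.1.2 _ (hfd (some x)) (hf (some x))
  · intro i _
    refine ContinuousOn.integrableOn_compact hC.isCompact ?_
    exact fun x hx ↦ (ContinuousAt.comp (f := fun x ↦ ((0 : ℝ), x)) (x := x)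
      (((hfam x hx).rescale (hfd i)).continuousAt_varLag hL)
      (Continuous.prodMk_right (0 : ℝ)).continuousAt).continuousWithinAt

end Vanishing

/-! ### Uniqueness properties of local flows -/

section Flows

variable {E : Type*} [NormedAddCommGroup E] [NormedSpace ℝ E] [CompleteSpace E]
  {M : Type*} [TopologicalSpace M] [ChartedSpace E M] [IsManifold 𝓘(ℝ, E) ∞ M] [T2Space M]
  {ξ : (x : M) → TangentSpace 𝓘(ℝ, E) x} {Φ : ℝ → M → M} {ε : ℝ} {U : Set M}

theorem SmoothField.integralCurve_unique (hξ : SmoothField ξ) {a b : ℝ} (h0 : (0 : ℝ) ∈ Ioo a b)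
    {γ γ' : ℝ → M} (hγ : IsMIntegralCurveOn γ ξ (Ioo a b)) (hγ' : IsMIntegralCurveOn γ' ξ (Ioo a b))
    (h : γ 0 = γ' 0) : EqOn γ γ' (Ioo a b) :=
  isMIntegralCurveOn_Ioo_eqOn_of_contMDiff_boundaryless h0
    (ContMDiff.of_le hξ (by simp)) hγ hγ' h

namespace IsLocalFlow

theorem zero_mem (h : IsLocalFlow ξ Φ ε U) : (0 : ℝ) ∈ Ioo (-ε) ε :=
  ⟨neg_lt_zero.2 h.pos, h.pos⟩

theorem isOpen_domain (h : IsLocalFlow ξ Φ ε U) : IsOpen (Ioo (-ε) ε ×ˢ U) :=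
  isOpen_Ioo.prod h.isOpen

theorem contMDiffAt (h : IsLocalFlow ξ Φ ε U) {p : ℝ × M} (hp : p ∈ Ioo (-ε) ε ×ˢ U) :
    ContMDiffAt (𝓘(ℝ, ℝ).prod 𝓘(ℝ, E)) 𝓘(ℝ, E) ∞ (fun p : ℝ × M ↦ Φ p.1 p.2) p :=
  h.smooth.contMDiffAt (h.isOpen_domain.mem_nhds hp)

theorem stationary (h : IsLocalFlow ξ Φ ε U) (hξ : SmoothField ξ) {x : M} (hx : x ∈ U)
    (h0 : ξ x = 0) {t : ℝ} (ht : t ∈ Ioo (-ε) ε) : Φ t x = x :=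
  hξ.integralCurve_unique h.zero_mem (h.integralCurve x hx)
    ((isMIntegralCurve_const h0).isMIntegralCurveOn _) (h.zero x hx) ht

/-- The curves `s ↦ Φ s (Φ (-t) x)` and `s ↦ Φ (s - t) x` are integral curves with the same value at
`0`. Halving the interval keeps `s - t` in `(-ε, ε)`, so they can be compared at `s = t`. -/
theorem comp_neg (h : IsLocalFlow ξ Φ ε U) (hξ : SmoothField ξ) {x : M} (hx : x ∈ U) {t : ℝ}
    (ht : t ∈ Ioo (-(ε / 2)) (ε / 2)) (hx' : Φ (-t) x ∈ U) : Φ t (Φ (-t) x) = x := by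
  have hε := h.pos
  have h1 : IsMIntegralCurveOn (fun s ↦ Φ s (Φ (-t) x)) ξ (Ioo (-(ε / 2)) (ε / 2)) :=
    (h.integralCurve _ hx').mono (Ioo_subset_Ioo (by linarith) (by linarith))
  have h2 : IsMIntegralCurveOn ((fun s ↦ Φ s x) ∘ (· + (-t))) ξ (Ioo (-(ε / 2)) (ε / 2)) :=
    ((h.integralCurve x hx).comp_add (-t)).mono fun s hs ↦ by
      refine ⟨?_, ?_⟩ <;> linarith [hs.1, hs.2, ht.1, ht.2]
  have h3 := hξ.integralCurve_unique ⟨by linarith, by linarith⟩ h1 h2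
    (by simp [h.zero _ hx']) ht
  simpa [h.zero x hx] using h3

end IsLocalFlow

end Flows

/-! ### Variations of sections by flows of projectable fields -/

section FlowVariation

variable {n m : ℕ} {X Y : Type*}
  [TopologicalSpace X] [T2Space X] [ChartedSpace (EBase n) X] [IsManifold (𝓡 (n + 1)) ∞ X]
  [TopologicalSpace Y] [T2Space Y] [ChartedSpace (ETot n m) Y] [IsManifold (𝓡 (n + 1 + m)) ∞ Y]
  {P : Fibration n m X Y} {φ : X → Y}
  {ξY : (y : Y) → TangentSpace (𝓡 (n + 1 + m)) y} {ξX : (x : X) → TangentSpace (𝓡 (n + 1)) x}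
  {ΦY : ℝ → Y → Y} {ΦX : ℝ → X → X} {ε : ℝ} {V : Set Y} {U : Set X}

/-- Projectability makes the projection of an integral curve of `ξY` an integral curve of `ξX`, and
uniqueness identifies it. -/
theorem proj_flow (hξX : SmoothField ξX) (hproj : ∀ y, P.dproj y (ξY y) = ξX (P.proj y))
    (hY : IsLocalFlow ξY ΦY ε V) (hX : IsLocalFlow ξX ΦX ε U) {y : Y} (hy : y ∈ V)
    (hyU : P.proj y ∈ U) {t : ℝ} (ht : t ∈ Ioo (-ε) ε) : P.proj (ΦY t y) = ΦX t (P.proj y) := by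
  refine hξX.integralCurve_unique hX.zero_mem (γ := fun t ↦ P.proj (ΦY t y)) (fun s hs ↦ ?_)
    (hX.integralCurve _ hyU) (by simp [hY.zero y hy, hX.zero _ hyU]) ht
  have h1 := hY.integralCurve y hy s hs
  have h2 : HasMFDerivAt (𝓡 (n + 1 + m)) (𝓡 (n + 1)) P.proj (ΦY s y)
      (mfderiv (𝓡 (n + 1 + m)) (𝓡 (n + 1)) P.proj (ΦY s y)) :=
    ((P.contMDiff _).mdifferentiableAt (by simp)).hasMFDerivAt
  have h3 := h2.comp_hasMFDerivWithinAt s h1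
  have h4 : (mfderiv (𝓡 (n + 1 + m)) (𝓡 (n + 1)) P.proj (ΦY s y) : ETot n m →L[ℝ] EBase n).comp
      ((1 : ℝ →L[ℝ] ℝ).smulRight (ξY (ΦY s y) : ETot n m))
      = (1 : ℝ →L[ℝ] ℝ).smulRight (ξX (P.proj (ΦY s y)) : EBase n) := by
    ext1
    change P.dproj (ΦY s y) ((1 : ℝ) • (ξY (ΦY s y) : ETot n m))
      = (1 : ℝ) • (ξX (P.proj (ΦY s y)) : EBase n)
    rw [one_smul, one_smul]
    exact hproj _
  rw [← h4]
  exact h3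

/-- The variation of a section by the flow of a projectable vector field. -/
theorem isSectionFamily_flow (hφ : P.IsSection φ) (hξX : SmoothField ξX)
    (hproj : ∀ y, P.dproj y (ξY y) = ξX (P.proj y))
    (hY : IsLocalFlow ξY ΦY ε V) (hX : IsLocalFlow ξX ΦX ε U) {x : X} (hx : x ∈ U)
    (hxV : φ x ∈ V) : IsSectionFamily P (fun t x ↦ ΦY t (φ (ΦX (-t) x))) (0, x) := by
  have hε := hX.pos
  have hneg : ContMDiff (𝓘(ℝ, ℝ).prod (𝓡 (n + 1))) (𝓘(ℝ, ℝ).prod (𝓡 (n + 1))) ∞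
      (fun p : ℝ × X ↦ (-p.1, p.2)) :=
    (contDiff_neg.contMDiff.comp contMDiff_fst).prodMk contMDiff_snd
  have hdX : ∀ p : ℝ × X, (-p.1, p.2) ∈ Ioo (-ε) ε ×ˢ U → ContMDiffAt (𝓘(ℝ, ℝ).prod (𝓡 (n + 1)))
      (𝓡 (n + 1)) ∞ (fun p : ℝ × X ↦ ΦX (-p.1) p.2) p := fun p hp ↦
    ContMDiffAt.comp p (g := fun p : ℝ × X ↦ ΦX p.1 p.2) (hX.contMDiffAt hp) hneg.contMDiffAt
  have hmem : (-(0 : ℝ), x) ∈ Ioo (-ε) ε ×ˢ U := by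
    rw [neg_zero]
    exact ⟨hX.zero_mem, hx⟩
  have hcX := (hdX (0, x) hmem).continuousAt
  have h0 : ΦX (-(0 : ℝ)) x = x := by rw [neg_zero, hX.zero x hx]
  have ev1 : ∀ᶠ p in 𝓝 ((0 : ℝ), x), ΦX (-p.1) p.2 ∈ U ∩ φ ⁻¹' V := by
    refine hcX.preimage_mem_nhds ((hX.isOpen.inter
      (hY.isOpen.preimage hφ.smooth.continuous)).mem_nhds ?_)
    rw [h0]
    exact ⟨hx, hxV⟩
  have ev2 : ∀ᶠ p in 𝓝 ((0 : ℝ), x), p ∈ Ioo (-(ε / 2)) (ε / 2) ×ˢ U :=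
    (isOpen_Ioo.prod hX.isOpen).mem_nhds ⟨⟨by linarith, by linarith⟩, hx⟩
  filter_upwards [ev1, ev2] with p h1 h2
  have ht : p.1 ∈ Ioo (-ε) ε := Ioo_subset_Ioo (by linarith) (by linarith) h2.1
  refine ⟨?_, ?_⟩
  · have d1 : ContMDiffAt (𝓘(ℝ, ℝ).prod (𝓡 (n + 1))) (𝓘(ℝ, ℝ).prod (𝓡 (n + 1 + m))) ∞
        (fun p : ℝ × X ↦ (p.1, φ (ΦX (-p.1) p.2))) p := by
      refine contMDiffAt_fst.prodMk (ContMDiffAt.comp p (g := φ) hφ.smooth.contMDiffAt (hdX p ?_))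
      exact ⟨⟨by linarith [ht.2], by linarith [ht.1]⟩, h2.2⟩
    exact ContMDiffAt.comp p (g := fun p : ℝ × Y ↦ ΦY p.1 p.2)
      (f := fun p : ℝ × X ↦ (p.1, φ (ΦX (-p.1) p.2))) (hY.contMDiffAt ⟨ht, h1.2⟩) d1
  · have h3 : P.proj (φ (ΦX (-p.1) p.2)) = ΦX (-p.1) p.2 := hφ.proj_apply _
    rw [proj_flow hξX hproj hY hX h1.2 (by rw [h3]; exact h1.1) ht, h3]
    exact hX.comp_neg hξX h2.2 h2.1 h1.1

/-- If `ξY` vanishes at `φ x`, so does its projection `ξX` at `x`; hence neither flow moves the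
point. -/
theorem flow_stationary (hφ : P.IsSection φ) (hξY : SmoothField ξY) (hξX : SmoothField ξX)
    (hproj : ∀ y, P.dproj y (ξY y) = ξX (P.proj y))
    (hY : IsLocalFlow ξY ΦY ε V) (hX : IsLocalFlow ξX ΦX ε U) {x : X} (hx : x ∈ U)
    (hxV : φ x ∈ V) (h0 : ξY (φ x) = 0) {t : ℝ} (ht : t ∈ Ioo (-ε) ε) :
    ΦY t (φ (ΦX (-t) x)) = φ x := by
  have h1 : ξX x = 0 := by
    have h2 := hproj (φ x)
    rw [h0, hφ.proj_apply] at h2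
    exact h2.symm.trans (map_zero _)
  rw [hX.stationary hξX hx h1 ⟨by linarith [ht.2], by linarith [ht.1]⟩]
  exact hY.stationary hξY hxV h0 ht

theorem IsSectionNear.jet1_congr {ψ ψ' : X → Y} {x : X} (h : IsSectionNear P ψ x)
    (h' : IsSectionNear P ψ' x) (he : ψ =ᶠ[𝓝 x] ψ') : P.jet1 ψ x = P.jet1 ψ' x := by
  obtain ⟨h1, h2⟩ := jet1_eq (P := P) (h.self_of_nhds.1.mdifferentiableAt (by simp))
    (h.mono fun _ h ↦ h.2)
  obtain ⟨h3, h4⟩ := jet1_eq (P := P) (h'.self_of_nhds.1.mdifferentiableAt (by simp))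
    (h'.mono fun _ h ↦ h.2)
  refine Jet.ext ?_ ?_
  · rw [h1, h3, he.self_of_nhds]
  · rw [h2, h4, tder_congr he]

end FlowVariation

/-! ### The equation for `Ω_L` implies extremality -/

section Sufficiency

variable {n m : ℕ} {X Y : Type*}
  [TopologicalSpace X] [T2Space X] [SecondCountableTopology X]
  [ChartedSpace (EBase n) X] [IsManifold (𝓡 (n + 1)) ∞ X] [MeasurableSpace X] [BorelSpace X]
  [TopologicalSpace Y] [T2Space Y] [ChartedSpace (ETot n m) Y] [IsManifold (𝓡 (n + 1 + m)) ∞ Y]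
  {P : Fibration n m X Y} {η : DiffForm (EBase n) X (n + 1)} {L : Jet P → ℝ} {φ : X → Y}

/-- The flows generate a family of sections, stationary on `∂C` because `ξY` vanishes on `φ(∂C)`.
The derivative of the action is the integral of `varLag`, which is zero by the Euler–Lagrange
equations extracted from the hypothesis. -/
theorem isExtremal_of_pullback (hη : IsVolumeForm η) (hL : ContMDiff 𝓘(ℝ, EJet n m) 𝓘(ℝ, ℝ) ∞ L)
    (hφ : P.IsSection φ)
    (h : ∀ ξ : (z : Jet P) → TangentSpace 𝓘(ℝ, EJet n m) z, SmoothField ξ →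
      pullback (P.jet1 φ) (interiorProduct ξ (poincareCartanTwo η L))
        = (0 : DiffForm (EBase n) X (n + 1))) : IsExtremal η L φ := by
  intro C hC ξY ξX hξY hξX hproj hfr ΦY ΦX ε V U hY hX hCU hCV
  have hfam : ∀ x ∈ C, IsSectionFamily P (fun t x ↦ ΦY t (φ (ΦX (-t) x))) (0, x) := fun x hx ↦
    isSectionFamily_flow hφ hξX hproj hY hX (hCU hx) (hCV (mem_image_of_mem _ hx))
  have hzero : ∀ x ∈ U, φ x ∈ V → ΦY 0 (φ (ΦX (-0) x)) = φ x := fun x hx hxV ↦ by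
    rw [neg_zero, hX.zero x hx, hY.zero _ hxV]
  have hd := hasDerivAt_action hη hL hC.isCompact hfam
  rw [integral_varLag_eq_zero hη hL hC hfam ?_ ?_] at hd
  · exact hd
  · intro x hx
    have hxC := hC.isCompact.isClosed.frontier_subset hx
    have hxV := hCV (mem_image_of_mem _ hxC)
    filter_upwards [isOpen_Ioo.mem_nhds hX.zero_mem] with t ht
    rw [flow_stationary hφ hξY hξX hproj hY hX (hCU hxC) hxV (hfr x hx) ht,
      hzero x (hCU hxC) hxV]
  · intro x hx c z₀ hc
    have hsec : IsSectionNear P (fun x ↦ ΦY 0 (φ (ΦX (-0) x))) x := (hfam x hx).isSectionNear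
    refine EL_eq_zero_of_pullback hη hL hsec c hc z₀ fun ξ hξ ↦ ?_
    -- The flows are controlled only on `U` and `V`, so the time-zero member is identified with `φ`
    -- only near points of `C`; this suffices for 1-jets.
    have he : (fun x ↦ ΦY 0 (φ (ΦX (-0) x))) =ᶠ[𝓝 x] φ := by
      filter_upwards [hX.isOpen.mem_nhds (hCU hx),
        (hY.isOpen.preimage hφ.smooth.continuous).mem_nhds (hCV (mem_image_of_mem _ hx))]
        with y hy hyV using hzero y hy hyV
    rw [pullback_congr (g := P.jet1 φ), h ξ hξ]
    · rfl
    · filter_upwards [hsec.eventually, eventually_eventually_nhds.2 he] with y h1 h2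
      exact h1.jet1_congr (hφ.isSectionNear y) h2

end Sufficiency

/-! ### Closed coordinate balls are compact domains -/

section BoundaryCharts

variable {n : ℕ}

/-- A smooth map with invertible differential at `a` restricts to a diffeomorphism around `a`. -/
theorem exists_smoothChart_of_equiv {E : Type*} [NormedAddCommGroup E] [NormedSpace ℝ E]
    [CompleteSpace E] {F : E → E} (hF : ContDiff ℝ ∞ F) {a : E} (A : E ≃L[ℝ] E)
    (hA : fderiv ℝ F a = A) :
    ∃ f : OpenPartialHomeomorph E E, a ∈ f.source ∧ (∀ y, f y = F y) ∧
      ContDiffOn ℝ ∞ f.symm f.target := by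
  have hd : ∀ y, HasFDerivAt F (fderiv ℝ F y) y := fun y ↦
    (hF.contDiffAt.differentiableAt (by simp)).hasFDerivAt
  have hda : HasFDerivAt F (A : E →L[ℝ] E) a := by
    rw [← hA]
    exact hd a
  set f₀ := hF.contDiffAt.toOpenPartialHomeomorph F hda (by simp) with hf₀
  -- The local inverse is known to be smooth only where the differential is invertible; restricting
  -- to this open set makes it smooth on the whole target.
  set O : Set E := fderiv ℝ F ⁻¹' range ((↑) : (E ≃L[ℝ] E) → E →L[ℝ] E) with hO
  have hOo : IsOpen O := ContinuousLinearEquiv.isOpen.preimage (hF.continuous_fderiv (by simp))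
  refine ⟨f₀.restrOpen O hOo, ⟨hF.contDiffAt.mem_toOpenPartialHomeomorph_source hda (by simp), A,
    hA.symm⟩, fun y ↦ rfl, fun b hb ↦ ?_⟩
  obtain ⟨B, hB⟩ := ((f₀.restrOpen O hOo).map_target hb).2
  refine ((f₀.restrOpen O hOo).contDiffAt_symm (f₀' := B) hb ?_ hF.contDiffAt).contDiffWithinAt
  rw [hB]
  exact hd _

/-- Regular sublevel sets of functions on `ℝ^{n+1}` are half-spaces in suitable coordinates. -/
theorem exists_smoothChart_of_fderiv_ne_zero {h : EBase n → ℝ} (hh : ContDiff ℝ ∞ h) {a u : EBase n}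
    (hu : fderiv ℝ h a u ≠ 0) :
    ∃ f : OpenPartialHomeomorph (EBase n) (EBase n), a ∈ f.source ∧ ContDiff ℝ ∞ f ∧
      ContDiffOn ℝ ∞ f.symm f.target ∧ ∀ y, f y 0 = h y := by
  have hu0 : u ≠ 0 := by
    rintro rfl
    exact hu (map_zero _)
  have he0 : frame n 0 ≠ 0 := fun h0 ↦ by
    have := congrArg (fun v : EBase n ↦ v 0) h0
    simp [frame] at this
  -- `T` carries `u` to `e_0`, and `S` is `T` with its `e_0`-component removed, so the kernel of `S`
  -- is spanned by `u`. The map `F = h e_0 + S` then has first coordinate `h`, and its differential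
  -- at `a` is injective because the derivative of `h` along `u` is nonzero.
  obtain ⟨T, hT⟩ := SeparatingDual.exists_continuousLinearEquiv_apply_eq (R := ℝ) hu0 he0
  set p₀ : EBase n →L[ℝ] ℝ := EuclideanSpace.proj (𝕜 := ℝ) (0 : Fin (n + 1)) with hp₀
  have hpe : p₀ (frame n 0) = 1 := by simp [hp₀, frame]
  set S : EBase n →L[ℝ] EBase n := (T : EBase n →L[ℝ] EBase n) -
    (p₀.comp (T : EBase n →L[ℝ] EBase n)).smulRight (frame n 0) with hS
  have hSv : ∀ v, S v = T v - p₀ (T v) • frame n 0 := fun v ↦ rfl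
  have hpS : ∀ v, p₀ (S v) = 0 := fun v ↦ by
    rw [hSv, map_sub, map_smul, hpe]
    simp
  set F : EBase n → EBase n := fun y ↦ h y • frame n 0 + S y with hF
  have hFd : ContDiff ℝ ∞ F := (hh.smul contDiff_const).add S.contDiff
  have hFa : HasFDerivAt F ((fderiv ℝ h a).smulRight (frame n 0) + S) a :=
    ((hh.contDiffAt.differentiableAt (by simp)).hasFDerivAt.smul_const (frame n 0)).add
      S.hasFDerivAt
  have hinj : Function.Injective ((fderiv ℝ h a).smulRight (frame n 0) + S) := by
    rw [injective_iff_map_eq_zero]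
    intro v hv
    have h1 : fderiv ℝ h a v • frame n 0 + S v = 0 := hv
    have h2 := congrArg p₀ h1
    rw [map_add, map_smul, hpe, hpS, map_zero, add_zero, smul_eq_mul, mul_one] at h2
    rw [h2, zero_smul, zero_add, hSv, sub_eq_zero, ← hT, ← map_smul] at h1
    have h3 := T.injective h1
    rw [h3, map_smul, smul_eq_mul] at h2
    rcases mul_eq_zero.1 h2 with h4 | h4
    · rw [h3, h4, zero_smul]
    · exact absurd h4 hu
  obtain ⟨f, hfa, hfF, hfs⟩ := exists_smoothChart_of_equiv hFd (a := a)
    (LinearEquiv.ofInjectiveEndo (((fderiv ℝ h a).smulRight (frame n 0) + S :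
      EBase n →L[ℝ] EBase n) : EBase n →ₗ[ℝ] EBase n) hinj).toContinuousLinearEquiv (by
        rw [hFa.fderiv]
        ext1 v
        rfl)
  refine ⟨f, hfa, ?_, hfs, fun y ↦ ?_⟩
  · rw [show (f : EBase n → EBase n) = F from funext hfF]
    exact hFd
  · have h1 : p₀ (F y) = h y := by
      simp only [hF, map_add, map_smul, hpe, hpS, add_zero, smul_eq_mul, mul_one]
    rw [hfF, ← h1]
    rfl

variable {X : Type*} [TopologicalSpace X] [T2Space X] [ChartedSpace (EBase n) X]
  [IsManifold (𝓡 (n + 1)) ∞ X]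

/-- Closed coordinate balls. -/
theorem isCompactDomain_closedBall {e : OpenPartialHomeomorph X (EBase n)}
    (he : IsSmoothChart (E := EBase n) e) {a : EBase n} {r : ℝ} (hr : 0 < r)
    (hball : Metric.closedBall a r ⊆ e.target) :
    IsCompactDomain n (e.symm '' Metric.closedBall a r) := by
  have hmem : ∀ x ∈ e.source,
      (x ∈ e.symm '' Metric.closedBall a r ↔ e x ∈ Metric.closedBall a r) := by
    intro x hx
    constructor
    · rintro ⟨b, hb, rfl⟩
      rwa [e.right_inv (hball hb)]
    · exact fun h ↦ ⟨e x, h, e.left_inv hx⟩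
  have hcpt : IsCompact (e.symm '' Metric.closedBall a r) :=
    (isCompact_closedBall a r).image_of_continuousOn (e.continuousOn_symm.mono hball)
  refine ⟨hcpt, fun x hx ↦ ?_⟩
  obtain ⟨b, hb, rfl⟩ := hcpt.isClosed.frontier_subset hx
  have hbt := hball hb
  have hbr : dist b a = r := by
    refine le_antisymm hb (not_lt.1 fun hlt ↦ hx.2 (mem_interior_iff_mem_nhds.2 ?_))
    have h1 : ∀ᶠ y in 𝓝 (e.symm b), e y ∈ Metric.ball a r := by
      refine (e.continuousAt (e.map_target hbt)).preimage_mem_nhds (Metric.isOpen_ball.mem_nhds ?_)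
      rw [e.right_inv hbt]
      exact hlt
    filter_upwards [h1, e.open_source.mem_nhds (e.map_target hbt)] with y hy hys
    exact (hmem y hys).2 (Metric.ball_subset_closedBall hy)
  -- Squaring the norm makes the defining function of the ball smooth. On the sphere its derivative
  -- along the radius `b - a` is `-2 r²`.
  set h : EBase n → ℝ := fun y ↦ r ^ 2 - ‖y - a‖ ^ 2 with hh
  have hhd : ContDiff ℝ ∞ h := contDiff_const.sub ((contDiff_id.sub contDiff_const).norm_sq ℝ)
  have hder : HasFDerivAt h (-(2 • innerSL ℝ (b - a))) b := by
    have h1 : HasFDerivAt (fun y : EBase n ↦ y - a) (ContinuousLinearMap.id ℝ (EBase n)) b :=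
      (hasFDerivAt_id b).sub_const a
    have h2 := (h1.norm_sq).const_sub (r ^ 2)
    simpa using h2
  obtain ⟨f, hfb, hfd, hfs, hf0⟩ := exists_smoothChart_of_fderiv_ne_zero hhd (a := b)
    (u := b - a) (by
    rw [hder.fderiv]
    have h1 : inner ℝ (b - a) (b - a) = r ^ 2 := by
      rw [real_inner_self_eq_norm_sq, ← dist_eq_norm, hbr]
    change -((2 : ℕ) • inner ℝ (b - a) (b - a)) ≠ 0
    rw [h1]
    simp [hr.ne'])
  refine ⟨e.trans f, ?_, ?_, ?_⟩
  · refine OpenPartialHomeomorph.mem_maximalAtlas_of_contMDiffOn _ ?_ ?_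
    · refine ContMDiffOn.comp (t := univ) (g := f) hfd.contMDiff.contMDiffOn
        (he.smooth.mono ?_) (fun _ _ ↦ mem_univ _)
      exact fun y hy ↦ hy.1
    · refine ContMDiffOn.comp (t := e.target) (g := e.symm) he.symm_smooth
        ((contMDiffOn_iff_contDiffOn.2 hfs).mono ?_) ?_
      · exact fun y hy ↦ hy.1
      · exact fun y hy ↦ hy.2
  · refine ⟨e.map_target hbt, ?_⟩
    change e (e.symm b) ∈ f.source
    rwa [e.right_inv hbt]
  · intro y hy
    rw [hmem y hy.1]
    change _ ↔ 0 ≤ f (e y) 0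
    rw [hf0, hh, Metric.mem_closedBall, dist_eq_norm, sub_nonneg]
    exact (sq_le_sq₀ (norm_nonneg _) hr.le).symm

end BoundaryCharts

/-! ### Vertical fields with explicit flows -/

section VerticalFields

variable {n m : ℕ} {X Y : Type*}
  [TopologicalSpace X] [ChartedSpace (EBase n) X]
  [TopologicalSpace Y] [ChartedSpace (ETot n m) Y] [IsManifold (𝓡 (n + 1 + m)) ∞ Y]
  {P : Fibration n m X Y} (c : FiberedChart P) (ψ : Y → ℝ) (g : EBase n → ℝ) (v : EFib m)

namespace FiberedChart

/-- The vertical vector field with components `ψ(y) g(x) v` in fibered coordinates. -/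
def vertField (y : Y) : TangentSpace (𝓡 (n + 1 + m)) y :=
  tder (EBase n × EFib m) (ETot n m) c.total.symm (c.total y)
    ((ψ y * g (c.total y).1) • ((0 : EBase n), v))

open Classical in
/-- The flow `(x, y) ↦ (x, y + t g(x) v)` in fibered coordinates. -/
def vertFlow (t : ℝ) (y : Y) : Y :=
  if y ∈ c.total.source then
    c.total.symm (c.total y + t • ((0 : EBase n), g (c.total y).1 • v)) else y

variable {c ψ g v}

theorem smoothField_vertField (hψ : ContMDiff (𝓡 (n + 1 + m)) 𝓘(ℝ, ℝ) ∞ ψ)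
    (hsupp : tsupport ψ ⊆ c.total.source) (hg : ContDiff ℝ ∞ g) :
    SmoothField (c.vertField ψ g v) := by
  refine smoothField_of_chart c.isSmoothChart_total
    (g := fun y ↦ (ψ y * g (c.total y).1) • ((0 : EBase n), v)) ?_ (isClosed_tsupport ψ) hsupp ?_
  · have h1 : ContMDiffOn (𝓡 (n + 1 + m)) 𝓘(ℝ, ℝ) ∞ (fun y ↦ g (c.total y).1) c.total.source :=
      (hg.comp contDiff_fst).contMDiff.comp_contMDiffOn c.total_smooth
    exact (hψ.contMDiffOn.mul h1).smul contMDiffOn_const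
  · intro y hy
    rw [image_eq_zero_of_notMem_tsupport hy, zero_mul, zero_smul]

theorem vertField_eq_zero {y : Y} (h : ψ y * g (c.total y).1 = 0) : c.vertField ψ g v y = 0 := by
  rw [vertField, h, zero_smul]
  exact map_zero _

theorem dproj_vertField (hsupp : tsupport ψ ⊆ c.total.source) (y : Y) :
    P.dproj y (c.vertField ψ g v y) = 0 := by
  by_cases hy : y ∈ c.total.source
  · have h := c.dproj_dTotSymm (c.total.map_source hy)
      ((ψ y * g (c.total y).1) • ((0 : EBase n), v))
    rw [c.total.left_inv hy] at h
    refine h.trans ?_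
    simp
  · rw [vertField_eq_zero]
    · exact map_zero _
    · rw [image_eq_zero_of_notMem_tsupport fun h ↦ hy (hsupp h), zero_mul]

theorem vertFlow_zero (y : Y) : c.vertFlow g v 0 y = y := by
  rw [vertFlow]
  split_ifs with hy
  · rw [zero_smul, add_zero, c.total.left_inv hy]
  · rfl

theorem vertFlow_eq_self {y : Y} (h : y ∈ c.total.source → g (c.total y).1 = 0) (t : ℝ) :
    c.vertFlow g v t y = y := by
  rw [vertFlow]
  split_ifs with hy
  · rw [h hy, zero_smul]
    have h0 : t • ((0 : EBase n), (0 : EFib m)) = 0 := by simp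
    rw [h0, add_zero, c.total.left_inv hy]
  · rfl

/-- `vertFlow` is the flow of the field without the cut-off `ψ`, which is present only to define the
field on all of `Y`. The pairs `(t, y)` whose trajectory point lies in the chart with `ψ = 1` form a
neighbourhood of `{0} × Q`, and the tube lemma extracts a common `ε`. -/
theorem exists_isLocalFlow_vertFlow (hg : ContDiff ℝ ∞ g) {Q : Set Y} (hQ : IsCompact Q)
    (hQs : Q ⊆ c.total.source) (hψ : ∀ᶠ y in 𝓝ˢ Q, ψ y = 1) :
    ∃ (ε : ℝ) (V : Set Y), Q ⊆ V ∧ V ⊆ c.total.source ∧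
      (∀ t ∈ Ioo (-ε) ε, ∀ y ∈ V,
        c.total y + t • ((0 : EBase n), g (c.total y).1 • v) ∈ c.total.target) ∧
      IsLocalFlow (c.vertField ψ g v) (c.vertFlow g v) ε V := by
  set G : ℝ × Y → EBase n × EFib m := fun p ↦
    c.total p.2 + p.1 • ((0 : EBase n), g (c.total p.2).1 • v) with hG
  have hGd : ∀ p : ℝ × Y, p.2 ∈ c.total.source →
      ContMDiffAt (𝓘(ℝ, ℝ).prod (𝓡 (n + 1 + m))) 𝓘(ℝ, EBase n × EFib m) ∞ G p := by
    intro p hp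
    have h1 : ContMDiffAt (𝓘(ℝ, ℝ).prod (𝓡 (n + 1 + m))) 𝓘(ℝ, EBase n × EFib m) ∞
        (fun p : ℝ × Y ↦ c.total p.2) p :=
      ContMDiffAt.comp (g := c.total) (f := Prod.snd) p (c.isSmoothChart_total.contMDiffAt hp)
        contMDiffAt_snd
    have h2 : ContDiff ℝ ∞ (fun q : EBase n × EFib m ↦ ((0 : EBase n), g q.1 • v)) :=
      contDiff_const.prodMk ((hg.comp contDiff_fst).smul contDiff_const)
    exact h1.add (contMDiffAt_fst.smul (h2.contMDiff.contMDiffAt.comp p h1))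
  have hG0 : ∀ y, G (0, y) = c.total y := fun y ↦ by
    simp only [hG, zero_smul, add_zero]
  set O : Set (ℝ × Y) := {p | (p.2 ∈ c.total.source ∧ G p ∈ c.total.target) ∧
    ψ (c.total.symm (G p)) = 1} with hO
  have hOn : ∀ y ∈ Q, O ∈ 𝓝 ((0 : ℝ), y) := by
    intro y hy
    have hys := hQs hy
    have hc := (hGd (0, y) hys).continuousAt
    have hmem : G (0, y) ∈ c.total.target := by
      rw [hG0]
      exact c.total.map_source hys
    have e1 : ∀ᶠ p : ℝ × Y in 𝓝 ((0 : ℝ), y), p.2 ∈ c.total.source :=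
      (continuousAt_snd (p := ((0 : ℝ), y))).preimage_mem_nhds (c.total.open_source.mem_nhds hys)
    have e2 : ∀ᶠ p in 𝓝 ((0 : ℝ), y), G p ∈ c.total.target :=
      hc.preimage_mem_nhds (c.total.open_target.mem_nhds hmem)
    have e3 : ∀ᶠ p in 𝓝 ((0 : ℝ), y), ψ (c.total.symm (G p)) = 1 := by
      have h1 : ContinuousAt (fun p ↦ c.total.symm (G p)) ((0 : ℝ), y) :=
        ContinuousAt.comp (c.total.continuousAt_symm hmem) hc
      refine h1.eventually (p := fun z ↦ ψ z = 1) ?_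
      beta_reduce
      rw [hG0, c.total.left_inv hys]
      exact mem_nhdsSet_iff_forall.1 hψ y hy
    exact (e1.and e2).and e3
  obtain ⟨u, V, hu, hV, h0u, hQV, huV⟩ := generalized_tube_lemma
    (isCompact_singleton (x := (0 : ℝ))) hQ (isOpen_interior (s := O)) (by
      rintro ⟨t, y⟩ ⟨ht, hy⟩
      obtain rfl : t = 0 := ht
      exact mem_interior_iff_mem_nhds.2 (hOn y hy))
  obtain ⟨ε, hε, hεu⟩ := Metric.mem_nhds_iff.1 (hu.mem_nhds (h0u rfl))
  rw [Real.ball_eq_Ioo, zero_sub, zero_add] at hεu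
  have hmain : ∀ t ∈ Ioo (-ε) ε, ∀ y ∈ V, (t, y) ∈ O := fun t ht y hy ↦
    interior_subset (huV ⟨hεu ht, hy⟩)
  have h0 : (0 : ℝ) ∈ Ioo (-ε) ε := ⟨neg_lt_zero.2 hε, hε⟩
  have hVs : V ⊆ c.total.source := fun y hy ↦ (hmain 0 h0 y hy).1.1
  have hflow : ∀ p : ℝ × Y, p.2 ∈ c.total.source →
      c.vertFlow g v p.1 p.2 = c.total.symm (G p) := fun p hp ↦ if_pos hp
  refine ⟨ε, V, hQV, hVs, fun t ht y hy ↦ (hmain t ht y hy).1.2, hε, hV, ?_,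
    fun y _ ↦ vertFlow_zero y, fun y hy ↦ ?_⟩
  · refine ContMDiffOn.congr (f := fun p ↦ c.total.symm (G p)) (fun p hp ↦ ?_)
      fun p hp ↦ hflow p (hVs hp.2)
    have hpO := hmain p.1 hp.1 p.2 hp.2
    exact (ContMDiffAt.comp (g := c.total.symm) (f := G) p
      (c.isSmoothChart_total.contMDiffAt_symm hpO.1.2) (hGd p hpO.1.1)).contMDiffWithinAt
  · intro t ht
    have hO := hmain t ht y hy
    set w : EBase n × EFib m := ((0 : EBase n), g (c.total y).1 • v) with hw
    have heq : (fun t ↦ c.vertFlow g v t y) = fun t ↦ c.total.symm (c.total y + t • w) :=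
      funext fun t ↦ hflow (t, y) hO.1.1
    have h1 : HasFDerivAt (fun t : ℝ ↦ c.total y + t • w) ((1 : ℝ →L[ℝ] ℝ).smulRight w) t := by
      exact ((hasFDerivAt_id (𝕜 := ℝ) t).smul_const w).const_add (c.total y)
    have h2 : HasMFDerivAt 𝓘(ℝ, EBase n × EFib m) (𝓡 (n + 1 + m)) c.total.symm
        (c.total y + t • w) (mfderiv 𝓘(ℝ, EBase n × EFib m) (𝓡 (n + 1 + m)) c.total.symm
          (c.total y + t • w)) :=
      (c.isSmoothChart_total.mdiffAt_symm hO.1.2).hasMFDerivAt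
    have h3 := (HasMFDerivAt.comp t h2 h1.hasMFDerivAt).hasMFDerivWithinAt (s := Ioo (-ε) ε)
    have hfl : c.vertFlow g v t y = c.total.symm (c.total y + t • w) := hflow (t, y) hO.1.1
    have htot : c.total (c.vertFlow g v t y) = c.total y + t • w := by
      rw [hfl]
      exact c.total.right_inv hO.1.2
    have hψ1 : ψ (c.vertFlow g v t y) = 1 := by
      rw [hfl]
      exact hO.2
    -- The flow does not move the base coordinate, so the coefficient `g` is constant along
    -- trajectories, which are therefore straight lines in the chart.
    have hfst : (c.total y + t • w).1 = (c.total y).1 := by simp [hw]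
    have h4 : (tder (EBase n × EFib m) (ETot n m) c.total.symm (c.total y + t • w)).comp
        ((1 : ℝ →L[ℝ] ℝ).smulRight w)
        = (1 : ℝ →L[ℝ] ℝ).smulRight (c.vertField ψ g v (c.vertFlow g v t y) : ETot n m) := by
      ext1
      change tder (EBase n × EFib m) (ETot n m) c.total.symm (c.total y + t • w) ((1 : ℝ) • w)
        = (1 : ℝ) • (c.vertField ψ g v (c.vertFlow g v t y) : ETot n m)
      rw [one_smul, one_smul, vertField, htot, hψ1, one_mul, hfst, hw]
      simp
    change HasMFDerivWithinAt _ _ _ _ t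
      ((1 : ℝ →L[ℝ] ℝ).smulRight (c.vertField ψ g v (c.vertFlow g v t y) : ETot n m))
    rw [← h4, heq]
    exact h3

end FiberedChart

end VerticalFields

theorem smoothField_zero {E : Type*} [NormedAddCommGroup E] [NormedSpace ℝ E]
    {M : Type*} [TopologicalSpace M] [ChartedSpace E M] [IsManifold 𝓘(ℝ, E) ∞ M] :
    SmoothField (fun x : M ↦ (0 : TangentSpace 𝓘(ℝ, E) x)) :=
  Bundle.contMDiff_zeroSection ℝ (TangentSpace 𝓘(ℝ, E) : M → Type _)

theorem isLocalFlow_zero {E : Type*} [NormedAddCommGroup E] [NormedSpace ℝ E]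
    {M : Type*} [TopologicalSpace M] [ChartedSpace E M] {ε : ℝ} (hε : 0 < ε) :
    IsLocalFlow (fun x : M ↦ (0 : TangentSpace 𝓘(ℝ, E) x)) (fun _ x ↦ x) ε univ where
  pos := hε
  isOpen := isOpen_univ
  smooth := contMDiffOn_snd
  zero _ _ := rfl
  integralCurve _ _ := (isMIntegralCurve_const rfl).isMIntegralCurveOn _

/-! ### Extremality implies the Euler–Lagrange equations -/

section Necessity

variable {n m : ℕ} {X Y : Type*}
  [TopologicalSpace X] [T2Space X] [SecondCountableTopology X]
  [ChartedSpace (EBase n) X] [IsManifold (𝓡 (n + 1)) ∞ X] [MeasurableSpace X] [BorelSpace X]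
  [TopologicalSpace Y] [T2Space Y] [SecondCountableTopology Y]
  [ChartedSpace (ETot n m) Y] [IsManifold (𝓡 (n + 1 + m)) ∞ Y]
  {P : Fibration n m X Y} {η : DiffForm (EBase n) X (n + 1)} {L : Jet P → ℝ} {φ : X → Y}
  {c : FiberedChart P}

theorem FiberedChart.velocity_vertFlow {g : EBase n → ℝ} {v : EFib m} (hφ : P.IsSection φ) {x : X}
    (hx : φ x ∈ c.total.source)
    (hfam : IsSectionFamily P (fun t x ↦ c.vertFlow g v t (φ x)) (0, x))
    (hmem : ∀ᶠ t in 𝓝 (0 : ℝ), c.total (φ x) + t • ((0 : EBase n), g (c.total (φ x)).1 • v)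
      ∈ c.total.target) :
    c.velocity (fun t x ↦ c.vertFlow g v t (φ x)) (c.base x) = g (c.base x) • v := by
  obtain ⟨hxb, htot⟩ := c.total_eq (hφ.proj_apply x) hx
  have h1 := FiberedChart.hasDerivAt_repFam hfam (by rwa [vertFlow_zero])
  have h2 : HasDerivAt (fun t : ℝ ↦ c.rep φ (c.base x) + t • (g (c.base x) • v))
      (g (c.base x) • v) 0 := by
    simpa using ((hasDerivAt_id (0 : ℝ)).smul_const (g (c.base x) • v)).const_add
      (c.rep φ (c.base x))
  refine h1.unique (h2.congr_of_eventuallyEq ?_)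
  filter_upwards [hmem] with t ht
  have h3 : c.vertFlow g v t (φ x)
      = c.total.symm (c.total (φ x) + t • ((0 : EBase n), g (c.total (φ x)).1 • v)) := if_pos hx
  change (c.total (c.vertFlow g v t (φ (c.base.symm (c.base x))))).2 = _
  rw [c.base.left_inv hxb, h3, c.total.right_inv ht, htot]
  simp

/-- Extremality is applied to the closed coordinate ball and a vertical field with velocity `g v`
along `φ`, projecting to the zero field. As `g` is supported in the open ball, the field vanishes on
`φ(∂C)` and the boundary does not contribute to the first variation formula. -/
theorem integral_smul_EL_eq_zero (hη : IsVolumeForm η) (hL : ContMDiff 𝓘(ℝ, EJet n m) 𝓘(ℝ, ℝ) ∞ L)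
    (hφ : P.IsSection φ) (h : IsExtremal η L φ) (z₀ : Jet P) {a₀ : EBase n} {r : ℝ} (hr : 0 < r)
    {s : ℝ} (hball : ∀ a ∈ Metric.closedBall a₀ r, a ∈ c.base.target ∧
      φ (c.base.symm a) ∈ c.total.source ∧ |chartDensity η c.base a| = s * chartDensity η c.base a)
    {g : EBase n → ℝ} (hg : ContDiff ℝ ∞ g) (hgc : HasCompactSupport g)
    (hgs : tsupport g ⊆ Metric.ball a₀ r) (v : EFib m) :
    ∫ a, g a • c.EL η L z₀ φ a v = 0 := by
  have : LocallyCompactSpace Y := ChartedSpace.locallyCompactSpace (ETot n m) Y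
  have htar : Metric.closedBall a₀ r ⊆ c.base.target := fun a ha ↦ (hball a ha).1
  have hsub := Metric.ball_subset_closedBall (x := a₀) (ε := r)
  set C := c.base.symm '' Metric.closedBall a₀ r with hCdef
  have hC : IsCompactDomain n C := isCompactDomain_closedBall c.isSmoothChart_base hr htar
  have hCs : C ⊆ c.base.source := by
    rintro _ ⟨a, ha, rfl⟩
    exact c.base.map_target (htar ha)
  have hCtot : ∀ x ∈ C, φ x ∈ c.total.source := by
    rintro _ ⟨a, ha, rfl⟩
    exact (hball a ha).2.1
  set N := c.base.symm '' Metric.ball a₀ r with hNdef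
  have hNC : N ⊆ C := image_mono hsub
  have hNo : IsOpen N := by
    have := c.base.symm.isOpen_image_of_subset_source Metric.isOpen_ball (hsub.trans htar)
    exact this
  have hNint : N ⊆ interior C := interior_maximal hNC hNo
  have hbN : c.base '' N = Metric.ball a₀ r := by
    rw [hNdef, image_image]
    refine (image_congr fun a ha ↦ ?_).trans (image_id _)
    exact c.base.right_inv (htar (hsub ha))
  set K := c.base.symm '' tsupport g with hKdef
  have hKN : K ⊆ N := image_mono hgs
  have hK : IsCompact K := hgc.isCompact.image_of_continuousOn
    (c.base.continuousOn_symm.mono ((hgs.trans hsub).trans htar))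
  have hQ : IsCompact (φ '' C) := hC.isCompact.image hφ.smooth.continuous
  have hQs : φ '' C ⊆ c.total.source := by
    rintro _ ⟨x, hx, rfl⟩
    exact hCtot x hx
  -- The cut-off is 1 near `φ(C)`, so it does not affect the variation for small times, and it is
  -- zero near the complement of the chart.
  obtain ⟨ψ, hψ0, hψ1, -⟩ := exists_contMDiffMap_zero_one_nhds_of_isClosed (n := ⊤)
    (𝓡 (n + 1 + m)) c.total.open_source.isClosed_compl hQ.isClosed
    (disjoint_compl_left_iff_subset.2 hQs)
  have hsupp : tsupport ψ ⊆ c.total.source := by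
    intro y hy
    by_contra hys
    have h1 : ∀ᶠ y' in 𝓝 y, ψ y' = 0 := mem_nhdsSet_iff_forall.1 hψ0 y hys
    exact (notMem_tsupport_iff_eventuallyEq.2 h1) hy
  obtain ⟨ε, V, hQV, -, hVmem, hflow⟩ :=
    FiberedChart.exists_isLocalFlow_vertFlow (v := v) hg hQ hQs hψ1
  have hξY : SmoothField (c.vertField ψ g v) :=
    FiberedChart.smoothField_vertField ψ.contMDiff hsupp hg
  have hξX : SmoothField (fun x : X ↦ (0 : TangentSpace (𝓡 (n + 1)) x)) := smoothField_zero
  have hX := isLocalFlow_zero (E := EBase n) (M := X) hflow.pos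
  have hproj : ∀ y, P.dproj y (c.vertField ψ g v y)
      = (fun x : X ↦ (0 : TangentSpace (𝓡 (n + 1)) x)) (P.proj y) :=
    FiberedChart.dproj_vertField hsupp
  have hg0 : ∀ x, x ∉ K → φ x ∈ c.total.source → g (c.total (φ x)).1 = 0 := by
    intro x hxK hxs
    obtain ⟨hxb, htot⟩ := c.total_eq (hφ.proj_apply x) hxs
    rw [htot]
    refine image_eq_zero_of_notMem_tsupport fun hx ↦ hxK ⟨_, hx, c.base.left_inv hxb⟩
  have hact := h C hC (c.vertField ψ g v) _ hξY hξX hproj (fun x hx ↦ by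
    have hxC := hC.isCompact.isClosed.frontier_subset hx
    refine FiberedChart.vertField_eq_zero ?_
    rw [hg0 x (fun hxK ↦ hx.2 (hNint (hKN hxK))) (hCtot x hxC), mul_zero])
    _ _ ε V univ hflow hX (subset_univ _) hQV
  have hfam : ∀ x ∈ C, IsSectionFamily P (fun t x ↦ c.vertFlow g v t (φ x)) (0, x) := fun x hx ↦
    isSectionFamily_flow hφ hξX hproj hflow hX (mem_univ x) (hQV (mem_image_of_mem _ hx))
  have hzero : (fun x ↦ c.vertFlow g v 0 (φ x)) = φ := funext fun x ↦
    FiberedChart.vertFlow_zero (φ x)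
  have hint := (hasDerivAt_action hη hL hC.isCompact hfam).unique hact
  rw [integral_varLag_eq hη hL hC.isCompact hfam c z₀ hNo hK hKN
    (fun x hx ↦ by rw [FiberedChart.vertFlow_zero]; exact hCtot x (hNC hx))
    (fun x hx ↦ hfam x (hNC hx)) ?_ s ?_ ?_ ?_] at hint
  -- The sign `s` can be cancelled because the density of a volume form never vanishes.
  · have hs : s ≠ 0 := by
      rintro rfl
      have h1 := hball a₀ (Metric.mem_closedBall_self hr.le)
      have h2 := h1.2.2
      rw [zero_mul, abs_eq_zero] at h2
      exact chartDensity_ne_zero c.isSmoothChart_base hη h1.1 h2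
    have h1 := (mul_eq_zero.1 hint).resolve_left hs
    rw [inter_eq_right.2 hNC, hbN, hzero] at h1
    rw [← setIntegral_eq_integral_of_forall_compl_eq_zero (s := Metric.ball a₀ r), ← h1]
    · refine setIntegral_congr_fun measurableSet_ball fun a ha ↦ ?_
      have hab := hball a (hsub ha)
      have hxC : c.base.symm a ∈ C := mem_image_of_mem _ (hsub ha)
      have h2 := FiberedChart.velocity_vertFlow hφ hab.2.1 (hfam _ hxC) (by
        filter_upwards [isOpen_Ioo.mem_nhds hflow.zero_mem] with t ht
        exact hVmem t ht _ (hQV (mem_image_of_mem _ hxC)))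
      rw [c.base.right_inv hab.1] at h2
      beta_reduce
      rw [h2, map_smul]
    · intro a ha
      rw [image_eq_zero_of_notMem_tsupport fun h ↦ ha (hgs h), zero_smul]
  · intro x hx
    have h1 : ∀ᶠ p in 𝓝 ((0 : ℝ), x), p.2 ∉ K :=
      (continuousAt_snd (p := ((0 : ℝ), x))).preimage_mem_nhds
        (hK.isClosed.isOpen_compl.mem_nhds hx)
    filter_upwards [h1] with p hp
    rw [FiberedChart.vertFlow_eq_self (hg0 p.2 hp), FiberedChart.vertFlow_zero]
  · rintro _ ⟨a, ha, rfl⟩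
    rw [c.base.right_inv (htar (hsub ha))]
    exact (hball a (hsub ha)).2.2
  · exact fun x hx ↦ absurd (hNint hx.2) hx.1.2
  · have h1 : frontier C ∩ N = ∅ := eq_empty_of_forall_notMem fun x hx ↦ hx.1.2 (hNint hx.2)
    rw [h1, image_empty, measure_empty]

/-- The Euler–Lagrange equations of an extremal. -/
theorem EL_eq_zero_of_isExtremal (hη : IsVolumeForm η) (hL : ContMDiff 𝓘(ℝ, EJet n m) 𝓘(ℝ, ℝ) ∞ L)
    (hφ : P.IsSection φ) (h : IsExtremal η L φ) (z₀ : Jet P) {x : X}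
    (hx : φ x ∈ c.total.source) : c.EL η L z₀ φ (c.base x) = 0 := by
  obtain ⟨hxb, hev⟩ := c.eventually_rep (hφ.isSectionNear x) hx z₀
  have hbt := c.base.map_source hxb
  obtain ⟨s, hs⟩ := exists_sign (contDiffAt_chartDensity c.isSmoothChart_base hη hbt).continuousAt
    (chartDensity_ne_zero c.isSmoothChart_base hη hbt)
  obtain ⟨r, hr, hball⟩ := Metric.nhds_basis_closedBall.mem_iff.1
    ((c.eventually_base hxb hev).and hs)
  have hsub := Metric.ball_subset_closedBall (x := c.base x) (ε := r)
  ext v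
  have hcont : ContinuousOn (fun a ↦ c.EL η L z₀ φ a v) (Metric.ball (c.base x) r) := by
    intro a ha
    obtain ⟨⟨h1, hat⟩, -⟩ := hball (hsub ha)
    rw [c.base.right_inv hat] at h1
    have h2 : ContDiffAt ℝ ∞ (c.EL η L z₀ φ) a := contDiffAt_eulerLagrange
      (contDiffAt_chartDensity c.isSmoothChart_base hη hat)
      (c.contDiffAt_locLag z₀ hL h1.2.2.2.1) h1.2.2.1
    exact (h2.continuousAt.clm_apply continuousAt_const).continuousWithinAt
  -- The fundamental lemma of the calculus of variations gives vanishing almost everywhere on the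
  -- ball, and continuity extends this to its centre.
  have hae := Metric.isOpen_ball.ae_eq_zero_of_integral_contDiff_smul_eq_zero
    (hcont.locallyIntegrableOn measurableSet_ball (μ := volume)) fun g hg hgc hgs ↦
      integral_smul_EL_eq_zero hη hL hφ h z₀ hr (s := s) (fun a ha ↦
        ⟨(hball ha).1.2, (hball ha).1.1.2.1, (hball ha).2⟩) hg hgc hgs v
  exact Measure.eqOn_open_of_ae_eq (g := fun _ ↦ (0 : ℝ))
    ((ae_restrict_iff' measurableSet_ball).2 hae) Metric.isOpen_ball hcont continuousOn_const
    (Metric.mem_ball_self hr)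

end Necessity

end ClassicalField

end

theorem mainTheorem5 {n m : ℕ} {X Y : Type*}
    [TopologicalSpace X] [T2Space X] [SecondCountableTopology X]
    [ChartedSpace (EBase n) X] [IsManifold (𝓡 (n + 1)) ∞ X]
    [MeasurableSpace X] [BorelSpace X]
    [TopologicalSpace Y] [T2Space Y] [SecondCountableTopology Y]
    [ChartedSpace (ETot n m) Y] [IsManifold (𝓡 (n + 1 + m)) ∞ Y]
    (P : Fibration n m X Y)
    (η : DiffForm (EBase n) X (n + 1)) (hη : IsVolumeForm η)
    (L : Jet P → ℝ) (hL : ContMDiff 𝓘(ℝ, EJet n m) 𝓘(ℝ, ℝ) ∞ L)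
    (φ : X → Y) (hφ : P.IsSection φ) :
    IsExtremal η L φ ↔
      ∀ ξ : (z : Jet P) → TangentSpace 𝓘(ℝ, EJet n m) z, SmoothField ξ →
        pullback (P.jet1 φ) (interiorProduct ξ (poincareCartanTwo η L))
          = (0 : DiffForm (EBase n) X (n + 1)) := by
  refine ⟨fun h ξ _ ↦ ?_, isExtremal_of_pullback hη hL hφ⟩
  funext x
  -- One fibered chart around `φ x` suffices, since the pullback at `x` depends only on the
  -- Euler–Lagrange expression at this point.
  obtain ⟨c, hc⟩ := P.exists_fiberedChart (φ x)
  exact pullback_interiorProduct_eq_zero hη hL (hφ.isSectionNear x) c hc (P.jet1 φ x)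
    (EL_eq_zero_of_isExtremal hη hL hφ h (P.jet1 φ x) hc) ξ
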